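/- Let $n\ge 3$ and let $C\in\mathbb{R}^{n\times n}$ be a relative interaction matrix, i.e. row-stochastic with zero diagonal. Let $\Delta_n$ be the unit simplex in $\mathbb{R}^n$ with vertices $e_1,\dots,e_n$, and let $x(t+1)=F(x(t))$ with $F(x)=C^\top(x-x^2)+x^2$, where $x^2$ is the entrywise square. Let $G(C)$ be the digraph on $\{1,\dots,n\}$ with an edge from $i$ to $j$ iff $C_{ij}>0$, and suppose that its condensation digraph (the digraph of strongly connected components) has $K\ge2$ sinks (components without outgoing edges), with node sets $S_1,\dots,S_K$ and $n_k=|S_k|$. A node in no sink is called reducible. For $x\in\mathbb{R}^n$ let $\zeta_k(x)=\sum_{i\in S_k}x_i$. Sink $k$ is a star with center $i\in S_k$ if every edge inside $S_k$ starts or ends at $i$. Each sink $k$ has a unique centrality vector $c^{(k)}\in\Delta_n$, positive exactly on $S_k$, with $(c^{(k)})^\top C=(c^{(k)})^\top$. For a split $\zeta^*\in\Delta_K$, call sink $k$ a full star if it is a star, $n_k\ge3$ and $\zeta^*_k=1$. (i) Equilibria. The set of fixed points of $F$ in $\Delta_n$ is the union of $\{e_1,\dots,e_n\}$ and of the set of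 the points $x^*=x^*(\zeta^*)$, $\zeta^*\in\Delta_K$, where $x^*(\zeta^*)$ denotes a fixed point $x^*\in\Delta_n$ with $\zeta_k(x^*)=\zeta^*_k$ for all $k$ and the following properties: (i.1) $x^*_i=0$ for every reducible node $i$; (i.2) if $n_k=2$ and $\zeta^*_k<1$, then $x^*_i=\zeta^*_k/2$ for $i\in S_k$; if $S_k=\{i,j\}$ with $i\neq j$ and $\zeta^*_k=1$, then $x^*_i=\alpha$ and $x^*_j=1-\alpha$ for some $\alpha\in[0,1]$; (i.3) if $n_k\ge3$ and $i\in S_k$, then $x^*_i=0$ if $\zeta^*_k=0$, and $x^*_i>0$ if $\zeta^*_k>0$ and sink $k$ is not a full star; if sink $k$ is a full star with center $i$, then $x^*=e_i$; (i.4) if $n_k\ge3$, $\zeta^*_k>0$ and sink $k$ is not a full star, then for all $i,j\in S_k$: $x^*_i<x^*_j$ iff $c^{(k)}_i<c^{(k)}_j$. Such an $x^*(\zeta^*)$ exists for every $\zeta^*\in\Delta_K$. It is uniquely determined by $\zeta^*$ unless $\zeta^*_k=1$ for a sink $S_k=\{i,j\}$ with two nodes, in which case every $\alpha e_i+(1-\alpha)e_j$,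 $\alpha\in[0,1]$, is such an $x^*(\zeta^*)$. (ii) Monotonicity of sink social power. For every $x(0)\in\Delta_n$, every sink $k$ and every $t\ge0$, $\zeta_k(x(t+1))\ge\zeta_k(x(t))$. If $\zeta_k(x(0))=0$ and $x_i(0)=0$ for every reducible node $i$ from which $G(C)$ has a directed path to $S_k$, then $\zeta_k(x(t))=0$ for all $t\ge0$, and $\zeta_k$ vanishes at the limit of $x(t)$ whenever this limit exists. (iii) Convergence. For every $x(0)\in\Delta_n\setminus\{e_1,\dots,e_n\}$ there are $\zeta^*\in\Delta_K$ and an equilibrium $x^*=x^*(\zeta^*)$ as in (i) such that $x(t)\to x^*$ as $t\to\infty$. Unless some sink is a full star for $\zeta^*$, the convergence is exponential: there are $A\in\mathbb{R}$ and $r\in(0,1)$ with $\|x(t)-x^*\|\le A r^t$ for all $t\ge0$. -/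

import Mathlib

open scoped Matrix Topology

/-- A relative interaction matrix: row-stochastic with zero diagonal. -/
def IsRelativeInteraction {n : ℕ} (C : Matrix (Fin n) (Fin n) ℝ) : Prop :=
  C ∈ Matrix.rowStochastic ℝ (Fin n) ∧ ∀ i, C i i = 0

/-- The single-timescale DeGroot-Friedkin map `F(x) = Cᵀ (x - x²) + x²`, squares entrywise. -/
noncomputable def dfMap {n : ℕ} (C : Matrix (Fin n) (Fin n) ℝ) (x : Fin n → ℝ) : Fin n → ℝ :=
  Cᵀ *ᵥ (x - x ^ 2) + x ^ 2

/-- The digraph `G(C)` has an edge from `i` to `j` when `C i j > 0`; `Reaches C i j` says that it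
contains a directed path (possibly of length zero) from `i` to `j`. -/
def Reaches {n : ℕ} (C : Matrix (Fin n) (Fin n) ℝ) : Fin n → Fin n → Prop :=
  Relation.ReflTransGen (fun i j => 0 < C i j)

/-- Mutual reachability; its classes are the strongly connected components of `G(C)`. -/
def sccSetoid {n : ℕ} (C : Matrix (Fin n) (Fin n) ℝ) : Setoid (Fin n) where
  r i j := Reaches C i j ∧ Reaches C j i
  iseqv :=
    { refl := fun _ => ⟨Relation.ReflTransGen.refl, Relation.ReflTransGen.refl⟩
      symm := fun h => ⟨h.2, h.1⟩
      trans := fun h h' => ⟨h.1.trans h'.1, h'.2.trans h.2⟩ }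

/-- Nodes of the condensation digraph `D(G(C))`: the strongly connected components of `G(C)`. -/
abbrev Condensation {n : ℕ} (C : Matrix (Fin n) (Fin n) ℝ) : Type :=
  Quotient (sccSetoid C)

/-- Edges of the condensation digraph: distinct components joined by an edge of `G(C)`. -/
def condensationAdj {n : ℕ} (C : Matrix (Fin n) (Fin n) ℝ) (A B : Condensation C) : Prop :=
  A ≠ B ∧ ∃ i j : Fin n,
    Quotient.mk (sccSetoid C) i = A ∧ Quotient.mk (sccSetoid C) j = B ∧ 0 < C i j

/-- The sinks of the condensation digraph: the components without outgoing edges. -/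
abbrev Sink {n : ℕ} (C : Matrix (Fin n) (Fin n) ℝ) : Type :=
  {A : Condensation C // ∀ B, ¬ condensationAdj C A B}

noncomputable instance instFintypeSink {n : ℕ} (C : Matrix (Fin n) (Fin n) ℝ) :
    Fintype (Sink C) :=
  Fintype.ofFinite _

open scoped Classical in
/-- The set of nodes of sink `k`. -/
noncomputable def sinkNodes {n : ℕ} (C : Matrix (Fin n) (Fin n) ℝ) (k : Sink C) :
    Finset (Fin n) :=
  Finset.univ.filter (fun i => Quotient.mk (sccSetoid C) i = k.1)

/-- A node is reducible when it belongs to no sink. -/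
def IsReducibleNode {n : ℕ} (C : Matrix (Fin n) (Fin n) ℝ) (i : Fin n) : Prop :=
  ∀ k : Sink C, i ∉ sinkNodes C k

/-- The social power of sink `k`: the sum of the self-weights of its nodes. -/
noncomputable def sinkPower {n : ℕ} (C : Matrix (Fin n) (Fin n) ℝ) (x : Fin n → ℝ)
    (k : Sink C) : ℝ :=
  ∑ i ∈ sinkNodes C k, x i

/-- `c` is the dominant left eigenvector of the block of `C` on sink `k`, extended by zero to all
nodes: a nonnegative vector of total `1`, positive exactly on sink `k`, with `cᵀ C = cᵀ`. -/
def IsSinkCentrality {n : ℕ} (C : Matrix (Fin n) (Fin n) ℝ) (k : Sink C)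
    (c : Fin n → ℝ) : Prop :=
  c ∈ stdSimplex ℝ (Fin n) ∧ (∀ i, 0 < c i ↔ i ∈ sinkNodes C k) ∧ c ᵥ* C = c

/-- Sink `k` has star topology with center node `i`: every edge inside the sink starts or ends
at `i`. -/
def IsStarCenter {n : ℕ} (C : Matrix (Fin n) (Fin n) ℝ) (k : Sink C) (i : Fin n) : Prop :=
  i ∈ sinkNodes C k ∧
    ∀ a ∈ sinkNodes C k, ∀ b ∈ sinkNodes C k, 0 < C a b → a = i ∨ b = i

/-- The total power `ζ` is concentrated in sink `k`, and this sink is a star on at least three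
nodes. -/
def IsFullStar {n : ℕ} (C : Matrix (Fin n) (Fin n) ℝ) (ζ : Sink C → ℝ) (k : Sink C) : Prop :=
  3 ≤ (sinkNodes C k).card ∧ (∃ i, IsStarCenter C k i) ∧ ζ k = 1

/-- `x` is an equilibrium `x*(ζ)` associated with the split `ζ` of the total power. -/
structure IsSplitEquilibrium {n : ℕ} (C : Matrix (Fin n) (Fin n) ℝ) (ζ : Sink C → ℝ)
    (x : Fin n → ℝ) : Prop where
  mem_simplex : x ∈ stdSimplex ℝ (Fin n)
  fixed : dfMap C x = x
  power : ∀ k, sinkPower C x k = ζ k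
  reducible : ∀ i, IsReducibleNode C i → x i = 0
  pair : ∀ k, (sinkNodes C k).card = 2 → ζ k < 1 → ∀ i ∈ sinkNodes C k, x i = ζ k / 2
  pair_full : ∀ k, ζ k = 1 → ∀ i j, i ≠ j → sinkNodes C k = {i, j} →
    ∃ α ∈ Set.Icc (0 : ℝ) 1, x i = α ∧ x j = 1 - α
  zero : ∀ k, 3 ≤ (sinkNodes C k).card → ζ k = 0 → ∀ i ∈ sinkNodes C k, x i = 0
  pos : ∀ k, 3 ≤ (sinkNodes C k).card → 0 < ζ k → ¬ IsFullStar C ζ k →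
    ∀ i ∈ sinkNodes C k, 0 < x i
  ranking : ∀ k, 3 ≤ (sinkNodes C k).card → 0 < ζ k → ¬ IsFullStar C ζ k →
    ∀ c, IsSinkCentrality C k c →
      ∀ i ∈ sinkNodes C k, ∀ j ∈ sinkNodes C k, (x i < x j ↔ c i < c j)
  star_full : ∀ k, IsFullStar C ζ k → ∀ i, IsStarCenter C k i → x = Pi.single i 1

/-! ### Elementary facts on the digraph, the sinks and the split of the total mass -/

section Basics

variable {n : ℕ} {C : Matrix (Fin n) (Fin n) ℝ}

/-! Write $y = x - x^2$. Then $F(x) - x = C^\top y - y$, so $x$ is fixed iff $y$ is a stationary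
vector of the chain `C` (`dfMap_eq_self_iff`). Nonnegative stationary vectors vanish on reducible
nodes and are multiples of the centrality on each sink. An equilibrium that is not a vertex
therefore satisfies $x_i(1-x_i) = l_k c^{(k)}_i$ on sink $k$. The ranking follows from
$(x_j-x_i)(1-x_i-x_j) = l_k(c_j-c_i)$. On sinks with at least three nodes, the split determines $x$
because two positive vectors of equal sum with proportional logistic values coincide
(`eq_of_logistic_proportional`).

For convergence, sink powers never decrease, so from a non-vertex start some sink eventually keeps a
positive share. Reducible entries then stay away from 1, and a weighted reducible mass contracts
(`exists_reducibleMass_le`). Up to this geometrically small error, $V = \sum_i (x_i^2/2 -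
x_i^3/3)/c_i$ decreases, where $c$ is stationary and positive exactly on the sinks: $\nabla V =
y/c$, and $C^\top$ contracts the $\ell^2$ norm with weights $1/c$. So every subsequential limit is
an equilibrium (`fixed_of_tendsto_subseq`). If no two-node sink takes all the power, the candidates
are the vertices and the only equilibrium with the limiting split; they are finitely many, so the
orbit converges, and vertices of sinks that are not star centers are excluded because they repel
(`not_tendsto_single`). If a two-node sink takes all the power, the equilibria fill a segment, but
the increments are bounded by the power still outside the pair, and the orbit is Cauchy at a
geometric rate.

The other rates come from the Hessian $\sum_i (1-2x_i)v_i^2/c_i$ of $V$ at the limit. It may be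
indefinite, yet it decreases strictly along the derivative of $F$ on variations that preserve the
support and the sink powers (`diagForm_dfDeriv_lt`). A quantity that decreases up to geometric
errors and tends to zero cannot be far below zero, so definiteness is not needed
(`exists_geometric_bound_of_lyapunov`). -/

lemma IsRelativeInteraction.nonneg (hC : IsRelativeInteraction C) (i j : Fin n) : 0 ≤ C i j :=
  Matrix.nonneg_of_mem_rowStochastic hC.1

lemma IsRelativeInteraction.sum_row (hC : IsRelativeInteraction C) (i : Fin n) :
    ∑ j, C i j = 1 :=
  Matrix.sum_row_of_mem_rowStochastic hC.1 i

lemma IsRelativeInteraction.le_one (hC : IsRelativeInteraction C) (i j : Fin n) : C i j ≤ 1 :=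
  Matrix.le_one_of_mem_rowStochastic hC.1

lemma IsRelativeInteraction.exists_pos (hC : IsRelativeInteraction C) (i : Fin n) :
    ∃ j, j ≠ i ∧ 0 < C i j := by
  by_contra! h
  have h0 : ∀ j, C i j = 0 := fun j => by
    by_cases hj : j = i
    · rw [hj]; exact hC.2 i
    · exact le_antisymm (h j hj) (hC.nonneg i j)
  have := hC.sum_row i
  simp [h0] at this

lemma dfMap_apply (x : Fin n → ℝ) (j : Fin n) :
    dfMap C x j = ∑ i, C i j * (x i - x i ^ 2) + x j ^ 2 := by
  simp [dfMap, Matrix.mulVec, dotProduct]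

lemma vecMul_eq_iff {u : Fin n → ℝ} : u ᵥ* C = u ↔ ∀ j, ∑ i, u i * C i j = u j := by
  simp [funext_iff, Matrix.vecMul, dotProduct]

lemma mem_sinkNodes {k : Sink C} {i : Fin n} :
    i ∈ sinkNodes C k ↔ Quotient.mk (sccSetoid C) i = k.1 := by
  simp [sinkNodes]

lemma sinkNodes_nonempty (k : Sink C) : (sinkNodes C k).Nonempty := by
  obtain ⟨i, hi⟩ := Quotient.exists_rep k.1
  exact ⟨i, mem_sinkNodes.2 hi⟩

lemma sink_eq {k l : Sink C} {i : Fin n} (hk : i ∈ sinkNodes C k) (hl : i ∈ sinkNodes C l) :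
    k = l :=
  Subtype.ext ((mem_sinkNodes.1 hk).symm.trans (mem_sinkNodes.1 hl))

lemma sink_reaches {k : Sink C} {i j : Fin n} (hi : i ∈ sinkNodes C k) (hj : j ∈ sinkNodes C k) :
    Reaches C i j :=
  (Quotient.exact ((mem_sinkNodes.1 hi).trans (mem_sinkNodes.1 hj).symm) :
    (sccSetoid C).r i j).1

lemma sink_closed {k : Sink C} {i j : Fin n} (hi : i ∈ sinkNodes C k) (h : 0 < C i j) :
    j ∈ sinkNodes C k := by
  by_contra hj
  rw [mem_sinkNodes] at hi hj
  exact k.2 _ ⟨fun he => hj he.symm, i, j, hi, rfl, h⟩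

lemma sink_closed_reaches {k : Sink C} {i j : Fin n} (hi : i ∈ sinkNodes C k)
    (h : Reaches C i j) : j ∈ sinkNodes C k := by
  induction h with
  | refl => exact hi
  | tail _ h ih => exact sink_closed ih h

lemma IsRelativeInteraction.sink_out (hC : IsRelativeInteraction C) {k : Sink C} {i j : Fin n}
    (hi : i ∈ sinkNodes C k) (hj : j ∉ sinkNodes C k) : C i j = 0 :=
  le_antisymm (not_lt.1 fun h => hj (sink_closed hi h)) (hC.nonneg i j)

lemma not_isReducibleNode {i : Fin n} : ¬ IsReducibleNode C i ↔ ∃ k, i ∈ sinkNodes C k := by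
  simp [IsReducibleNode]

lemma IsRelativeInteraction.nonred_out (hC : IsRelativeInteraction C) {i j : Fin n}
    (hi : ¬ IsReducibleNode C i) (hj : IsReducibleNode C j) : C i j = 0 := by
  obtain ⟨k, hk⟩ := not_isReducibleNode.1 hi
  exact hC.sink_out hk (hj k)

lemma IsRelativeInteraction.sum_sink (hC : IsRelativeInteraction C) {k : Sink C} {i : Fin n}
    (hi : i ∈ sinkNodes C k) : ∑ j ∈ sinkNodes C k, C i j = 1 := by
  rw [← hC.sum_row i]
  exact Finset.sum_subset (Finset.subset_univ _) fun j _ hj => hC.sink_out hi hj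

lemma IsRelativeInteraction.exists_pos_sink (hC : IsRelativeInteraction C) {k : Sink C}
    {i : Fin n} (hi : i ∈ sinkNodes C k) : ∃ j ∈ sinkNodes C k, j ≠ i ∧ 0 < C i j := by
  obtain ⟨j, hj, h⟩ := hC.exists_pos i
  exact ⟨j, sink_closed hi h, hj, h⟩

lemma IsRelativeInteraction.two_le_card (hC : IsRelativeInteraction C) (k : Sink C) :
    2 ≤ (sinkNodes C k).card := by
  obtain ⟨i, hi⟩ := sinkNodes_nonempty k
  obtain ⟨j, hj, hne, -⟩ := hC.exists_pos_sink hi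
  exact Finset.one_lt_card.2 ⟨j, hj, i, hi, hne⟩

/-- Every node reaches some sink. -/
lemma exists_sink_reaches (C : Matrix (Fin n) (Fin n) ℝ) (i : Fin n) :
    ∃ k : Sink C, ∃ j ∈ sinkNodes C k, Reaches C i j := by
  classical
  -- Among the descendants of `i`, one with the fewest descendants lies in a sink: the descendants
  -- of any successor are among its own, so minimality makes the two sets equal and gives a path
  -- back.
  obtain ⟨j, hj, hmin⟩ := Finset.exists_min_image
    (Finset.univ.filter fun j => Reaches C i j)
    (fun j => (Finset.univ.filter fun l => Reaches C j l).card)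
    ⟨i, Finset.mem_filter.2 ⟨Finset.mem_univ i, Relation.ReflTransGen.refl⟩⟩
  simp only [Finset.mem_filter, Finset.mem_univ, true_and] at hj hmin
  refine ⟨⟨Quotient.mk (sccSetoid C) j, ?_⟩, j, mem_sinkNodes.2 rfl, hj⟩
  rintro B ⟨hne, a, b, ha, rfl, hab⟩
  have haj : Reaches C a j ∧ Reaches C j a := (Quotient.exact ha : (sccSetoid C).r a j)
  have hjb : Reaches C j b := haj.2.tail hab
  have hsub : (Finset.univ.filter fun l => Reaches C b l) ⊆
      (Finset.univ.filter fun l => Reaches C j l) := by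
    intro l hl
    simp only [Finset.mem_filter, Finset.mem_univ, true_and] at hl ⊢
    exact hjb.trans hl
  have heq := Finset.eq_of_subset_of_card_le hsub (hmin b (hj.trans hjb))
  have hbj : Reaches C b j := by
    have : j ∈ (Finset.univ.filter fun l => Reaches C b l) := by
      rw [heq]; exact Finset.mem_filter.2 ⟨Finset.mem_univ j, Relation.ReflTransGen.refl⟩
    simpa using this
  exact hne (Quotient.sound (show (sccSetoid C).r j b from ⟨hjb, hbj⟩))

open scoped Classical in
/-- The total weight of the reducible nodes. -/
noncomputable def reducibleMass (C : Matrix (Fin n) (Fin n) ℝ) (x : Fin n → ℝ) : ℝ :=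
  ∑ i with IsReducibleNode C i, x i

open scoped Classical in
lemma sum_eq_sum_sinkPower_add (C : Matrix (Fin n) (Fin n) ℝ) (x : Fin n → ℝ) :
    ∑ i, x i = ∑ k, sinkPower C x k + reducibleMass C x := by
  rw [reducibleMass, ← Finset.sum_filter_not_add_sum_filter Finset.univ (IsReducibleNode C)]
  congr 1
  unfold sinkPower
  rw [← Finset.sum_biUnion]
  · refine Finset.sum_congr ?_ fun _ _ => rfl
    ext i
    simp [not_isReducibleNode]
  · intro k _ l _ hkl
    exact Finset.disjoint_left.2 fun i hi hj => hkl (sink_eq hi hj)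

lemma reducibleMass_nonneg {x : Fin n → ℝ} (hx : ∀ i, 0 ≤ x i) : 0 ≤ reducibleMass C x :=
  Finset.sum_nonneg fun i _ => hx i

lemma sinkPower_nonneg {x : Fin n → ℝ} (hx : ∀ i, 0 ≤ x i) (k : Sink C) : 0 ≤ sinkPower C x k :=
  Finset.sum_nonneg fun i _ => hx i

lemma le_sinkPower {x : Fin n → ℝ} (hx : ∀ i, 0 ≤ x i) {k : Sink C} {i : Fin n}
    (hi : i ∈ sinkNodes C k) : x i ≤ sinkPower C x k :=
  Finset.single_le_sum (f := x) (fun j _ => hx j) hi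

lemma le_reducibleMass {x : Fin n → ℝ} (hx : ∀ i, 0 ≤ x i) {i : Fin n}
    (hi : IsReducibleNode C i) : x i ≤ reducibleMass C x := by
  classical
  unfold reducibleMass
  exact Finset.single_le_sum (f := x) (fun j _ => hx j) (by simpa using hi)

lemma eq_zero_of_sinkPower_eq_zero {x : Fin n → ℝ} (hx : ∀ i, 0 ≤ x i) {k : Sink C}
    (h : sinkPower C x k = 0) {i : Fin n} (hi : i ∈ sinkNodes C k) : x i = 0 :=
  le_antisymm (h ▸ le_sinkPower hx hi) (hx i)

@[fun_prop]
lemma continuous_sinkPower (k : Sink C) : Continuous fun x : Fin n → ℝ => sinkPower C x k := by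
  unfold sinkPower; fun_prop

@[fun_prop]
lemma continuous_reducibleMass : Continuous fun x : Fin n → ℝ => reducibleMass C x := by
  unfold reducibleMass; fun_prop

@[fun_prop]
lemma continuous_dfMap : Continuous (dfMap C) := by
  refine continuous_pi fun j => ?_
  simp only [dfMap_apply]
  fun_prop

end Basics

/-! ### Weights that vary strictly along the chain -/

section Weights

/-- Superharmonic-type weights for a nonnegative kernel with reachable target set `T`. -/
lemma exists_hitting_weights {ι : Type*} [Fintype ι] (N : ι → ι → ℝ) (hN : ∀ i j, 0 ≤ N i j)
    (T : Set ι) :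
    ∃ h : ι → ℝ, (∀ i, 0 ≤ h i) ∧ (∀ i, h i ≤ 1) ∧ (∀ i ∈ T, h i = 1) ∧
      (∀ i, (∃ t ∈ T, Relation.ReflTransGen (fun a b => 0 < N a b) i t) → 0 < h i) ∧
      ∀ i ∉ T, 2 * h i ≤ ∑ j, N i j * h j := by
  classical
  obtain ⟨m, hm0, hm⟩ : ∃ m : ℝ, 0 < m ∧ ∀ i j, 0 < N i j → m ≤ N i j := by
    by_cases hne : (Finset.univ.filter fun p : ι × ι => 0 < N p.1 p.2).Nonempty
    · obtain ⟨p, hp, hmin⟩ := Finset.exists_min_image _ (fun p : ι × ι => N p.1 p.2) hne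
      refine ⟨N p.1 p.2, by simpa using hp, fun i j hij => hmin (i, j) (by simpa using hij)⟩
    · refine ⟨1, one_pos, fun i j hij => (hne ⟨(i, j), by simpa using hij⟩).elim⟩
  -- `D k i` says that a walk of length `k` leads from `i` to `T`.
  obtain ⟨D, hD0, hDs⟩ : ∃ D : ℕ → ι → Prop, (∀ i, D 0 i ↔ i ∈ T) ∧
      ∀ k i, D (k + 1) i ↔ ∃ j, 0 < N i j ∧ D k j :=
    ⟨fun k => Nat.rec (motive := fun _ => ι → Prop) (fun i => i ∈ T)
      (fun _ P i => ∃ j, 0 < N i j ∧ P j) k, fun _ => Iff.rfl, fun _ _ => Iff.rfl⟩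
  have hreach : ∀ i, (∃ t ∈ T, Relation.ReflTransGen (fun a b => 0 < N a b) i t) →
      ∃ k, D k i := by
    rintro i ⟨t, ht, h⟩
    induction h using Relation.ReflTransGen.head_induction_on with
    | refl => exact ⟨0, (hD0 t).2 ht⟩
    | head hab _ ih =>
      obtain ⟨k, hk⟩ := ih
      exact ⟨k + 1, (hDs _ _).2 ⟨_, hab, hk⟩⟩
  -- The weight is `q` to the power of the distance to `T`. Since `2 * q ≤ m`, the single edge that
  -- shortens the distance already pays for the factor 2.
  set q : ℝ := min (m / 2) 1 with hq
  have hq0 : 0 < q := lt_min (by positivity) one_pos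
  have hq1 : q ≤ 1 := min_le_right _ _
  have hqm : 2 * q ≤ m := by have := min_le_left (m / 2) 1; linarith
  let h : ι → ℝ := fun i => if hi : ∃ k, D k i then q ^ Nat.find (p := fun k => D k i) hi else 0
  have hpos : ∀ i, (∃ k, D k i) → 0 < h i := fun i hi => by
    simp only [h, dif_pos hi]; positivity
  have hnn : ∀ i, 0 ≤ h i := fun i => by
    simp only [h]; split_ifs <;> positivity
  refine ⟨h, hnn, fun i => ?_, fun i hi => ?_, fun i hi => hpos i (hreach i hi), fun i hi => ?_⟩
  · simp only [h]
    split_ifs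
    · exact pow_le_one₀ hq0.le hq1
    · exact zero_le_one
  · have : ∃ k, D k i := ⟨0, (hD0 i).2 hi⟩
    simp only [h, dif_pos this]
    rw [(Nat.find_eq_zero this).2 ((hD0 i).2 hi), pow_zero]
  · have hsn : 0 ≤ ∑ j, N i j * h j := Finset.sum_nonneg fun j _ => mul_nonneg (hN i j) (hnn j)
    by_cases hk : ∃ k, D k i
    · have hspec := Nat.find_spec hk
      have hne : Nat.find hk ≠ 0 := fun h0 => hi (by rw [h0] at hspec; exact (hD0 i).1 hspec)
      obtain ⟨k, hk'⟩ := Nat.exists_eq_succ_of_ne_zero hne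
      rw [hk', hDs] at hspec
      obtain ⟨j, hij, hj⟩ := hspec
      have hj' : ∃ k, D k j := ⟨k, hj⟩
      have h1 : q ^ k ≤ h j := by
        simp only [h, dif_pos hj']
        exact pow_le_pow_of_le_one hq0.le hq1 (Nat.find_min' hj' hj)
      have h2 : h i = q ^ (k + 1) := by simp only [h, dif_pos hk, hk']
      calc 2 * h i = (2 * q) * q ^ k := by rw [h2]; ring
        _ ≤ N i j * h j := mul_le_mul (hqm.trans (hm i j hij)) h1 (by positivity) (hN i j)
        _ ≤ _ := Finset.single_le_sum (f := fun j => N i j * h j)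
          (fun j _ => mul_nonneg (hN i j) (hnn j)) (Finset.mem_univ j)
    · have : h i = 0 := by simp only [h, dif_neg hk]
      rw [this]; simpa using hsn

variable {n : ℕ} {C : Matrix (Fin n) (Fin n) ℝ}

/-- Weights on the reducible nodes that decrease strictly along `C`. -/
lemma IsRelativeInteraction.exists_reducible_weights (hC : IsRelativeInteraction C) :
    ∃ w : Fin n → ℝ, ∃ η : ℝ, 0 < η ∧ (∀ i, ¬ IsReducibleNode C i → w i = 0) ∧
      (∀ i, IsReducibleNode C i → 1 / 2 ≤ w i) ∧ (∀ i, w i ≤ 1) ∧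
      (∀ i, IsReducibleNode C i → ∑ j, C i j * w j ≤ w i - η) ∧
      ∀ i, ¬ IsReducibleNode C i → ∑ j, C i j * w j = 0 := by
  obtain ⟨h, h0, h1, hT, hp, hs⟩ :=
    exists_hitting_weights C hC.nonneg {i | ¬ IsReducibleNode C i}
  have hpos : ∀ i, 0 < h i := fun i => hp i <| by
    obtain ⟨k, j, hj, hr⟩ := exists_sink_reaches C i
    exact ⟨j, not_isReducibleNode.2 ⟨k, hj⟩, hr⟩
  obtain ⟨η, hη, hle⟩ : ∃ η : ℝ, 0 < η ∧ ∀ i, η ≤ h i := by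
    rcases isEmpty_or_nonempty (Fin n) with he | he
    · exact ⟨1, one_pos, fun i => he.elim i⟩
    · obtain ⟨i, hi⟩ := Finite.exists_min h
      exact ⟨h i, hpos i, hi⟩
  have hsum : ∀ i, ∑ j, C i j * (1 - h j) = 1 - ∑ j, C i j * h j := fun i => by
    simp only [mul_sub, mul_one, Finset.sum_sub_distrib, hC.sum_row]
  -- For the weight `1 - h`, the bound `2 h ≤ C h` becomes a loss of at least `h ≥ η` in one step;
  -- combined with `C h ≤ 1` it gives `h ≤ 1 / 2` on reducible nodes.
  refine ⟨fun i => 1 - h i, η, hη, fun i hi => by simp [hT i hi], fun i hi => ?_, fun i => ?_,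
    fun i hi => ?_, fun i hi => ?_⟩
  · have h2 := hs i (by simpa using hi)
    have h3 : ∑ j, C i j * h j ≤ ∑ j, C i j :=
      Finset.sum_le_sum fun j _ => mul_le_of_le_one_right (hC.nonneg i j) (h1 j)
    rw [hC.sum_row] at h3
    linarith
  · have := h0 i
    linarith
  · have h2 := hs i (by simpa using hi)
    have := hle i
    rw [hsum]; linarith
  · refine Finset.sum_eq_zero fun j _ => ?_
    by_cases hj : IsReducibleNode C j
    · rw [hC.nonred_out hi hj, zero_mul]
    · simp [hT j hj]

end Weights

/-! ### Stationary vectors of the chain (Perron–Frobenius on sinks) -/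

section Perron

variable {n : ℕ} {C : Matrix (Fin n) (Fin n) ℝ}

lemma stationary_pos_of_reaches (hC : IsRelativeInteraction C) {u : Fin n → ℝ}
    (hu0 : ∀ i, 0 ≤ u i) (hu : u ᵥ* C = u) {i j : Fin n} (h : Reaches C i j) (hi : 0 < u i) :
    0 < u j := by
  induction h with
  | refl => exact hi
  | @tail a b _ hab ih =>
    rw [← vecMul_eq_iff.1 hu b]
    exact Finset.sum_pos' (fun l _ => mul_nonneg (hu0 l) (hC.nonneg l b))
      ⟨a, Finset.mem_univ a, mul_pos ih hab⟩

/-- The triangle inequality bounds each `|u j|` by the inflow of `|u|`. Both sides have the same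
total because rows sum to one, so equality holds entrywise. -/
lemma stationary_abs (hC : IsRelativeInteraction C) {u : Fin n → ℝ} (hu : u ᵥ* C = u) :
    (fun i => |u i|) ᵥ* C = fun i => |u i| := by
  rw [vecMul_eq_iff] at hu ⊢
  have hle : ∀ j ∈ Finset.univ, |u j| ≤ ∑ i, |u i| * C i j := fun j _ => by
    calc |u j| = |∑ i, u i * C i j| := by rw [hu j]
      _ ≤ ∑ i, |u i * C i j| := Finset.abs_sum_le_sum_abs _ _
      _ = _ := by simp only [abs_mul, abs_of_nonneg (hC.nonneg _ j)]
  have heq : ∑ j, |u j| = ∑ j, ∑ i, |u i| * C i j := by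
    rw [Finset.sum_comm]
    simp only [← Finset.mul_sum, hC.sum_row, mul_one]
  intro j
  exact ((Finset.sum_eq_sum_iff_of_le hle).1 heq j (Finset.mem_univ j)).symm

/-- The block of a sink is row-stochastic, so the identity minus this block kills the constant
vector and is singular. A left kernel vector, extended by zero, stays stationary because no edge
leaves the sink. -/
lemma exists_sink_stationary (hC : IsRelativeInteraction C) (k : Sink C) :
    ∃ u : Fin n → ℝ, u ≠ 0 ∧ (∀ i ∉ sinkNodes C k, u i = 0) ∧ u ᵥ* C = u := by
  classical
  let B : Matrix (sinkNodes C k) (sinkNodes C k) ℝ := 1 - C.submatrix Subtype.val Subtype.val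
  have hdet : B.det = 0 := by
    rw [← Matrix.exists_mulVec_eq_zero_iff]
    obtain ⟨i, hi⟩ := sinkNodes_nonempty k
    refine ⟨1, fun h => one_ne_zero (congrFun h ⟨i, hi⟩), ?_⟩
    ext a
    rw [Matrix.sub_mulVec, Matrix.one_mulVec]
    simp only [Pi.sub_apply, Pi.one_apply, Pi.zero_apply, Matrix.mulVec, dotProduct,
      Matrix.submatrix_apply, mul_one]
    rw [Finset.sum_coe_sort (sinkNodes C k) (fun b => C a b), hC.sum_sink a.2, sub_self]
  obtain ⟨v, hv0, hv⟩ := Matrix.exists_vecMul_eq_zero_iff.2 hdet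
  let u : Fin n → ℝ := fun i => if h : i ∈ sinkNodes C k then v ⟨i, h⟩ else 0
  have huv : ∀ a : sinkNodes C k, u a = v a := fun a => by simp [u]
  have hu0 : ∀ i ∉ sinkNodes C k, u i = 0 := fun i hi => by simp [u, hi]
  refine ⟨u, fun h => hv0 ?_, hu0, vecMul_eq_iff.2 fun j => ?_⟩
  · ext a
    rw [← huv a, h]; rfl
  · have hsum : ∑ i, u i * C i j = ∑ i ∈ sinkNodes C k, u i * C i j :=
      (Finset.sum_subset (Finset.subset_univ _) fun i _ hi => by rw [hu0 i hi, zero_mul]).symm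
    rw [hsum]
    by_cases hj : j ∈ sinkNodes C k
    · rw [Matrix.vecMul_sub, Matrix.vecMul_one] at hv
      have := congrFun hv ⟨j, hj⟩
      simp only [Pi.sub_apply, Pi.zero_apply, Matrix.vecMul, dotProduct,
        Matrix.submatrix_apply] at this
      rw [← Finset.sum_coe_sort (sinkNodes C k) (fun i => u i * C i j)]
      simp only [huv]
      rw [huv ⟨j, hj⟩]
      linarith
    · rw [hu0 j hj]
      exact Finset.sum_eq_zero fun i hi => by rw [hC.sink_out hi hj, mul_zero]

/-- Subtracting the smallest ratio `u / c` times `c` leaves a nonnegative stationary vector with a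
zero in the sink; a positive entry would spread to that zero. -/
lemma sink_stationary_eq_smul (hC : IsRelativeInteraction C) {k : Sink C} {u c : Fin n → ℝ}
    (hc0 : ∀ i ∈ sinkNodes C k, 0 < c i) (hcs : ∀ i ∉ sinkNodes C k, c i = 0) (hc : c ᵥ* C = c)
    (hus : ∀ i ∉ sinkNodes C k, u i = 0) (hu : u ᵥ* C = u) :
    ∃ l : ℝ, ∀ i, u i = l * c i := by
  obtain ⟨i₀, hi₀, hmin⟩ := Finset.exists_min_image _ (fun i => u i / c i) (sinkNodes_nonempty k)
  set l := u i₀ / c i₀ with hl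
  have hz0 : ∀ i, 0 ≤ u i - l * c i := fun i => by
    by_cases hi : i ∈ sinkNodes C k
    · have := (le_div_iff₀ (hc0 i hi)).1 (hmin i hi)
      linarith
    · simp [hus i hi, hcs i hi]
  have hz : (fun i => u i - l * c i) ᵥ* C = fun i => u i - l * c i := by
    rw [vecMul_eq_iff] at hu hc ⊢
    intro j
    rw [← hu j, ← hc j, Finset.mul_sum, ← Finset.sum_sub_distrib]
    exact Finset.sum_congr rfl fun i _ => by ring
  have hzi : u i₀ - l * c i₀ = 0 := by
    rw [hl, div_mul_cancel₀ _ (hc0 i₀ hi₀).ne', sub_self]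
  refine ⟨l, fun i => ?_⟩
  by_cases hi : i ∈ sinkNodes C k
  · by_contra hne
    have hpos : 0 < u i - l * c i := lt_of_le_of_ne (hz0 i) fun h => hne (by linarith)
    exact (stationary_pos_of_reaches hC hz0 hz (sink_reaches hi hi₀) hpos).ne' hzi
  · simp [hus i hi, hcs i hi]

lemma IsSinkCentrality.eq_zero {k : Sink C} {c : Fin n → ℝ} (hc : IsSinkCentrality C k c)
    {i : Fin n} (hi : i ∉ sinkNodes C k) : c i = 0 :=
  le_antisymm (not_lt.1 fun h => hi ((hc.2.1 i).1 h)) (hc.1.1 i)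

lemma IsSinkCentrality.pos {k : Sink C} {c : Fin n → ℝ} (hc : IsSinkCentrality C k c)
    {i : Fin n} (hi : i ∈ sinkNodes C k) : 0 < c i :=
  (hc.2.1 i).2 hi

lemma IsSinkCentrality.sum_sink {k : Sink C} {c : Fin n → ℝ} (hc : IsSinkCentrality C k c) :
    ∑ i ∈ sinkNodes C k, c i = 1 := by
  rw [← hc.1.2]
  exact Finset.sum_subset (Finset.subset_univ _) fun i _ hi => hc.eq_zero hi

lemma IsSinkCentrality.exists_eq_mul (hC : IsRelativeInteraction C) {k : Sink C}
    {c : Fin n → ℝ} (hc : IsSinkCentrality C k c) {u : Fin n → ℝ}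
    (hus : ∀ i ∉ sinkNodes C k, u i = 0) (hu : u ᵥ* C = u) : ∃ l : ℝ, ∀ i, u i = l * c i :=
  sink_stationary_eq_smul hC (fun _ hi => hc.pos hi) (fun _ hi => hc.eq_zero hi) hc.2.2 hus hu

lemma existsUnique_isSinkCentrality (hC : IsRelativeInteraction C) (k : Sink C) :
    ∃! c : Fin n → ℝ, IsSinkCentrality C k c := by
  obtain ⟨v, hv0, hvs, hv⟩ := exists_sink_stationary hC k
  set u : Fin n → ℝ := fun i => |v i| with hudef
  have hu : u ᵥ* C = u := stationary_abs hC hv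
  have hu0 : ∀ i, 0 ≤ u i := fun i => abs_nonneg _
  have hus : ∀ i ∉ sinkNodes C k, u i = 0 := fun i hi => by simp [hudef, hvs i hi]
  obtain ⟨i₀, hi₀⟩ : ∃ i, v i ≠ 0 := by
    by_contra! h
    exact hv0 (funext h)
  have hi₀s : i₀ ∈ sinkNodes C k := by
    by_contra h
    exact hi₀ (hvs _ h)
  have hupos : ∀ i ∈ sinkNodes C k, 0 < u i := fun i hi =>
    stationary_pos_of_reaches hC hu0 hu (sink_reaches hi₀s hi) (abs_pos.2 hi₀)
  have hs : 0 < ∑ i, u i :=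
    Finset.sum_pos' (fun i _ => hu0 i) ⟨i₀, Finset.mem_univ _, abs_pos.2 hi₀⟩
  have hcent : IsSinkCentrality C k fun i => u i / ∑ j, u j := by
    refine ⟨⟨fun i => div_nonneg (hu0 i) hs.le, ?_⟩, fun i => ⟨fun h => ?_, fun h => ?_⟩, ?_⟩
    · rw [← Finset.sum_div, div_self hs.ne']
    · by_contra hi
      simp [hus i hi] at h
    · exact div_pos (hupos i h) hs
    · rw [vecMul_eq_iff] at hu ⊢
      intro j
      rw [← hu j, Finset.sum_div]
      exact Finset.sum_congr rfl fun i _ => by ring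
  refine ⟨_, hcent, fun c hc => ?_⟩
  obtain ⟨l, hl⟩ := hcent.exists_eq_mul hC (fun _ hi => hc.eq_zero hi) hc.2.2
  have h1 : l = 1 := by
    have h2 := hc.1.2
    simp only [hl, ← Finset.mul_sum] at h2
    rw [hcent.1.2, mul_one] at h2
    exact h2
  ext i
  rw [hl i, h1, one_mul]

/-- A stationary vector, positive exactly on the union of the sinks. -/
lemma exists_stationary_pos_iff (hC : IsRelativeInteraction C) :
    ∃ c : Fin n → ℝ, (∀ i, 0 ≤ c i) ∧ (∀ i, 0 < c i ↔ ¬ IsReducibleNode C i) ∧ c ᵥ* C = c := by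
  choose c hc using fun k => (existsUnique_isSinkCentrality hC k).exists
  have h0 : ∀ i, 0 ≤ ∑ k, c k i := fun i => Finset.sum_nonneg fun k _ => (hc k).1.1 i
  refine ⟨fun i => ∑ k, c k i, h0, fun i => ⟨fun h hi => ?_, fun h => ?_⟩, ?_⟩
  · exact h.ne' (Finset.sum_eq_zero fun k _ => (hc k).eq_zero (hi k))
  · obtain ⟨k, hk⟩ := not_isReducibleNode.1 h
    exact Finset.sum_pos' (fun k _ => (hc k).1.1 i) ⟨k, Finset.mem_univ k, (hc k).pos hk⟩
  · rw [vecMul_eq_iff]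
    intro j
    simp only [Finset.sum_mul]
    rw [Finset.sum_comm]
    exact Finset.sum_congr rfl fun k _ => vecMul_eq_iff.1 (hc k).2.2 j

open scoped Classical in
/-- Restricting a stationary vector without reducible mass to a sink. -/
lemma stationary_restrict (hC : IsRelativeInteraction C) {u : Fin n → ℝ} (hu : u ᵥ* C = u)
    (hR : ∀ i, IsReducibleNode C i → u i = 0) (k : Sink C) :
    (fun i => if i ∈ sinkNodes C k then u i else 0) ᵥ* C =
      fun i => if i ∈ sinkNodes C k then u i else 0 := by
  rw [vecMul_eq_iff] at hu ⊢
  intro j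
  by_cases hj : j ∈ sinkNodes C k
  · rw [if_pos hj, ← hu j]
    refine Finset.sum_congr rfl fun i _ => ?_
    by_cases hi : i ∈ sinkNodes C k
    · rw [if_pos hi]
    · rw [if_neg hi, zero_mul]
      by_cases hr : IsReducibleNode C i
      · rw [hR i hr, zero_mul]
      · obtain ⟨l, hl⟩ := not_isReducibleNode.1 hr
        rw [hC.sink_out hl (fun h => hi (sink_eq h hj ▸ hl)), mul_zero]
  · rw [if_neg hj]
    refine Finset.sum_eq_zero fun i _ => ?_
    split_ifs with hi
    · rw [hC.sink_out hi hj, mul_zero]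
    · rw [zero_mul]

lemma IsSinkCentrality.exists_eq_mul_of_stationary (hC : IsRelativeInteraction C) {k : Sink C}
    {c : Fin n → ℝ} (hc : IsSinkCentrality C k c) {u : Fin n → ℝ} (hu : u ᵥ* C = u)
    (hR : ∀ i, IsReducibleNode C i → u i = 0) :
    ∃ l : ℝ, ∀ i ∈ sinkNodes C k, u i = l * c i := by
  classical
  obtain ⟨l, hl⟩ := hc.exists_eq_mul hC
    (u := fun i => if i ∈ sinkNodes C k then u i else 0) (fun i hi => if_neg hi)
    (stationary_restrict hC hu hR k)
  exact ⟨l, fun i hi => by rw [← hl i, if_pos hi]⟩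

end Perron

/-! ### Uniqueness for proportional logistic values -/

section Proportional

/-- This rests on the factorization $(b-b^2)-(a-a^2) = (b-a)(1-a-b)$. -/
lemma lt_of_sub_sq_lt {a b : ℝ} (h : a - a ^ 2 < b - b ^ 2) (hab : a + b ≤ 1) : a < b := by
  by_contra! hle
  nlinarith [mul_nonneg (sub_nonneg.2 hle) (sub_nonneg.2 hab)]

lemma le_of_sub_sq_le {a b : ℝ} (h : a - a ^ 2 ≤ b - b ^ 2) (hab : a + b < 1) : a ≤ b := by
  by_contra! hle
  nlinarith [mul_pos (sub_pos.2 hle) (sub_pos.2 hab)]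

/-- Two positive vectors with the same sum, at most `1`, and pairwise sums below `1` agree if
their logistic images `x - x²` are proportional (ratio at least one). -/
lemma eq_of_logistic_proportional {ι : Type*} [DecidableEq ι] {T : Finset ι} {x x' : ι → ℝ}
    (hx : ∀ i ∈ T, 0 < x i) (hx' : ∀ i ∈ T, 0 < x' i)
    (h2 : ∀ i ∈ T, ∀ j ∈ T, i ≠ j → x i + x j < 1)
    (h2' : ∀ i ∈ T, ∀ j ∈ T, i ≠ j → x' i + x' j < 1)
    (hsum : ∑ i ∈ T, x' i = ∑ i ∈ T, x i) (hle : ∑ i ∈ T, x i ≤ 1) {l : ℝ} (hl : 1 ≤ l)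
    (hprop : ∀ i ∈ T, x' i - x' i ^ 2 = l * (x i - x i ^ 2)) : ∀ i ∈ T, x i = x' i := by
  have hx1 : ∀ i ∈ T, x i ≤ 1 := fun i hi =>
    (Finset.single_le_sum (f := x) (fun j hj => (hx j hj).le) hi).trans hle
  have hx1' : ∀ i ∈ T, x' i ≤ 1 := fun i hi =>
    (Finset.single_le_sum (f := x') (fun j hj => (hx' j hj).le) hi).trans (hsum.trans_le hle)
  have hge : ∀ i ∈ T, x i - x i ^ 2 ≤ x' i - x' i ^ 2 := fun i hi => by
    rw [hprop i hi]
    nlinarith [mul_nonneg (hx i hi).le (sub_nonneg.2 (hx1 i hi)),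
      mul_nonneg (sub_nonneg.2 hl) (mul_nonneg (hx i hi).le (sub_nonneg.2 (hx1 i hi)))]
  -- On the increasing branch of the logistic function, a ratio `l ≥ 1` gives `x ≤ x'` entrywise,
  -- and equal sums force equality. Otherwise exactly one entry exceeds 1/2; it is reflected to `z =
  -- 1 - x i`, and `w` is the reflection of `x' i` into the same branch.
  by_cases hsmall : ∀ i ∈ T, x i ≤ 1 / 2
  · refine (Finset.sum_eq_sum_iff_of_le fun i hi => ?_).1 hsum.symm
    rcases le_or_gt (x' i) (1 / 2) with h | h
    · by_contra! hlt
      have := hge i hi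
      have := hsmall i hi
      nlinarith
    · exact (hsmall i hi).trans h.le
  push Not at hsmall
  obtain ⟨i, hi, hbig⟩ := hsmall
  set z := 1 - x i with hz
  set w := min (x' i) (1 - x' i) with hw
  have hwhalf : w ≤ 1 / 2 := by
    rcases le_total (x' i) (1 / 2) with h | h
    · exact (min_le_left _ _).trans h
    · exact (min_le_right _ _).trans (by linarith)
  have hwy : w - w ^ 2 = l * (z - z ^ 2) := by
    have h1 : w - w ^ 2 = x' i - x' i ^ 2 := by
      rcases min_choice (x' i) (1 - x' i) with h | h <;> rw [hw, h]
      ring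
    rw [h1, hprop i hi, hz]; ring
  have hzhalf : z < 1 / 2 := by rw [hz]; linarith
  have hz0 : 0 ≤ z := by rw [hz]; linarith [hx1 i hi]
  have hsx := Finset.add_sum_erase T x hi
  have hsx' := Finset.add_sum_erase T x' hi
  set s := ∑ j ∈ T.erase i, x j with hs
  set s' := ∑ j ∈ T.erase i, x' j with hs'
  have hsz : s ≤ z := by rw [hz]; linarith
  have hss : s' - s = (1 - x' i) - z := by rw [hz]; linarith
  rcases hz0.eq_or_lt with hz00 | hzpos
  · -- all the mass sits at `i`
    have hempty : T.erase i = ∅ := by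
      by_contra hne
      obtain ⟨j, hj⟩ := Finset.nonempty_iff_ne_empty.2 hne
      have : 0 < s := Finset.sum_pos (fun j hj => hx j (Finset.mem_of_mem_erase hj)) ⟨j, hj⟩
      linarith
    have h0 : s = 0 := by rw [hs, hempty, Finset.sum_empty]
    have h0' : s' = 0 := by rw [hs', hempty, Finset.sum_empty]
    intro j hj
    by_cases hji : j = i
    · rw [hji]; linarith
    · have : j ∈ T.erase i := Finset.mem_erase.2 ⟨hji, hj⟩
      rw [hempty] at this
      simp at this
  have hwz : z ≤ w := by
    refine le_of_sub_sq_le ?_ (by linarith)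
    rw [hwy]
    nlinarith [mul_nonneg (sub_nonneg.2 hl) (mul_nonneg hz0 (by linarith : 0 ≤ 1 - z))]
  -- The ratio of the reflected large entries. The small entries, lying below `z`, turn out to grow
  -- at most by this factor.
  set r := w / z with hr
  have hrz : r * z = w := div_mul_cancel₀ _ hzpos.ne'
  have hr1 : 1 ≤ r := (one_le_div hzpos).2 hwz
  have hlr : l * (1 - z) = r * (1 - w) := by
    have : z * (l * (1 - z)) = z * (r * (1 - w)) := by
      calc z * (l * (1 - z)) = l * (z - z ^ 2) := by ring
        _ = w - w ^ 2 := hwy.symm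
        _ = (r * z) * (1 - w) := by rw [hrz]; ring
        _ = _ := by ring
    exact mul_left_cancel₀ hzpos.ne' this
  have hsm : ∀ j ∈ T.erase i, x j < z ∧ x' j ≤ 1 / 2 ∧ r * x j < 1 / 2 := by
    intro j hj
    obtain ⟨hji, hjT⟩ := Finset.mem_erase.1 hj
    have hxz : x j < z := by have := h2 i hi j hjT (Ne.symm hji); rw [hz]; linarith
    refine ⟨hxz, ?_, ?_⟩
    · by_contra! hjbig
      have h3 := h2' i hi j hjT (Ne.symm hji)
      have h4 : x j - x j ^ 2 < x i - x i ^ 2 := by nlinarith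
      have h5 : x' i - x' i ^ 2 < x' j - x' j ^ 2 := by nlinarith
      rw [hprop i hi, hprop j hjT] at h5
      nlinarith
    · calc r * x j < r * z := mul_lt_mul_of_pos_left hxz (by linarith)
        _ ≤ 1 / 2 := by rw [hrz]; exact hwhalf
  -- The right side is nonnegative because `x j < z`: the logistic value of `r * x j` exceeds that
  -- of `x' j`, strictly if `r > 1`.
  have hkey : ∀ j ∈ T.erase i, (1 - z) * ((r * x j - (r * x j) ^ 2) - (x' j - x' j ^ 2)) =
      r * x j * ((r - 1) * (z - x j)) := by
    intro j hj
    rw [hprop j (Finset.mem_of_mem_erase hj)]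
    have : (1 - z) * (l * (x j - x j ^ 2)) = r * (1 - r * z) * (x j - x j ^ 2) := by
      rw [hrz, ← hlr]; ring
    linear_combination -this
  have hxr : ∀ j ∈ T.erase i, x' j ≤ r * x j := by
    intro j hj
    obtain ⟨ha, hb, hc⟩ := hsm j hj
    refine le_of_sub_sq_le ?_ (by linarith)
    have h3 := hkey j hj
    have h4 : 0 ≤ r * x j * ((r - 1) * (z - x j)) := by
      have := hx j (Finset.mem_of_mem_erase hj)
      have : 0 ≤ r - 1 := by linarith
      have : 0 ≤ z - x j := by linarith
      positivity
    rw [← h3] at h4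
    have := nonneg_of_mul_nonneg_right h4 (by linarith : 0 < 1 - z)
    linarith
  have hs'r : s' ≤ r * s := by
    rw [hs, hs', Finset.mul_sum]; exact Finset.sum_le_sum hxr
  have hwle : w ≤ 1 - x' i := min_le_right _ _
  have hwr : w - z = (r - 1) * z := by rw [← hrz]; ring
  rcases hr1.eq_or_lt with hr1 | hr1
  · have hsle : s' ≤ s := by rw [← hr1, one_mul] at hs'r; exact hs'r
    have hseq : s' = s := by linarith
    have heq : x i = x' i := by rw [hz] at hss; linarith
    have hall := (Finset.sum_eq_sum_iff_of_le (s := T.erase i) (f := x') (g := x)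
      (fun j hj => by have := hxr j hj; rwa [← hr1, one_mul] at this)).1 hseq
    intro j hj
    by_cases hji : j = i
    · rw [hji]; exact heq
    · exact (hall j (Finset.mem_erase.2 ⟨hji, hj⟩)).symm
  -- Equal sums give `s' - s ≥ w - z = (r - 1) z ≥ (r - 1) s`, whereas the small entries give `s' <
  -- r s`, unless there are none and both sums vanish.
  · exfalso
    have hrs : (r - 1) * s ≤ (r - 1) * z := mul_le_mul_of_nonneg_left hsz (by linarith)
    have hrz0 : 0 < (r - 1) * z := mul_pos (by linarith) hzpos
    rcases (T.erase i).eq_empty_or_nonempty with he | hne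
    · have h0 : s = 0 := by rw [hs, he, Finset.sum_empty]
      have h0' : s' = 0 := by rw [hs', he, Finset.sum_empty]
      linarith
    · have : s' < r * s := by
        rw [hs, hs', Finset.mul_sum]
        refine Finset.sum_lt_sum_of_nonempty hne fun j hj => ?_
        obtain ⟨ha, hb, hc⟩ := hsm j hj
        refine lt_of_sub_sq_lt ?_ (by linarith)
        have h3 := hkey j hj
        have h4 : 0 < r * x j * ((r - 1) * (z - x j)) := by
          have := hx j (Finset.mem_of_mem_erase hj)
          have : 0 < r - 1 := by linarith
          have : 0 < z - x j := by linarith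
          positivity
        rw [← h3] at h4
        have := pos_of_mul_pos_right h4 (by linarith : 0 ≤ 1 - z)
        linarith
      linarith

end Proportional

/-! ### Fixed points and their splits -/

section Fixed

variable {n : ℕ} {C : Matrix (Fin n) (Fin n) ℝ}

/-- The square terms cancel, which reduces the nonlinear fixed-point equation to the linear theory
of stationary vectors. -/
lemma dfMap_eq_self_iff {x : Fin n → ℝ} :
    dfMap C x = x ↔ (fun i => x i - x i ^ 2) ᵥ* C = fun i => x i - x i ^ 2 := by
  rw [vecMul_eq_iff, funext_iff]
  refine forall_congr' fun j => ?_
  rw [dfMap_apply]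
  simp only [mul_comm (C _ j)]
  constructor <;> intro h <;> linarith

lemma stdSimplex_le_one {ι : Type*} [Fintype ι] {x : ι → ℝ} (hx : x ∈ stdSimplex ℝ ι) (i : ι) :
    x i ≤ 1 := by
  rw [← hx.2]
  exact Finset.single_le_sum (fun j _ => hx.1 j) (Finset.mem_univ i)

lemma stdSimplex_add_le_one {ι : Type*} [Fintype ι] {x : ι → ℝ} (hx : x ∈ stdSimplex ℝ ι)
    {i j : ι} (hij : i ≠ j) : x i + x j ≤ 1 := by
  classical
  rw [← hx.2, ← Finset.sum_pair hij]
  exact Finset.sum_le_sum_of_subset_of_nonneg (Finset.subset_univ _) fun j _ _ => hx.1 j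

lemma stdSimplex_eq_single {ι : Type*} [Fintype ι] [DecidableEq ι] {x : ι → ℝ}
    (hx : x ∈ stdSimplex ℝ ι) {i : ι} (hi : x i = 1) : x = Pi.single i 1 := by
  ext j
  by_cases hj : j = i
  · rw [hj, hi, Pi.single_eq_same]
  · rw [Pi.single_eq_of_ne hj]
    have := stdSimplex_add_le_one hx hj
    exact le_antisymm (by linarith) (hx.1 j)

lemma stdSimplex_logistic_nonneg {ι : Type*} [Fintype ι] {x : ι → ℝ} (hx : x ∈ stdSimplex ℝ ι)
    (i : ι) : 0 ≤ x i - x i ^ 2 := by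
  nlinarith [hx.1 i, stdSimplex_le_one hx i]

/-- Testing stationarity against the reducible weights gives equal sums, while one step of the chain
lowers the weight strictly at every reducible node. -/
lemma stationary_reducible (hC : IsRelativeInteraction C) {u : Fin n → ℝ} (hu0 : ∀ i, 0 ≤ u i)
    (hu : u ᵥ* C = u) {i : Fin n} (hi : IsReducibleNode C i) : u i = 0 := by
  obtain ⟨w, η, hη, hw0, -, -, hwR, hwS⟩ := hC.exists_reducible_weights
  have heq : ∑ j, u j * w j = ∑ i, u i * ∑ j, C i j * w j := by
    simp only [Finset.mul_sum]
    rw [Finset.sum_comm]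
    refine Finset.sum_congr rfl fun j _ => ?_
    rw [← vecMul_eq_iff.1 hu j, Finset.sum_mul]
    exact Finset.sum_congr rfl fun i _ => by ring
  have hle : ∀ j ∈ Finset.univ, u j * ∑ l, C j l * w l ≤ u j * w j := fun j _ => by
    refine mul_le_mul_of_nonneg_left ?_ (hu0 j)
    by_cases hj : IsReducibleNode C j
    · linarith [hwR j hj]
    · rw [hwS j hj, hw0 j hj]
  have h := (Finset.sum_eq_sum_iff_of_le hle).1 heq.symm i (Finset.mem_univ i)
  by_contra hne
  have h1 := mul_left_cancel₀ hne h
  linarith [hwR i hi]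

lemma IsStarCenter.row (hC : IsRelativeInteraction C) {k : Sink C} {i l : Fin n}
    (h : IsStarCenter C k i) (hl : l ∈ sinkNodes C k) (hli : l ≠ i) : C l i = 1 := by
  rw [← hC.sum_row l]
  refine (Finset.sum_eq_single i (fun b _ hb => ?_) (by simp)).symm
  by_contra hne
  have hpos : 0 < C l b := lt_of_le_of_ne (hC.nonneg l b) (Ne.symm hne)
  rcases h.2 l hl b (sink_closed hl hpos) hpos with h | h
  · exact hli h
  · exact hb h

lemma exists_third {k : Sink C} (hk : 3 ≤ (sinkNodes C k).card) (i j : Fin n) :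
    ∃ l ∈ sinkNodes C k, l ≠ i ∧ l ≠ j := by
  by_contra! h
  have hsub : sinkNodes C k ⊆ {i, j} := fun l hl => by
    by_cases hli : l = i
    · simp [hli]
    · simp [h l hl hli]
  have := (Finset.card_le_card hsub).trans Finset.card_le_two
  omega

/-- With two centers, a third node would send its whole unit row to both. -/
lemma IsStarCenter.unique (hC : IsRelativeInteraction C) {k : Sink C} {i j : Fin n}
    (hk : 3 ≤ (sinkNodes C k).card) (hi : IsStarCenter C k i) (hj : IsStarCenter C k j) :
    i = j := by
  by_contra hij
  obtain ⟨l, hl, hli, hlj⟩ := exists_third hk i j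
  have h1 := hi.row hC hl hli
  have h2 := hj.row hC hl hlj
  have h3 : C l i + C l j ≤ ∑ b, C l b := by
    rw [← Finset.sum_pair hij]
    exact Finset.sum_le_sum_of_subset_of_nonneg (Finset.subset_univ _) fun b _ _ => hC.nonneg l b
  rw [hC.sum_row] at h3
  linarith

lemma exists_lt_one_of_not_isStarCenter (hC : IsRelativeInteraction C) {k : Sink C} {i : Fin n}
    (hi : i ∈ sinkNodes C k) (h : ¬ IsStarCenter C k i) :
    ∃ l ∈ sinkNodes C k, l ≠ i ∧ C l i < 1 := by
  by_contra! hno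
  refine h ⟨hi, fun a ha b hb hab => ?_⟩
  by_cases hai : a = i
  · exact Or.inl hai
  · right
    by_contra hbi
    have h3 : C a i + C a b ≤ ∑ b, C a b := by
      rw [← Finset.sum_pair (Ne.symm hbi)]
      exact Finset.sum_le_sum_of_subset_of_nonneg (Finset.subset_univ _)
        fun b _ _ => hC.nonneg a b
    rw [hC.sum_row] at h3
    linarith [hno a ha hai]

lemma add_lt_one_of_pos {x : Fin n → ℝ} (hx : x ∈ stdSimplex ℝ (Fin n)) {k : Sink C}
    (hk : 3 ≤ (sinkNodes C k).card) (hpos : ∀ i ∈ sinkNodes C k, 0 < x i) {i j : Fin n}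
    (hij : i ≠ j) : x i + x j < 1 := by
  obtain ⟨l, hl, hli, hlj⟩ := exists_third hk i j
  have h3 : ∑ a ∈ {l, i, j}, x a ≤ ∑ a, x a :=
    Finset.sum_le_sum_of_subset_of_nonneg (Finset.subset_univ _) fun b _ _ => hx.1 b
  rw [hx.2, Finset.sum_insert (by simp [hli, hlj]), Finset.sum_pair hij] at h3
  linarith [hpos l hl]

lemma eq_zero_of_sinkPower_eq_one {x : Fin n → ℝ} (hx : x ∈ stdSimplex ℝ (Fin n)) {k : Sink C}
    (h : sinkPower C x k = 1) {i : Fin n} (hi : i ∉ sinkNodes C k) : x i = 0 := by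
  have h3 : ∑ a ∈ insert i (sinkNodes C k), x a ≤ ∑ a, x a :=
    Finset.sum_le_sum_of_subset_of_nonneg (Finset.subset_univ _) fun b _ _ => hx.1 b
  rw [hx.2, Finset.sum_insert hi] at h3
  unfold sinkPower at h
  exact le_antisymm (by linarith) (hx.1 i)

lemma sinkPower_le_one {x : Fin n → ℝ} (hx : x ∈ stdSimplex ℝ (Fin n)) (k : Sink C) :
    sinkPower C x k ≤ 1 := by
  rw [← hx.2]
  exact Finset.sum_le_sum_of_subset_of_nonneg (Finset.subset_univ _) fun b _ _ => hx.1 b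

/-- A full star admits no fixed point that is positive on the whole sink. -/
lemma not_pos_of_isStarCenter (hC : IsRelativeInteraction C) {x : Fin n → ℝ}
    (hx : x ∈ stdSimplex ℝ (Fin n)) (hfix : dfMap C x = x) {k : Sink C}
    (hk : 3 ≤ (sinkNodes C k).card) (hone : sinkPower C x k = 1) {i : Fin n}
    (hi : IsStarCenter C k i) : ¬ ∀ j ∈ sinkNodes C k, 0 < x j := by
  intro hpos
  have h0 := fun j hj => eq_zero_of_sinkPower_eq_one (C := C) hx hone (i := j) hj
  have hst := vecMul_eq_iff.1 (dfMap_eq_self_iff.1 hfix) i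
  have hsplit : ∑ l, (x l - x l ^ 2) * C l i = ∑ l ∈ (sinkNodes C k).erase i, (x l - x l ^ 2) := by
    rw [← Finset.sum_subset (Finset.subset_univ ((sinkNodes C k).erase i))]
    · refine Finset.sum_congr rfl fun l hl => ?_
      rw [hi.row hC (Finset.mem_of_mem_erase hl) (Finset.ne_of_mem_erase hl), mul_one]
    · intro l _ hl
      by_cases hli : l = i
      · rw [hli, hC.2 i, mul_zero]
      · rw [h0 l fun h => hl (Finset.mem_erase.2 ⟨hli, h⟩)]; ring
  have hsum : x i + ∑ l ∈ (sinkNodes C k).erase i, x l = 1 := by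
    rw [Finset.add_sum_erase _ x hi.1]; exact hone
  -- Leaves send everything to the center, so the center's equation equates its logistic value with
  -- the sum of theirs. Inserting `1 - x i = ∑ x l` gives this vanishing sum, whose terms are
  -- positive when three entries are positive.
  have hzero : ∑ l ∈ (sinkNodes C k).erase i, x l * (1 - x l - x i) = 0 := by
    have : ∑ l ∈ (sinkNodes C k).erase i, x l * (1 - x l - x i) =
        ∑ l ∈ (sinkNodes C k).erase i, (x l - x l ^ 2) -
          (∑ l ∈ (sinkNodes C k).erase i, x l) * x i := by
      rw [Finset.sum_mul, ← Finset.sum_sub_distrib]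
      exact Finset.sum_congr rfl fun l _ => by ring
    rw [this, ← hsplit, hst, ← eq_sub_iff_add_eq'.2 hsum |>.symm]
    ring
  have hposs : 0 < ∑ l ∈ (sinkNodes C k).erase i, x l * (1 - x l - x i) := by
    obtain ⟨l, hl, hli, -⟩ := exists_third hk i i
    refine Finset.sum_pos (fun l hl => ?_) ⟨l, Finset.mem_erase.2 ⟨hli, hl⟩⟩
    have hl' := Finset.mem_erase.1 hl
    have := add_lt_one_of_pos hx hk hpos hl'.1
    exact mul_pos (hpos l hl'.2) (by linarith)
  exact hposs.ne' hzero

/-- An entry strictly between 0 and 1 has positive logistic value, and positivity of a stationary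
vector spreads along edges. -/
lemma fixed_pos (hC : IsRelativeInteraction C) {x : Fin n → ℝ}
    (hx : x ∈ stdSimplex ℝ (Fin n)) (hfix : dfMap C x = x) {k : Sink C}
    (hlt : ∀ i ∈ sinkNodes C k, x i ≠ 1) (hp : 0 < sinkPower C x k) :
    ∀ i ∈ sinkNodes C k, 0 < x i := by
  obtain ⟨j, hj, hj0⟩ : ∃ j ∈ sinkNodes C k, x j ≠ 0 := by
    by_contra! h
    exact hp.ne' (Finset.sum_eq_zero h)
  have hj1 : 0 < x j := lt_of_le_of_ne (hx.1 j) hj0.symm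
  have hj2 : x j < 1 := lt_of_le_of_ne (stdSimplex_le_one hx j) (hlt j hj)
  intro i hi
  have := stationary_pos_of_reaches hC (stdSimplex_logistic_nonneg hx)
    (dfMap_eq_self_iff.1 hfix) (sink_reaches hj hi) (by nlinarith)
  refine lt_of_le_of_ne (hx.1 i) fun h => ?_
  rw [← h] at this
  norm_num at this

lemma sinkPower_eq_one {x : Fin n → ℝ} (hx : x ∈ stdSimplex ℝ (Fin n)) {k : Sink C} {i : Fin n}
    (hi : i ∈ sinkNodes C k) (h1 : x i = 1) : sinkPower C x k = 1 :=
  le_antisymm (sinkPower_le_one hx k) (h1 ▸ le_sinkPower hx.1 hi)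

lemma card_eq_two_pair (hC : IsRelativeInteraction C) {k : Sink C} {i j : Fin n} (hij : i ≠ j)
    (hk : sinkNodes C k = {i, j}) : C i j = 1 := by
  have hi : i ∈ sinkNodes C k := by simp [hk]
  have := hC.sum_sink hi
  rw [hk, Finset.sum_pair hij, hC.2 i, zero_add] at this
  exact this

/-- A fixed point without reducible mass, whose possible vertices in sinks with at least three
nodes are star centers, is a split equilibrium. -/
lemma isSplitEquilibrium_of_fixed (hC : IsRelativeInteraction C) {x : Fin n → ℝ}
    (hx : x ∈ stdSimplex ℝ (Fin n)) (hfix : dfMap C x = x)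
    (hR : ∀ i, IsReducibleNode C i → x i = 0)
    (hv : ∀ (k : Sink C) i, i ∈ sinkNodes C k → x i = 1 → 3 ≤ (sinkNodes C k).card →
      IsStarCenter C k i) :
    IsSplitEquilibrium C (sinkPower C x) x := by
  have hst := dfMap_eq_self_iff.1 hfix
  have hpos : ∀ k : Sink C, 3 ≤ (sinkNodes C k).card → 0 < sinkPower C x k →
      ¬ IsFullStar C (sinkPower C x) k → ∀ i ∈ sinkNodes C k, 0 < x i := by
    intro k hk hp hns
    refine fixed_pos hC hx hfix (fun i hi h1 => hns ⟨hk, ⟨i, hv k i hi h1 hk⟩, ?_⟩) hp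
    exact sinkPower_eq_one hx hi h1
  -- Each node of a two-node sink is fed only by the other. Equality of logistic values means
  -- $(x_i-x_j)(1-x_i-x_j)=0$, so the halves are equal unless the pair has all the power.
  have hpairs : ∀ k : Sink C, ∀ i j, i ≠ j → sinkNodes C k = {i, j} →
      x i - x i ^ 2 = x j - x j ^ 2 := by
    intro k i j hij hk
    have hj : j ∈ sinkNodes C k := by simp [hk]
    rw [← vecMul_eq_iff.1 hst j, Finset.sum_eq_single i]
    · rw [card_eq_two_pair hC hij hk, mul_one]
    · intro l _ hli
      by_cases hlk : l ∈ sinkNodes C k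
      · have : l = j := by
          rw [hk] at hlk
          simpa [hli] using hlk
        rw [this, hC.2 j, mul_zero]
      · by_cases hr : IsReducibleNode C l
        · rw [hR l hr]; ring
        · obtain ⟨m, hm⟩ := not_isReducibleNode.1 hr
          rw [hC.sink_out hm fun h => hlk (sink_eq h hj ▸ hm), mul_zero]
    · simp
  refine ⟨hx, hfix, fun _ => rfl, hR, ?_, ?_, ?_, hpos, ?_, ?_⟩
  · intro k hk hlt i hi
    obtain ⟨a, b, hab, hk⟩ := Finset.card_eq_two.1 hk
    have h1 := hpairs k a b hab hk
    have h2 : sinkPower C x k = x a + x b := by rw [sinkPower, hk, Finset.sum_pair hab]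
    have h3 : x a = x b := by
      have : (x a - x b) * (1 - x a - x b) = 0 := by linear_combination h1
      rcases mul_eq_zero.1 this with h | h
      · linarith
      · linarith
    rw [hk] at hi
    rcases Finset.mem_insert.1 hi with h | h
    · rw [h]; linarith
    · rw [Finset.mem_singleton.1 h]; linarith
  · intro k h1 i j hij hk
    refine ⟨x i, ⟨hx.1 i, stdSimplex_le_one hx i⟩, rfl, ?_⟩
    rw [sinkPower, hk, Finset.sum_pair hij] at h1
    linarith
  · intro k _ h0 i hi
    exact eq_zero_of_sinkPower_eq_zero hx.1 h0 hi
  · intro k hk hp hns c hc i hi j hj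
    have hpk := hpos k hk hp hns
    obtain ⟨l, hl⟩ := hc.exists_eq_mul_of_stationary hC hst
      (fun a ha => by rw [hR a ha]; ring)
    have hone : ∀ a ∈ sinkNodes C k, x a < 1 := fun a ha => by
      obtain ⟨b, hb, hba, -⟩ := exists_third hk a a
      have := add_lt_one_of_pos hx hk hpk hba.symm
      linarith [hpk b hb]
    have hl0 : 0 < l := by
      have h1 := hl i hi
      have h2 : 0 < x i - x i ^ 2 := by nlinarith [hone i hi, hpk i hi]
      rw [h1] at h2
      exact pos_of_mul_pos_left h2 (hc.1.1 i)
    by_cases hij : i = j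
    · simp [hij]
    have hlt := add_lt_one_of_pos hx hk hpk hij
    -- The factor `1 - x i - x j` is positive, because a third node has positive weight, so both
    -- differences have the same sign.
    have hid : (x j - x i) * (1 - x i - x j) = l * (c j - c i) := by
      linear_combination hl j hj - hl i hi
    rw [← sub_pos, ← sub_pos (a := c j)]
    constructor
    · intro h
      exact pos_of_mul_pos_right (hid ▸ mul_pos h (by linarith)) hl0.le
    · intro h
      exact pos_of_mul_pos_left (hid ▸ mul_pos hl0 h) (by linarith)
  · rintro k ⟨hk, -, h1⟩ i hi
    by_cases hex : ∃ j ∈ sinkNodes C k, x j = 1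
    · obtain ⟨j, hj, hj1⟩ := hex
      rw [hi.unique hC hk (hv k j hj hj1 hk)]
      exact stdSimplex_eq_single hx hj1
    · push Not at hex
      exact (not_pos_of_isStarCenter hC hx hfix hk h1 hi
        (fixed_pos hC hx hfix hex (by rw [h1]; exact one_pos))).elim

lemma fixed_reducible_eq_zero (hC : IsRelativeInteraction C) {x : Fin n → ℝ}
    (hx : x ∈ stdSimplex ℝ (Fin n)) (hfix : dfMap C x = x) {i : Fin n}
    (hi : IsReducibleNode C i) (h1 : x i ≠ 1) : x i = 0 := by
  have := stationary_reducible hC (stdSimplex_logistic_nonneg hx) (dfMap_eq_self_iff.1 hfix) hi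
  have h2 : x i * (1 - x i) = 0 := by linear_combination this
  rcases mul_eq_zero.1 h2 with h | h
  · exact h
  · exact (h1 (by linarith)).elim

lemma sinkPower_mem_stdSimplex {x : Fin n → ℝ} (hx : x ∈ stdSimplex ℝ (Fin n))
    (hR : ∀ i, IsReducibleNode C i → x i = 0) : sinkPower C x ∈ stdSimplex ℝ (Sink C) := by
  refine ⟨fun k => sinkPower_nonneg hx.1 k, ?_⟩
  have h := sum_eq_sum_sinkPower_add C x
  rw [hx.2, reducibleMass, Finset.sum_eq_zero (fun i hi => hR i (by simpa using hi)),
    add_zero] at h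
  exact h.symm

lemma isSplitEquilibrium_of_fixed_of_ne_one (hC : IsRelativeInteraction C) {x : Fin n → ℝ}
    (hx : x ∈ stdSimplex ℝ (Fin n)) (hfix : dfMap C x = x) (h1 : ∀ i, x i ≠ 1) :
    sinkPower C x ∈ stdSimplex ℝ (Sink C) ∧ IsSplitEquilibrium C (sinkPower C x) x := by
  have hR : ∀ i, IsReducibleNode C i → x i = 0 := fun i hi =>
    fixed_reducible_eq_zero hC hx hfix hi (h1 i)
  exact ⟨sinkPower_mem_stdSimplex hx hR, isSplitEquilibrium_of_fixed hC hx hfix hR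
    fun k i _ h => (h1 i h).elim⟩

/-- The comparison is made sink by sink. Where the entries are positive, both logistic vectors are
positive multiples of the centrality; the one with the smaller multiple plays the role of `x` in
`eq_of_logistic_proportional`. -/
lemma IsSplitEquilibrium.unique (hC : IsRelativeInteraction C) {ζ : Sink C → ℝ}
    (h2 : ∀ k, (sinkNodes C k).card = 2 → ζ k < 1) {x x' : Fin n → ℝ}
    (hx : IsSplitEquilibrium C ζ x) (hx' : IsSplitEquilibrium C ζ x') : x = x' := by
  ext i
  by_cases hr : IsReducibleNode C i
  · rw [hx.reducible i hr, hx'.reducible i hr]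
  obtain ⟨k, hik⟩ := not_isReducibleNode.1 hr
  rcases (hC.two_le_card k).eq_or_lt with hk | hk
  · rw [hx.pair k hk.symm (h2 k hk.symm) i hik, hx'.pair k hk.symm (h2 k hk.symm) i hik]
  have hζ0 : 0 ≤ ζ k := hx.power k ▸ sinkPower_nonneg hx.mem_simplex.1 k
  rcases hζ0.eq_or_lt with h0 | h0
  · rw [hx.zero k hk h0.symm i hik, hx'.zero k hk h0.symm i hik]
  by_cases hs : IsFullStar C ζ k
  · obtain ⟨-, ⟨j, hj⟩, -⟩ := id hs
    rw [hx.star_full k hs j hj, hx'.star_full k hs j hj]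
  have hpx := hx.pos k hk h0 hs
  have hpx' := hx'.pos k hk h0 hs
  obtain ⟨c, hc, -⟩ := existsUnique_isSinkCentrality hC k
  obtain ⟨a, ha⟩ := hc.exists_eq_mul_of_stationary hC (dfMap_eq_self_iff.1 hx.fixed)
      (fun a ha => by rw [hx.reducible a ha]; ring)
  obtain ⟨b, hb⟩ := hc.exists_eq_mul_of_stationary hC (dfMap_eq_self_iff.1 hx'.fixed)
      (fun a ha => by rw [hx'.reducible a ha]; ring)
  have key : ∀ {a : ℝ} {x : Fin n → ℝ}, IsSplitEquilibrium C ζ x →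
      (∀ i ∈ sinkNodes C k, x i - x i ^ 2 = a * c i) → 0 < a := by
    intro a x hx ha
    have hp := hx.pos k hk h0 hs
    obtain ⟨j, hj, hji, -⟩ := exists_third hk i i
    have h3 := add_lt_one_of_pos hx.mem_simplex hk hp hji
    have h4 : 0 < x i - x i ^ 2 := by nlinarith [hp i hik, hp j hj]
    rw [ha i hik] at h4
    exact pos_of_mul_pos_left h4 (hc.1.1 i)
  have ha0 := key hx ha
  have hb0 := key hx' hb
  have hsum : ∑ i ∈ sinkNodes C k, x' i = ∑ i ∈ sinkNodes C k, x i :=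
    (hx'.power k).trans (hx.power k).symm
  rcases le_total a b with hab | hab
  · refine eq_of_logistic_proportional hpx hpx'
      (fun i _ j _ hij => add_lt_one_of_pos hx.mem_simplex hk hpx hij)
      (fun i _ j _ hij => add_lt_one_of_pos hx'.mem_simplex hk hpx' hij) hsum
      (sinkPower_le_one hx.mem_simplex k) ((one_le_div ha0).2 hab) (fun j hj => ?_) i hik
    rw [ha j hj, hb j hj]; field_simp
  · refine (eq_of_logistic_proportional hpx' hpx
      (fun i _ j _ hij => add_lt_one_of_pos hx'.mem_simplex hk hpx' hij)
      (fun i _ j _ hij => add_lt_one_of_pos hx.mem_simplex hk hpx hij) hsum.symm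
      (sinkPower_le_one hx'.mem_simplex k) ((one_le_div hb0).2 hab) (fun j hj => ?_) i hik).symm
    rw [ha j hj, hb j hj]; field_simp

/-- Every division of the total power inside a two-node sink is an equilibrium. -/
lemma isSplitEquilibrium_pair (hC : IsRelativeInteraction C) {ζ : Sink C → ℝ}
    (hζ : ζ ∈ stdSimplex ℝ (Sink C)) {k : Sink C} (hk1 : ζ k = 1) {i j : Fin n} (hij : i ≠ j)
    (hk : sinkNodes C k = {i, j}) {α : ℝ} (hα : α ∈ Set.Icc (0 : ℝ) 1) :
    IsSplitEquilibrium C ζ (Pi.single i α + Pi.single j (1 - α)) := by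
  set x : Fin n → ℝ := Pi.single i α + Pi.single j (1 - α) with hxdef
  have hxi : x i = α := by simp [hxdef, hij]
  have hxj : x j = 1 - α := by simp [hxdef, hij.symm]
  have hx0 : ∀ l ∉ sinkNodes C k, x l = 0 := fun l hl => by
    simp only [hk, Finset.mem_insert, Finset.mem_singleton, not_or] at hl
    simp [hxdef, hl.1, hl.2]
  have hx : x ∈ stdSimplex ℝ (Fin n) := by
    refine ⟨fun l => ?_, ?_⟩
    · by_cases hl : l ∈ sinkNodes C k
      · rw [hk] at hl
        rcases Finset.mem_insert.1 hl with h | h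
        · rw [h, hxi]; exact hα.1
        · rw [Finset.mem_singleton.1 h, hxj]; linarith [hα.2]
      · rw [hx0 l hl]
    · rw [← Finset.sum_subset (Finset.subset_univ _) fun l _ hl => hx0 l hl, hk,
        Finset.sum_pair hij, hxi, hxj]
      ring
  have hsum : ∀ f : Fin n → ℝ, ∑ l, (x l - x l ^ 2) * f l = (α - α ^ 2) * (f i + f j) := by
    intro f
    rw [← Finset.sum_subset (Finset.subset_univ (sinkNodes C k)), hk, Finset.sum_pair hij, hxi,
      hxj]
    · ring
    · intro l _ hl
      rw [hx0 l hl]; ring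
  have hfix : dfMap C x = x := by
    rw [dfMap_eq_self_iff, vecMul_eq_iff]
    intro l
    rw [hsum fun a => C a l]
    have h1 := card_eq_two_pair hC hij hk
    have h2 := card_eq_two_pair hC hij.symm (hk.trans (Finset.pair_comm i j))
    by_cases hl : l ∈ sinkNodes C k
    · rw [hk] at hl
      rcases Finset.mem_insert.1 hl with h | h
      · rw [h, hC.2 i, h2, hxi]; ring
      · rw [Finset.mem_singleton.1 h, hC.2 j, h1, hxj]; ring
    · rw [hC.sink_out (k := k) (by simp [hk]) hl, hC.sink_out (k := k) (by simp [hk]) hl,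
        hx0 l hl]
      ring
  have hR : ∀ l, IsReducibleNode C l → x l = 0 := fun l hl => hx0 l (hl k)
  -- Both splits give sink `k` the value 1, so both are the same vertex of the simplex of splits.
  have hpow : sinkPower C x = ζ := by
    have h1 : sinkPower C x k = 1 := by
      rw [sinkPower, hk, Finset.sum_pair hij, hxi, hxj]; ring
    have hs := sinkPower_mem_stdSimplex hx hR
    classical
    rw [stdSimplex_eq_single hs h1, stdSimplex_eq_single hζ hk1]
  rw [← hpow]
  refine isSplitEquilibrium_of_fixed hC hx hfix hR fun m l hl hl1 hm => ?_
  exfalso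
  have hlk : l ∈ sinkNodes C k := by
    by_contra h
    rw [hx0 l h] at hl1
    exact zero_ne_one hl1
  rw [sink_eq hl hlk, hk, Finset.card_pair hij] at hm
  omega

end Fixed

/-! ### Monotonicity, positivity and decay of the reducible mass along orbits -/

section Dynamics

variable {n : ℕ} {C : Matrix (Fin n) (Fin n) ℝ}

/-- Moves one step of the dynamics from the state to a test weight. All monotone linear functionals
below (sink powers, reducible mass, distance from a repelling vertex) are handled through it. -/
lemma dfMap_sum_mul (x w : Fin n → ℝ) :
    ∑ j, dfMap C x j * w j =
      ∑ i, (x i - x i ^ 2) * ∑ j, C i j * w j + ∑ j, x j ^ 2 * w j := by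
  simp only [dfMap_apply, add_mul, Finset.sum_add_distrib, Finset.sum_mul, Finset.mul_sum]
  rw [Finset.sum_comm]
  congr 1
  exact Finset.sum_congr rfl fun i _ => Finset.sum_congr rfl fun j _ => by ring

lemma dfMap_nonneg (hC : IsRelativeInteraction C) {x : Fin n → ℝ} (hx0 : ∀ i, 0 ≤ x i)
    (hx1 : ∀ i, x i ≤ 1) (i : Fin n) : 0 ≤ dfMap C x i := by
  rw [dfMap_apply]
  refine add_nonneg (Finset.sum_nonneg fun j _ => mul_nonneg (hC.nonneg j i) ?_) (sq_nonneg _)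
  nlinarith [hx0 j, hx1 j]

lemma dfMap_mem_stdSimplex (hC : IsRelativeInteraction C) {x : Fin n → ℝ}
    (hx : x ∈ stdSimplex ℝ (Fin n)) : dfMap C x ∈ stdSimplex ℝ (Fin n) := by
  refine ⟨dfMap_nonneg hC hx.1 (stdSimplex_le_one hx), ?_⟩
  have := dfMap_sum_mul (C := C) x (fun _ => 1)
  simp only [mul_one, hC.sum_row, ← Finset.sum_add_distrib, sub_add_cancel] at this
  rw [this, hx.2]

lemma sq_le_dfMap (hC : IsRelativeInteraction C) {x : Fin n → ℝ}
    (hx : x ∈ stdSimplex ℝ (Fin n)) (i : Fin n) : x i ^ 2 ≤ dfMap C x i := by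
  rw [dfMap_apply]
  exact le_add_of_nonneg_left
    (Finset.sum_nonneg fun j _ => mul_nonneg (hC.nonneg j i) (stdSimplex_logistic_nonneg hx j))

lemma mul_logistic_le_dfMap (hC : IsRelativeInteraction C) {x : Fin n → ℝ}
    (hx : x ∈ stdSimplex ℝ (Fin n)) (i j : Fin n) :
    C i j * (x i - x i ^ 2) ≤ dfMap C x j := by
  rw [dfMap_apply]
  have := Finset.single_le_sum (f := fun i => C i j * (x i - x i ^ 2))
    (fun l _ => mul_nonneg (hC.nonneg l j) (stdSimplex_logistic_nonneg hx l)) (Finset.mem_univ i)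
  linarith [sq_nonneg (x j)]

/-- Since $F(x) \ge x^2$ entrywise, an image equal to a vertex forces all other entries of `x` to
vanish already. -/
lemma dfMap_ne_one (hC : IsRelativeInteraction C) {x : Fin n → ℝ}
    (hx : x ∈ stdSimplex ℝ (Fin n)) (h1 : ∀ i, x i ≠ 1) (i : Fin n) : dfMap C x i ≠ 1 := by
  intro h
  have hs := stdSimplex_eq_single (dfMap_mem_stdSimplex hC hx) h
  refine h1 i ?_
  rw [← hx.2]
  refine (Finset.sum_eq_single i (fun j _ hj => ?_) (by simp)).symm
  have h2 := sq_le_dfMap hC hx j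
  rw [hs, Pi.single_eq_of_ne hj] at h2
  exact pow_eq_zero_iff two_ne_zero |>.1 (le_antisymm h2 (sq_nonneg _))

lemma iterate_mem_stdSimplex (hC : IsRelativeInteraction C) {x : Fin n → ℝ}
    (hx : x ∈ stdSimplex ℝ (Fin n)) (t : ℕ) : (dfMap C)^[t] x ∈ stdSimplex ℝ (Fin n) := by
  induction t with
  | zero => exact hx
  | succ t ih => rw [Function.iterate_succ_apply']; exact dfMap_mem_stdSimplex hC ih

lemma iterate_ne_one (hC : IsRelativeInteraction C) {x : Fin n → ℝ}
    (hx : x ∈ stdSimplex ℝ (Fin n)) (h1 : ∀ i, x i ≠ 1) (t : ℕ) :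
    ∀ i, (dfMap C)^[t] x i ≠ 1 := by
  induction t with
  | zero => exact h1
  | succ t ih =>
    rw [Function.iterate_succ_apply']
    exact dfMap_ne_one hC (iterate_mem_stdSimplex hC hx t) ih

open scoped Classical in
lemma sinkPower_eq_sum_mul (x : Fin n → ℝ) (k : Sink C) :
    sinkPower C x k = ∑ i, x i * if i ∈ sinkNodes C k then 1 else 0 := by
  simp [sinkPower, Finset.sum_ite_mem]

/-- `C` maps the indicator of a sink to 1 on the sink and to nonnegative values elsewhere: nothing
leaves, and reducible nodes may contribute. -/
lemma sinkPower_le_dfMap (hC : IsRelativeInteraction C) {x : Fin n → ℝ}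
    (hx : x ∈ stdSimplex ℝ (Fin n)) (k : Sink C) : sinkPower C x k ≤ sinkPower C (dfMap C x) k := by
  classical
  rw [sinkPower_eq_sum_mul, sinkPower_eq_sum_mul, dfMap_sum_mul, ← Finset.sum_add_distrib]
  refine Finset.sum_le_sum fun i _ => ?_
  by_cases hi : i ∈ sinkNodes C k
  · have : ∑ j, C i j * (if j ∈ sinkNodes C k then (1 : ℝ) else 0) = 1 := by
      simp only [mul_ite, mul_one, mul_zero, Finset.sum_ite_mem, Finset.univ_inter, hC.sum_sink hi]
    rw [this, if_pos hi]
    linarith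
  · rw [if_neg hi, mul_zero, mul_zero, add_zero]
    refine mul_nonneg (stdSimplex_logistic_nonneg hx i) (Finset.sum_nonneg fun j _ => ?_)
    refine mul_nonneg (hC.nonneg i j) ?_
    split_ifs <;> norm_num

lemma sinkPower_dfMap_eq (hC : IsRelativeInteraction C) {x : Fin n → ℝ}
    (hR : ∀ i, IsReducibleNode C i → x i = 0) (k : Sink C) :
    sinkPower C (dfMap C x) k = sinkPower C x k := by
  classical
  rw [sinkPower_eq_sum_mul, sinkPower_eq_sum_mul, dfMap_sum_mul, ← Finset.sum_add_distrib]
  refine Finset.sum_congr rfl fun i _ => ?_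
  by_cases hi : i ∈ sinkNodes C k
  · have : ∑ j, C i j * (if j ∈ sinkNodes C k then (1 : ℝ) else 0) = 1 := by
      simp only [mul_ite, mul_one, mul_zero, Finset.sum_ite_mem, Finset.univ_inter, hC.sum_sink hi]
    rw [this, if_pos hi]
    ring
  · rw [if_neg hi, mul_zero, mul_zero, add_zero]
    by_cases hr : IsReducibleNode C i
    · rw [hR i hr]; ring
    · obtain ⟨l, hl⟩ := not_isReducibleNode.1 hr
      rw [Finset.sum_eq_zero, mul_zero]
      intro j _
      split_ifs with hj
      · rw [hC.sink_out hl fun h => hi (sink_eq h hj ▸ hl), zero_mul]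
      · rw [mul_zero]

lemma dfMap_reducible_eq_zero (hC : IsRelativeInteraction C) {x : Fin n → ℝ}
    (hR : ∀ i, IsReducibleNode C i → x i = 0) {i : Fin n} (hi : IsReducibleNode C i) :
    dfMap C x i = 0 := by
  rw [dfMap_apply, hR i hi, Finset.sum_eq_zero]
  · norm_num
  · intro j _
    by_cases hj : IsReducibleNode C j
    · rw [hR j hj]; ring
    · rw [hC.nonred_out hj hi, zero_mul]

lemma iterate_reducible_eq_zero (hC : IsRelativeInteraction C) {x : Fin n → ℝ}
    (hR : ∀ i, IsReducibleNode C i → x i = 0) (t : ℕ) :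
    ∀ i, IsReducibleNode C i → (dfMap C)^[t] x i = 0 := by
  induction t with
  | zero => exact hR
  | succ t ih =>
    rw [Function.iterate_succ_apply']
    exact fun i hi => dfMap_reducible_eq_zero hC ih hi

lemma iterate_sinkPower_eq (hC : IsRelativeInteraction C) {x : Fin n → ℝ}
    (hR : ∀ i, IsReducibleNode C i → x i = 0) (k : Sink C) (t : ℕ) :
    sinkPower C ((dfMap C)^[t] x) k = sinkPower C x k := by
  induction t with
  | zero => rfl
  | succ t ih =>
    rw [Function.iterate_succ_apply', sinkPower_dfMap_eq hC (iterate_reducible_eq_zero hC hR t), ih]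

lemma sinkPower_iterate_monotone (hC : IsRelativeInteraction C) {x : Fin n → ℝ}
    (hx : x ∈ stdSimplex ℝ (Fin n)) (k : Sink C) :
    Monotone fun t : ℕ => sinkPower C ((dfMap C)^[t] x) k :=
  monotone_nat_of_le_succ fun t => by
    rw [Function.iterate_succ_apply']
    exact sinkPower_le_dfMap hC (iterate_mem_stdSimplex hC hx t) k

/-- The nodes with a path to the sink contain all their predecessors, so no mass can flow in from
outside this set. -/
lemma iterate_eq_zero_of_reaches (hC : IsRelativeInteraction C) {x : Fin n → ℝ} {k : Sink C}
    (h : ∀ i, (∃ j ∈ sinkNodes C k, Reaches C i j) → x i = 0) (t : ℕ) :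
    ∀ i, (∃ j ∈ sinkNodes C k, Reaches C i j) → (dfMap C)^[t] x i = 0 := by
  induction t with
  | zero => exact h
  | succ t ih =>
    rintro i ⟨j, hj, hij⟩
    rw [Function.iterate_succ_apply', dfMap_apply, ih i ⟨j, hj, hij⟩, Finset.sum_eq_zero]
    · norm_num
    · intro l _
      rcases (hC.nonneg l i).eq_or_lt with h0 | h0
      · rw [← h0, zero_mul]
      · rw [ih l ⟨j, hj, Relation.ReflTransGen.head (r := fun i j => 0 < C i j) h0 hij⟩]; ring

lemma eq_zero_of_reaches_sink {x : Fin n → ℝ} (hx : ∀ i, 0 ≤ x i) {k : Sink C}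
    (h0 : sinkPower C x k = 0)
    (hR : ∀ i, IsReducibleNode C i → (∃ j ∈ sinkNodes C k, Reaches C i j) → x i = 0) (i : Fin n)
    (hi : ∃ j ∈ sinkNodes C k, Reaches C i j) : x i = 0 := by
  by_cases hr : IsReducibleNode C i
  · exact hR i hr hi
  · obtain ⟨l, hl⟩ := not_isReducibleNode.1 hr
    obtain ⟨j, hj, hij⟩ := hi
    have : l = k := sink_eq (sink_closed_reaches hl hij) hj
    exact eq_zero_of_sinkPower_eq_zero hx h0 (this ▸ hl)

/-- A positive entry stays positive because $F(x) \ge x^2$, and it feeds its successors because it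
never equals 1. -/
lemma iterate_pos (hC : IsRelativeInteraction C) {x : Fin n → ℝ}
    (hx : x ∈ stdSimplex ℝ (Fin n)) (h1 : ∀ i, x i ≠ 1) {i j : Fin n} (hij : Reaches C i j)
    (hi : 0 < x i) : ∃ T, ∀ t ≥ T, 0 < (dfMap C)^[t] x j := by
  have hstep : ∀ j t, 0 < (dfMap C)^[t] x j → ∀ s ≥ t, 0 < (dfMap C)^[s] x j := by
    intro j t ht s hs
    induction s, hs using Nat.le_induction with
    | base => exact ht
    | succ s _ ih =>
      rw [Function.iterate_succ_apply']
      exact (pow_pos ih 2).trans_le (sq_le_dfMap hC (iterate_mem_stdSimplex hC hx s) j)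
  induction hij with
  | refl => exact ⟨0, hstep i 0 hi⟩
  | @tail a b _ hab ih =>
    obtain ⟨T, hT⟩ := ih
    refine ⟨T + 1, hstep b (T + 1) ?_⟩
    have hm := iterate_mem_stdSimplex hC hx T
    have hlt := lt_of_le_of_ne (stdSimplex_le_one hm a) (iterate_ne_one hC hx h1 T a)
    have hpos := hT T le_rfl
    rw [Function.iterate_succ_apply']
    exact (mul_pos hab (by nlinarith)).trans_le (mul_logistic_le_dfMap hC hm a b)

/-- The reducible mass decays exponentially unless the trajectory starts at a vertex. -/
lemma exists_reducibleMass_le (hC : IsRelativeInteraction C) {x : Fin n → ℝ}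
    (hx : x ∈ stdSimplex ℝ (Fin n)) (h1 : ∀ i, x i ≠ 1) :
    ∃ A r : ℝ, 0 ≤ A ∧ 0 < r ∧ r < 1 ∧ ∀ t, reducibleMass C ((dfMap C)^[t] x) ≤ A * r ^ t := by
  classical
  obtain ⟨i, hi⟩ : ∃ i, 0 < x i := by
    by_contra! h
    have := Finset.sum_nonpos (s := Finset.univ) fun i _ => h i
    rw [hx.2] at this
    linarith
  obtain ⟨k, j, hj, hij⟩ := exists_sink_reaches C i
  obtain ⟨T, hT⟩ := iterate_pos hC hx h1 hij hi
  have hmem := iterate_mem_stdSimplex hC hx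
  set X : ℕ → Fin n → ℝ := fun t => (dfMap C)^[t] x with hX
  have hsucc : ∀ t, X (t + 1) = dfMap C (X t) := fun t => Function.iterate_succ_apply' _ _ _
  set ε := sinkPower C (X T) k with hε
  have hε0 : 0 < ε := (hT T le_rfl).trans_le (le_sinkPower (hmem T).1 hj)
  have hred : ∀ t ≥ T, ∀ i, IsReducibleNode C i → X t i ≤ 1 - ε := by
    intro t ht i hi
    have h2 := sum_eq_sum_sinkPower_add C (X t)
    rw [(hmem t).2] at h2
    have h3 := le_reducibleMass (hmem t).1 hi
    have h4 := Finset.single_le_sum (f := fun l => sinkPower C (X t) l)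
      (fun l _ => sinkPower_nonneg (hmem t).1 l) (Finset.mem_univ k)
    have h5 : ε ≤ sinkPower C (X t) k := sinkPower_iterate_monotone hC hx k ht
    linarith
  obtain ⟨w, η, hη, hw0, hwhalf, hw1, hwR, hwS⟩ := hC.exists_reducible_weights
  have hwnn : ∀ i, 0 ≤ w i := fun i => by
    by_cases hi : IsReducibleNode C i
    · linarith [hwhalf i hi]
    · rw [hw0 i hi]
  -- The floor 1/2 only keeps the rate positive.
  set ρ := max (1 - η * ε) (1 / 2) with hρ
  have hρ0 : 0 < ρ := lt_max_of_lt_right (by norm_num)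
  have hρ1 : ρ < 1 := max_lt (by nlinarith) (by norm_num)
  set Lf : ℕ → ℝ := fun t => ∑ i, X t i * w i with hL
  have hLnn : ∀ t, 0 ≤ Lf t := fun t =>
    Finset.sum_nonneg fun i _ => mul_nonneg ((hmem t).1 i) (hwnn i)
  have hmL : ∀ t, reducibleMass C (X t) ≤ 2 * Lf t := by
    intro t
    have : reducibleMass C (X t) ≤ ∑ i with IsReducibleNode C i, 2 * (X t i * w i) := by
      refine Finset.sum_le_sum fun i hi => ?_
      have := hwhalf i (by simpa using hi)
      nlinarith [(hmem t).1 i]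
    refine this.trans ?_
    rw [← Finset.mul_sum]
    exact mul_le_mul_of_nonneg_left (Finset.sum_le_sum_of_subset_of_nonneg (Finset.subset_univ _)
      fun i _ _ => mul_nonneg ((hmem t).1 i) (hwnn i)) zero_le_two
  have hLstep : ∀ t ≥ T, Lf (t + 1) ≤ ρ * Lf t := by
    intro t ht
    simp only [hL]
    rw [hsucc, dfMap_sum_mul, ← Finset.sum_add_distrib, Finset.mul_sum]
    refine Finset.sum_le_sum fun i _ => ?_
    have hy := stdSimplex_logistic_nonneg (hmem t) i
    have hx0 := (hmem t).1 i
    by_cases hi : IsReducibleNode C i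
    · have h2 := mul_le_mul_of_nonneg_left (hwR i hi) hy
      have h3 := hred t ht i hi
      -- The sink `k` keeps at least `ε`, so reducible entries are at most `1 - ε` and pass on a
      -- fixed fraction of their mass; each such step loses weight by `η`.
      have h5 : ε * X t i ≤ X t i - X t i ^ 2 := by nlinarith
      have h6 : η * ε * (X t i * w i) ≤ η * (X t i - X t i ^ 2) := by
        have := mul_le_mul_of_nonneg_left (mul_le_of_le_one_right hx0 (hw1 i)) (mul_pos hη hε0).le
        nlinarith
      have h7 : (1 - η * ε) * (X t i * w i) ≤ ρ * (X t i * w i) :=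
        mul_le_mul_of_nonneg_right (le_max_left _ _) (mul_nonneg hx0 (hwnn i))
      nlinarith
    · rw [hwS i hi, hw0 i hi]; simp
  have hLT : ∀ s, Lf (T + s) ≤ ρ ^ s := by
    intro s
    induction s with
    | zero =>
      rw [pow_zero, ← (hmem T).2]
      exact Finset.sum_le_sum fun i _ => mul_le_of_le_one_right ((hmem T).1 i) (hw1 i)
    | succ s ih =>
      calc Lf (T + (s + 1)) ≤ ρ * Lf (T + s) := hLstep (T + s) (by omega)
        _ ≤ ρ * ρ ^ s := mul_le_mul_of_nonneg_left ih hρ0.le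
        _ = ρ ^ (s + 1) := by ring
  -- The 2 undoes the lower bound 1/2 on the weights, and dividing by `ρ ^ T` also covers times
  -- before `T`, when the mass is at most 1.
  refine ⟨2 / ρ ^ T, ρ, by positivity, hρ0, hρ1, fun t => ?_⟩
  rcases le_total T t with ht | ht
  · obtain ⟨s, rfl⟩ := Nat.exists_eq_add_of_le ht
    calc reducibleMass C (X (T + s)) ≤ 2 * ρ ^ s := (hmL _).trans (by linarith [hLT s])
      _ = 2 / ρ ^ T * ρ ^ (T + s) := by rw [pow_add]; field_simp
  · have h2 := sum_eq_sum_sinkPower_add C (X t)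
    rw [(hmem t).2] at h2
    have h3 : 0 ≤ ∑ k, sinkPower C (X t) k :=
      Finset.sum_nonneg fun k _ => sinkPower_nonneg (hmem t).1 k
    have h4 : 1 ≤ ρ ^ t / ρ ^ T :=
      (one_le_div (by positivity)).2 (pow_le_pow_of_le_one hρ0.le hρ1.le ht)
    calc reducibleMass C (X t) ≤ 1 := by linarith
      _ ≤ 2 * (ρ ^ t / ρ ^ T) := by linarith
      _ = _ := by ring

end Dynamics

/-! ### Lyapunov function and subsequential limits -/

section Lyapunov

variable {n : ℕ} {C : Matrix (Fin n) (Fin n) ℝ}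

/-- The transposed chain contracts the norm weighted by `1 / c`,
for a stationary vector `c`. -/
lemma sum_sq_vecMul_div_le (hC : IsRelativeInteraction C) {c : Fin n → ℝ} (hc0 : ∀ i, 0 ≤ c i)
    (hc : c ᵥ* C = c) {v : Fin n → ℝ} (hv : ∀ i, c i = 0 → v i = 0) :
    ∑ i, (∑ j, C j i * v j) ^ 2 / c i ≤ ∑ j, v j ^ 2 / c j := by
  have hterm : ∀ i, (∑ j, C j i * v j) ^ 2 / c i ≤ ∑ j, C j i * (v j ^ 2 / c j) := by
    intro i
    have hnn : ∀ j ∈ Finset.univ, 0 ≤ C j i * (v j ^ 2 / c j) := fun j _ =>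
      mul_nonneg (hC.nonneg j i) (div_nonneg (sq_nonneg _) (hc0 j))
    refine div_le_of_le_mul₀ (hc0 i) (Finset.sum_nonneg hnn) ?_
    -- Cauchy–Schwarz with weights `c j * C j i`, whose sum over `j` is `c i` by stationarity.
    have h := Finset.sum_sq_le_sum_mul_sum_of_sq_le_mul Finset.univ
      (r := fun j => C j i * v j) (f := fun j => C j i * (v j ^ 2 / c j))
      (g := fun j => c j * C j i) hnn (fun j _ => mul_nonneg (hc0 j) (hC.nonneg j i))
      (fun j _ => by
        by_cases h0 : c j = 0
        · simp [h0, hv j h0]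
        · exact le_of_eq (by field_simp))
    rwa [vecMul_eq_iff.1 hc i] at h
  refine (Finset.sum_le_sum fun i _ => hterm i).trans_eq ?_
  rw [Finset.sum_comm]
  simp only [← Finset.sum_mul, hC.sum_row, one_mul]

/-- The Lyapunov function `∑ (x² / 2 - x³ / 3) / c`. -/
noncomputable def lyapunov (c x : Fin n → ℝ) : ℝ :=
  ∑ i, (x i ^ 2 / 2 - x i ^ 3 / 3) / c i

/-- The guaranteed decrease of the Lyapunov function. -/
noncomputable def dissipation (C : Matrix (Fin n) (Fin n) ℝ) (c x : Fin n → ℝ) : ℝ :=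
  ∑ i, (dfMap C x i - x i) ^ 2 * (2 * x i + dfMap C x i) / (3 * c i)

/-- With $y=x-x^2$ and $d=F(x)-x$, one has $C^\top y = y+d$. The change of the Lyapunov function
plus the dissipation equals half the change of $\sum y_i^2/c_i$ under $C^\top$, which is at most
zero. Reducible entries must vanish, since `1 / c` cannot see them. -/
lemma lyapunov_dfMap_le (hC : IsRelativeInteraction C) {c : Fin n → ℝ} (hc0 : ∀ i, 0 ≤ c i)
    (hc : c ᵥ* C = c) {x : Fin n → ℝ} (hx : ∀ i, c i = 0 → x i = 0) :
    lyapunov c (dfMap C x) ≤ lyapunov c x - dissipation C c x := by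
  have h := sum_sq_vecMul_div_le hC hc0 hc (v := fun i => x i - x i ^ 2)
    (fun i hi => by simp [hx i hi])
  have hid : lyapunov c (dfMap C x) - lyapunov c x + dissipation C c x =
      (∑ i, (∑ j, C j i * (x j - x j ^ 2)) ^ 2 / c i - ∑ i, (x i - x i ^ 2) ^ 2 / c i) / 2 := by
    simp only [lyapunov, dissipation]
    rw [← Finset.sum_sub_distrib, ← Finset.sum_sub_distrib, ← Finset.sum_add_distrib,
      Finset.sum_div]
    refine Finset.sum_congr rfl fun i _ => ?_
    have hb : ∑ j, C j i * (x j - x j ^ 2) = dfMap C x i - x i ^ 2 := by rw [dfMap_apply]; ring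
    rw [hb]
    by_cases hi : c i = 0
    · simp [hi]
    · field_simp
      ring
  linarith

open scoped Classical in
/-- Delete the reducible entries. -/
noncomputable def dropReducible (C : Matrix (Fin n) (Fin n) ℝ) (x : Fin n → ℝ) : Fin n → ℝ :=
  fun i => if IsReducibleNode C i then 0 else x i

lemma dropReducible_of_not {x : Fin n → ℝ} {i : Fin n} (hi : ¬ IsReducibleNode C i) :
    dropReducible C x i = x i := if_neg hi

lemma dropReducible_of {x : Fin n → ℝ} {i : Fin n} (hi : IsReducibleNode C i) :
    dropReducible C x i = 0 := if_pos hi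

@[fun_prop]
lemma continuous_dropReducible : Continuous (dropReducible C) := by
  refine continuous_pi fun i => ?_
  by_cases hi : IsReducibleNode C i
  · simp only [dropReducible_of hi]; fun_prop
  · simp only [dropReducible_of_not hi]; fun_prop

lemma continuous_dissipation (c : Fin n → ℝ) : Continuous (dissipation C c) := by
  have h : ∀ i, Continuous fun x => dfMap C x i := fun i =>
    (continuous_apply i).comp continuous_dfMap
  unfold dissipation
  fun_prop

/-- Reducible nodes send out at most their mass. The upper bound needs an irreducible target: at a
reducible one the square of the entry is dropped as well. -/
lemma dropReducible_dfMap (hC : IsRelativeInteraction C) {x : Fin n → ℝ}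
    (hx : x ∈ stdSimplex ℝ (Fin n)) (i : Fin n) :
    dfMap C (dropReducible C x) i ≤ dfMap C x i ∧
      (¬ IsReducibleNode C i →
        dfMap C x i ≤ dfMap C (dropReducible C x) i + reducibleMass C x) := by
  classical
  have hterm : ∀ j, C j i * (dropReducible C x j - dropReducible C x j ^ 2) ≤
      C j i * (x j - x j ^ 2) := by
    intro j
    by_cases hj : IsReducibleNode C j
    · rw [dropReducible_of hj]
      have := mul_nonneg (hC.nonneg j i) (stdSimplex_logistic_nonneg hx j)
      simpa using this
    · rw [dropReducible_of_not hj]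
  constructor
  · rw [dfMap_apply, dfMap_apply]
    refine add_le_add (Finset.sum_le_sum fun j _ => hterm j) ?_
    by_cases hi : IsReducibleNode C i
    · rw [dropReducible_of hi, zero_pow two_ne_zero]; exact sq_nonneg _
    · rw [dropReducible_of_not hi]
  · intro hi
    rw [dfMap_apply, dfMap_apply, dropReducible_of_not hi, reducibleMass, Finset.sum_filter]
    have : ∑ j, C j i * (x j - x j ^ 2) ≤
        ∑ j, C j i * (dropReducible C x j - dropReducible C x j ^ 2) +
          ∑ j, if IsReducibleNode C j then x j else 0 := by
      rw [← Finset.sum_add_distrib]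
      refine Finset.sum_le_sum fun j _ => ?_
      by_cases hj : IsReducibleNode C j
      · rw [dropReducible_of hj, if_pos hj]
        have h1 := mul_le_of_le_one_left (stdSimplex_logistic_nonneg hx j) (hC.le_one j i)
        nlinarith [sq_nonneg (x j)]
      · rw [dropReducible_of_not hj, if_neg hj, add_zero]
    linarith

lemma lyapunov_dropReducible {c : Fin n → ℝ} (hcR : ∀ i, IsReducibleNode C i → c i = 0)
    (x : Fin n → ℝ) : lyapunov c (dropReducible C x) = lyapunov c x := by
  refine Finset.sum_congr rfl fun i _ => ?_
  by_cases hi : IsReducibleNode C i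
  · simp [hcR i hi]
  · rw [dropReducible_of_not hi]

/-- The function $s^2/2-s^3/3$ has slope $s-s^2 \le 1$ on $[0,1]$, so restoring the deleted
reducible inflow costs at most the reducible mass over `c i`. Division by zero gives zero, so
reducible nodes do not count. -/
lemma lyapunov_step (hC : IsRelativeInteraction C) {c : Fin n → ℝ} (hc0 : ∀ i, 0 ≤ c i)
    (hcp : ∀ i, 0 < c i ↔ ¬ IsReducibleNode C i) (hc : c ᵥ* C = c) {x : Fin n → ℝ}
    (hx : x ∈ stdSimplex ℝ (Fin n)) :
    lyapunov c (dfMap C x) ≤ lyapunov c x - dissipation C c (dropReducible C x) +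
      (∑ i, 1 / c i) * reducibleMass C x := by
  have hcR : ∀ i, IsReducibleNode C i → c i = 0 := fun i hi =>
    le_antisymm (not_lt.1 fun h => (hcp i).1 h hi) (hc0 i)
  have h1 := lyapunov_dfMap_le hC hc0 hc (x := dropReducible C x) (fun i hi =>
    dropReducible_of (by by_contra h; exact ((hcp i).2 h).ne' hi))
  rw [lyapunov_dropReducible hcR] at h1
  suffices h : lyapunov c (dfMap C x) ≤ lyapunov c (dfMap C (dropReducible C x)) +
      (∑ i, 1 / c i) * reducibleMass C x by linarith
  unfold lyapunov
  rw [Finset.sum_mul, ← Finset.sum_add_distrib]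
  refine Finset.sum_le_sum fun i _ => ?_
  by_cases hi : IsReducibleNode C i
  · simp [hcR i hi]
  obtain ⟨ha, hb⟩ := dropReducible_dfMap hC hx i
  specialize hb hi
  have hlow : 0 ≤ dfMap C (dropReducible C x) i := by
    refine dfMap_nonneg hC (fun j => ?_) (fun j => ?_) i
    · by_cases hj : IsReducibleNode C j
      · rw [dropReducible_of hj]
      · rw [dropReducible_of_not hj]; exact hx.1 j
    · by_cases hj : IsReducibleNode C j
      · rw [dropReducible_of hj]; exact zero_le_one
      · rw [dropReducible_of_not hj]; exact stdSimplex_le_one hx j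
  have hup : dfMap C x i ≤ 1 := stdSimplex_le_one (dfMap_mem_stdSimplex hC hx) i
  rw [one_div, inv_mul_eq_div, ← add_div]
  refine div_le_div_of_nonneg_right ?_ (hc0 i)
  generalize dfMap C x i = b at *
  generalize dfMap C (dropReducible C x) i = a at *
  have : (b - a) - ((b ^ 2 / 2 - b ^ 3 / 3) - (a ^ 2 / 2 - a ^ 3 / 3)) ≥ 0 := by
    have : (b - a) - ((b ^ 2 / 2 - b ^ 3 / 3) - (a ^ 2 / 2 - a ^ 3 / 3)) =
      (b - a) * ((1 - b) / 2 + (1 - a) / 2 + (a ^ 2 + a * b + b ^ 2) / 3) := by ring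
    rw [this]
    refine mul_nonneg (by linarith) ?_
    have : 0 ≤ a * b := mul_nonneg hlow (hlow.trans ha)
    nlinarith [sq_nonneg a, sq_nonneg b]
  linarith

lemma dissipation_nonneg (hC : IsRelativeInteraction C) {c : Fin n → ℝ} (hc0 : ∀ i, 0 ≤ c i)
    {x : Fin n → ℝ} (hx0 : ∀ i, 0 ≤ x i) (hx1 : ∀ i, x i ≤ 1) (i : Fin n) :
    0 ≤ (dfMap C x i - x i) ^ 2 * (2 * x i + dfMap C x i) / (3 * c i) := by
  have := dfMap_nonneg hC hx0 hx1 i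
  have := hx0 i
  have := hc0 i
  positivity

lemma fixed_of_dissipation_eq_zero (hC : IsRelativeInteraction C) {c : Fin n → ℝ}
    (hc0 : ∀ i, 0 ≤ c i) (hcp : ∀ i, 0 < c i ↔ ¬ IsReducibleNode C i) {x : Fin n → ℝ}
    (hx0 : ∀ i, 0 ≤ x i) (hx1 : ∀ i, x i ≤ 1) (hR : ∀ i, IsReducibleNode C i → x i = 0)
    (h : dissipation C c x = 0) : dfMap C x = x := by
  ext i
  by_cases hi : IsReducibleNode C i
  · rw [dfMap_reducible_eq_zero hC hR hi, hR i hi]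
  have h1 := (Finset.sum_eq_zero_iff_of_nonneg fun i _ => dissipation_nonneg hC hc0 hx0 hx1 i).1 h i
    (Finset.mem_univ i)
  have hci := (hcp i).2 hi
  rcases div_eq_zero_iff.1 h1 with h2 | h2
  · rcases mul_eq_zero.1 h2 with h3 | h3
    · linarith [pow_eq_zero_iff two_ne_zero |>.1 h3]
    · have := dfMap_nonneg hC hx0 hx1 i
      have := hx0 i
      linarith
  · linarith

/-- Subsequential limits of a non-vertex trajectory are fixed points without reducible mass. -/
lemma fixed_of_tendsto_subseq (hC : IsRelativeInteraction C) {x : Fin n → ℝ}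
    (hx : x ∈ stdSimplex ℝ (Fin n)) (h1 : ∀ i, x i ≠ 1) {φ : ℕ → ℕ} (hφ : StrictMono φ)
    {p : Fin n → ℝ}
    (hp : Filter.Tendsto (fun t => (dfMap C)^[φ t] x) Filter.atTop (𝓝 p)) :
    p ∈ stdSimplex ℝ (Fin n) ∧ (∀ i, IsReducibleNode C i → p i = 0) ∧ dfMap C p = p := by
  obtain ⟨c, hc0, hcp, hc⟩ := exists_stationary_pos_iff hC
  obtain ⟨A, r, hA, hr0, hr1, hm⟩ := exists_reducibleMass_le hC hx h1
  have hmem := iterate_mem_stdSimplex hC hx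
  set X : ℕ → Fin n → ℝ := fun t => (dfMap C)^[t] x with hX
  have hsucc : ∀ t, X (t + 1) = dfMap C (X t) := fun t => Function.iterate_succ_apply' _ _ _
  have hdrop0 : ∀ t i, 0 ≤ dropReducible C (X t) i := fun t i => by
    by_cases hj : IsReducibleNode C i
    · rw [dropReducible_of hj]
    · rw [dropReducible_of_not hj]; exact (hmem t).1 i
  have hdrop1 : ∀ t i, dropReducible C (X t) i ≤ 1 := fun t i => by
    by_cases hj : IsReducibleNode C i
    · rw [dropReducible_of hj]; exact zero_le_one
    · rw [dropReducible_of_not hj]; exact stdSimplex_le_one (hmem t) i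
  have hpmem : p ∈ stdSimplex ℝ (Fin n) :=
    (isClosed_stdSimplex ℝ (Fin n)).mem_of_tendsto hp (Filter.Eventually.of_forall fun t => hmem _)
  have hred : Filter.Tendsto (fun t => reducibleMass C (X t)) Filter.atTop (𝓝 0) := by
    refine squeeze_zero (fun t => reducibleMass_nonneg (hmem t).1) hm ?_
    simpa using (tendsto_pow_atTop_nhds_zero_of_lt_one hr0.le hr1).const_mul A
  have hpred : reducibleMass C p = 0 :=
    tendsto_nhds_unique ((continuous_reducibleMass.tendsto p).comp hp)
      (hred.comp hφ.tendsto_atTop)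
  have hpR : ∀ i, IsReducibleNode C i → p i = 0 := fun i hi =>
    le_antisymm (hpred ▸ le_reducibleMass hpmem.1 hi) (hpmem.1 i)
  refine ⟨hpmem, hpR, ?_⟩
  set M := ∑ i, 1 / c i with hM
  have hM0 : 0 ≤ M := Finset.sum_nonneg fun i _ => one_div_nonneg.2 (hc0 i)
  -- `B * r ^ t` is the sum of all errors from time `t` on. Adding it to the Lyapunov value gives a
  -- decreasing sequence whose drops dominate the dissipation, which is therefore summable.
  set B := M * A / (1 - r) with hB
  have hB0 : 0 ≤ B := div_nonneg (mul_nonneg hM0 hA) (by linarith)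
  have hBr : B * (1 - r) = M * A := div_mul_cancel₀ _ (by linarith)
  set Dt : ℕ → ℝ := fun t => dissipation C c (dropReducible C (X t)) with hDt
  have hD0 : ∀ t, 0 ≤ Dt t := fun t =>
    Finset.sum_nonneg fun i _ => dissipation_nonneg hC hc0 (hdrop0 t) (hdrop1 t) i
  have hV0 : ∀ t, 0 ≤ lyapunov c (X t) := fun t => Finset.sum_nonneg fun i _ => by
    refine div_nonneg ?_ (hc0 i)
    nlinarith [(hmem t).1 i, stdSimplex_le_one (hmem t) i, sq_nonneg (X t i),
      mul_nonneg (sq_nonneg (X t i)) (sub_nonneg.2 (stdSimplex_le_one (hmem t) i))]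
  have hstep : ∀ t, Dt t ≤ (lyapunov c (X t) + B * r ^ t) -
      (lyapunov c (X (t + 1)) + B * r ^ (t + 1)) := fun t => by
    have h2 := lyapunov_step hC hc0 hcp hc (hmem t)
    have h3 := mul_le_mul_of_nonneg_left (hm t) hM0
    have h4 : B * r ^ t - B * r ^ (t + 1) = M * (A * r ^ t) := by
      rw [pow_succ]; linear_combination r ^ t * hBr
    rw [hsucc]
    change lyapunov c (dfMap C (X t)) ≤ _ at h2
    simp only [hDt]
    change M * reducibleMass C (X t) ≤ _ at h3
    linarith
  have hsumm : Summable Dt := by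
    refine summable_of_sum_range_le (c := lyapunov c (X 0) + B * r ^ 0) hD0 fun N => ?_
    have : ∑ t ∈ Finset.range N, Dt t ≤ (lyapunov c (X 0) + B * r ^ 0) -
        (lyapunov c (X N) + B * r ^ N) := by
      rw [← Finset.sum_range_sub' fun t => lyapunov c (X t) + B * r ^ t]
      exact Finset.sum_le_sum fun t _ => hstep t
    have := hV0 N
    have : 0 ≤ B * r ^ N := by positivity
    linarith
  have hDp : dissipation C c (dropReducible C p) = 0 :=
    tendsto_nhds_unique
      ((((continuous_dissipation c).comp continuous_dropReducible).tendsto p).comp hp)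
      (hsumm.tendsto_atTop_zero.comp hφ.tendsto_atTop)
  have hdp : dropReducible C p = p := by
    ext i
    by_cases hi : IsReducibleNode C i
    · rw [dropReducible_of hi, hpR i hi]
    · rw [dropReducible_of_not hi]
  rw [hdp] at hDp
  exact fixed_of_dissipation_eq_zero hC hc0 hcp hpmem.1 (stdSimplex_le_one hpmem) hpR hDp

end Lyapunov

/-! ### Convergence to isolated limit points -/

section Isolated

/-- An orbit in a compact set converges to each isolated subsequential limit that is fixed. -/
lemma tendsto_of_isolated_subseq_limit {E : Type*} [MetricSpace E] [ProperSpace E] {F : E → E}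
    (hF : Continuous F)
    {X : ℕ → E} (hX : ∀ t, X (t + 1) = F (X t)) {p : E} (hp : F p = p) {φ : ℕ → ℕ}
    (hφ : StrictMono φ) (hφp : Filter.Tendsto (X ∘ φ) Filter.atTop (𝓝 p)) {R : ℝ} (hR : 0 < R)
    (hiso : ∀ (ψ : ℕ → ℕ) q, StrictMono ψ → Filter.Tendsto (X ∘ ψ) Filter.atTop (𝓝 q) →
      dist q p ≤ R → q = p) :
    Filter.Tendsto X Filter.atTop (𝓝 p) := by
  rw [Metric.tendsto_atTop]
  intro ε hε
  set e := min ε R with he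
  have he0 : 0 < e := lt_min hε hR
  obtain ⟨δ, hδ0, hδ⟩ := Metric.continuous_iff.1 hF p e he0
  rw [hp] at hδ
  set d := min δ e with hd
  have hd0 : 0 < d := lt_min hδ0 he0
  -- Infinitely many visits to this compact shell would produce a limit point in it, and isolation
  -- would make that point `p`, which is not in the shell.
  have hK : IsCompact (Metric.closedBall p e \ Metric.ball p d) :=
    (isCompact_closedBall p e).diff Metric.isOpen_ball
  have hev : ∀ᶠ t in Filter.atTop, X t ∉ Metric.closedBall p e \ Metric.ball p d := by
    by_contra h
    rw [Filter.not_eventually] at h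
    simp only [not_not] at h
    obtain ⟨q, hq, ψ, hψ, hlim⟩ := hK.tendsto_subseq' h
    have hqp := hiso ψ q hψ hlim ((Metric.mem_closedBall.1 hq.1).trans (min_le_right _ _))
    rw [hqp] at hq
    exact hq.2 (Metric.mem_ball_self hd0)
  obtain ⟨T, hT⟩ := Filter.eventually_atTop.1 hev
  obtain ⟨s, hs, hsT⟩ : ∃ s, dist (X s) p < d ∧ T ≤ s := by
    have h1 := (Metric.tendsto_nhds.1 hφp d hd0).and
      (hφ.tendsto_atTop.eventually_ge_atTop T)
    obtain ⟨t, ht1, ht2⟩ := h1.exists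
    exact ⟨φ t, ht1, ht2⟩
  -- By continuity at the fixed point, one step from the ball of radius `d` stays within `e`, so the
  -- orbit cannot jump over the shell that it no longer visits.
  have hall : ∀ t ≥ s, dist (X t) p < d := by
    intro t ht
    induction t, ht using Nat.le_induction with
    | base => exact hs
    | succ t hst ih =>
      have h1 : dist (X (t + 1)) p < e := by
        rw [hX]; exact hδ _ (ih.trans_le (min_le_left _ _))
      by_contra hnot
      exact hT (t + 1) (by omega) ⟨Metric.mem_closedBall.2 h1.le, fun h => hnot h⟩
  exact ⟨s, fun t ht => (hall t ht).trans_le ((min_le_right _ _).trans (min_le_left _ _))⟩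

end Isolated

/-! ### Limits of sink powers, repelling vertices and convergence -/

section Limits

variable {n : ℕ} {C : Matrix (Fin n) (Fin n) ℝ}

lemma tendsto_reducibleMass (hC : IsRelativeInteraction C) {x : Fin n → ℝ}
    (hx : x ∈ stdSimplex ℝ (Fin n)) (h1 : ∀ i, x i ≠ 1) :
    Filter.Tendsto (fun t : ℕ => reducibleMass C ((dfMap C)^[t] x)) Filter.atTop (𝓝 0) := by
  obtain ⟨A, r, hA, hr0, hr1, hm⟩ := exists_reducibleMass_le hC hx h1
  refine squeeze_zero (fun t => reducibleMass_nonneg (iterate_mem_stdSimplex hC hx t).1) hm ?_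
  simpa using (tendsto_pow_atTop_nhds_zero_of_lt_one hr0.le hr1).const_mul A

/-- The sink powers of a non-vertex trajectory converge, at the speed of the reducible mass. -/
lemma exists_tendsto_sinkPower (hC : IsRelativeInteraction C) {x : Fin n → ℝ}
    (hx : x ∈ stdSimplex ℝ (Fin n)) (h1 : ∀ i, x i ≠ 1) :
    ∃ ζ ∈ stdSimplex ℝ (Sink C),
      (∀ k, Filter.Tendsto (fun t : ℕ => sinkPower C ((dfMap C)^[t] x) k) Filter.atTop
        (𝓝 (ζ k))) ∧
      ∀ t k, sinkPower C ((dfMap C)^[t] x) k ≤ ζ k ∧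
        ζ k - sinkPower C ((dfMap C)^[t] x) k ≤ reducibleMass C ((dfMap C)^[t] x) := by
  have hmem := iterate_mem_stdSimplex hC hx
  have hmono := sinkPower_iterate_monotone hC hx
  have hbdd : ∀ k : Sink C, BddAbove (Set.range fun t : ℕ => sinkPower C ((dfMap C)^[t] x) k) :=
    fun k => ⟨1, by rintro _ ⟨t, rfl⟩; exact sinkPower_le_one (hmem t) k⟩
  set ζ : Sink C → ℝ := fun k => ⨆ t : ℕ, sinkPower C ((dfMap C)^[t] x) k with hζ
  have hlim : ∀ k, Filter.Tendsto (fun t : ℕ => sinkPower C ((dfMap C)^[t] x) k) Filter.atTop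
      (𝓝 (ζ k)) := fun k => tendsto_atTop_ciSup (hmono k) (hbdd k)
  have hle : ∀ t k, sinkPower C ((dfMap C)^[t] x) k ≤ ζ k := fun t k => le_ciSup (hbdd k) t
  have htot : ∀ t, ∑ k, sinkPower C ((dfMap C)^[t] x) k = 1 - reducibleMass C ((dfMap C)^[t] x) :=
    fun t => by
      have := sum_eq_sum_sinkPower_add C ((dfMap C)^[t] x)
      rw [(hmem t).2] at this
      linarith
  have hsum : ∑ k, ζ k = 1 := by
    have h2 : Filter.Tendsto (fun t : ℕ => ∑ k, sinkPower C ((dfMap C)^[t] x) k) Filter.atTop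
        (𝓝 (∑ k, ζ k)) := tendsto_finsetSum _ fun k _ => hlim k
    refine tendsto_nhds_unique h2 ?_
    simp only [htot]
    simpa using (tendsto_reducibleMass hC hx h1).const_sub 1
  refine ⟨ζ, ⟨fun k => (sinkPower_nonneg hx.1 k).trans (hle 0 k), hsum⟩, hlim, fun t k =>
    ⟨hle t k, ?_⟩⟩
  -- What the sinks have still to gain is exactly what the reducible nodes still hold, and each
  -- deficit is nonnegative.
  have h3 : ∑ k, (ζ k - sinkPower C ((dfMap C)^[t] x) k) =
      reducibleMass C ((dfMap C)^[t] x) := by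
    rw [Finset.sum_sub_distrib, hsum, htot]; ring
  rw [← h3]
  exact Finset.single_le_sum (f := fun k => ζ k - sinkPower C ((dfMap C)^[t] x) k)
    (fun k _ => sub_nonneg.2 (hle t k)) (Finset.mem_univ k)

/-- Weights witnessing that a vertex which is not a star center is repelling. -/
lemma exists_repelling_weights (hC : IsRelativeInteraction C) {k : Sink C} {i : Fin n}
    (hi : i ∈ sinkNodes C k) (hns : ¬ IsStarCenter C k i) :
    ∃ w : Fin n → ℝ, ∃ η : ℝ, 0 < η ∧ (∀ j ∈ (sinkNodes C k).erase i, 0 < w j) ∧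
      (∀ j ∉ (sinkNodes C k).erase i, w j = 0) ∧
      ∀ l ∈ (sinkNodes C k).erase i, (1 + η) * w l ≤ ∑ j, (C i j + C l j) * w j := by
  classical
  obtain ⟨l₀, hl₀, hl₀i, hlt⟩ := exists_lt_one_of_not_isStarCenter hC hi hns
  set S := (sinkNodes C k).erase i with hS
  have hl₀S : l₀ ∈ S := Finset.mem_erase.2 ⟨hl₀i, hl₀⟩
  -- Near the vertex at `i`, the center emits about `1 - x i`, at least the total mass on `S`. Each
  -- unit at `l ∈ S` is thus passed on along row `l` and also, through the center, along row `i`.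
  set N : Fin n → Fin n → ℝ := fun l j => if l ∈ S ∧ j ∈ S then C i j + C l j else 0 with hN
  have hNnn : ∀ l j, 0 ≤ N l j := fun l j => by
    simp only [hN]
    split_ifs
    · exact add_nonneg (hC.nonneg _ _) (hC.nonneg _ _)
    · exact le_rfl
  obtain ⟨h, h0, h1, hT, hp, hs⟩ := exists_hitting_weights N hNnn {l₀}
  -- Every node of `S` inherits the out-edges of `i` in this kernel, so a walk from `i` can be
  -- followed from any `l ∈ S`, with returns to `i` cut out.
  have hpath : ∀ b, Reaches C i b → b ≠ i → ∀ l ∈ S,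
      Relation.ReflTransGen (fun a b => 0 < N a b) l b := by
    intro b hb
    induction hb with
    | refl => exact fun h => (h rfl).elim
    | @tail a b hia hab ih =>
      intro hbi l hl
      have haS : a ∈ sinkNodes C k := sink_closed_reaches hi hia
      have hbS : b ∈ S := Finset.mem_erase.2 ⟨hbi, sink_closed haS hab⟩
      by_cases hai : a = i
      · refine Relation.ReflTransGen.single ?_
        simp only [hN, if_pos (And.intro hl hbS)]
        rw [hai] at hab
        exact add_pos_of_pos_of_nonneg hab (hC.nonneg _ _)
      · refine (ih hai l hl).tail ?_
        have haS' : a ∈ S := Finset.mem_erase.2 ⟨hai, haS⟩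
        simp only [hN, if_pos (And.intro haS' hbS)]
        exact add_pos_of_nonneg_of_pos (hC.nonneg _ _) hab
  have hpos : ∀ l ∈ S, 0 < h l := fun l hl =>
    hp l ⟨l₀, rfl, hpath l₀ (sink_reaches hi hl₀) hl₀i l hl⟩
  obtain ⟨lm, hlm, hmin⟩ := Finset.exists_min_image S h ⟨l₀, hl₀S⟩
  -- The kernel's row sums on `S` are `2 - C l i ≥ 1`, with excess `2 * s` at `l₀`. The weight `1 +
  -- s * h` spreads this excess to all of `S`.
  set s := (1 - C l₀ i) / 2 with hsdef
  have hs0 : 0 < s := by rw [hsdef]; linarith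
  have hs1 : s ≤ 1 := by rw [hsdef]; linarith [hC.nonneg l₀ i]
  set w : Fin n → ℝ := fun j => if j ∈ S then 1 + s * h j else 0 with hw
  have hwS : ∀ j ∈ S, w j = 1 + s * h j := fun j hj => by simp only [hw, if_pos hj]
  refine ⟨w, s * h lm / 2, by have := hpos lm hlm; positivity, fun j hj => ?_, fun j hj => ?_,
    fun l hl => ?_⟩
  · rw [hwS j hj]
    have := mul_nonneg hs0.le (h0 j)
    linarith
  · simp only [hw, if_neg hj]
  · have hlS := (Finset.mem_erase.1 hl)
    have hrow : ∀ a ∈ sinkNodes C k, ∑ j ∈ S, C a j = 1 - C a i := fun a ha => by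
      have := Finset.add_sum_erase _ (fun j => C a j) hi
      rw [hC.sum_sink ha] at this
      linarith
    have hNh : ∑ j, N l j * h j = ∑ j ∈ S, (C i j + C l j) * h j := by
      rw [← Finset.sum_subset (Finset.subset_univ S)]
      · exact Finset.sum_congr rfl fun j hj => by simp only [hN, if_pos (And.intro hl hj)]
      · intro j _ hj
        simp only [hN, hj, and_false, if_false, zero_mul]
    have hsum : ∑ j, (C i j + C l j) * w j = 1 + (1 - C l i) + s * ∑ j, N l j * h j := by
      rw [hNh, ← Finset.sum_subset (Finset.subset_univ S)]
      · have : ∀ j ∈ S, (C i j + C l j) * w j =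
            C i j + C l j + s * ((C i j + C l j) * h j) := fun j hj => by rw [hwS j hj]; ring
        rw [Finset.sum_congr rfl this, Finset.sum_add_distrib, Finset.sum_add_distrib,
          hrow i hi, hrow l hlS.2, ← Finset.mul_sum, hC.2 i]
        ring
      · intro j _ hj
        simp only [hw, if_neg hj, mul_zero]
    rw [hsum, hwS l hl]
    have hhl := hmin l hl
    have hkey : 1 + s * h l + s * h l ≤ 1 + (1 - C l i) + s * ∑ j, N l j * h j := by
      have hnn : 0 ≤ ∑ j, N l j * h j :=
        Finset.sum_nonneg fun j _ => mul_nonneg (hNnn l j) (h0 j)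
      have hsh := mul_le_of_le_one_right hs0.le (h1 l)
      by_cases hll : l = l₀
      · have : 0 ≤ s * ∑ j, N l j * h j := mul_nonneg hs0.le hnn
        have : 2 * s = 1 - C l i := by rw [hll, hsdef]; ring
        linarith
      · have := mul_le_mul_of_nonneg_left (hs l (by simpa using hll)) hs0.le
        linarith [hC.le_one l i]
    have h3 : s * h lm / 2 * (1 + s * h l) ≤ s * h l := by
      have ha : 1 + s * h l ≤ 2 := by nlinarith [h0 l, h1 l]
      have hb : s * h lm ≤ s * h l := mul_le_mul_of_nonneg_left hhl hs0.le
      have hc : 0 ≤ s * h lm / 2 := by have := h0 lm; positivity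
      nlinarith [mul_le_mul_of_nonneg_left ha hc]
    linarith

/-- A trajectory that does not start at a vertex cannot converge to a vertex which lies in a sink
and is not a star center of it. -/
lemma not_tendsto_single (hC : IsRelativeInteraction C) {x : Fin n → ℝ}
    (hx : x ∈ stdSimplex ℝ (Fin n)) (h1 : ∀ i, x i ≠ 1) {k : Sink C} {i : Fin n}
    (hi : i ∈ sinkNodes C k) (hns : ¬ IsStarCenter C k i) :
    ¬ Filter.Tendsto (fun t : ℕ => (dfMap C)^[t] x) Filter.atTop
      (𝓝 (Pi.single i 1 : Fin n → ℝ)) := by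
  classical
  intro hlim
  obtain ⟨w, η, hη, hwpos, hw0, hw⟩ := exists_repelling_weights hC hi hns
  have hmem := iterate_mem_stdSimplex hC hx
  set X : ℕ → Fin n → ℝ := fun t => (dfMap C)^[t] x with hX
  have hsucc : ∀ t, X (t + 1) = dfMap C (X t) := fun t => Function.iterate_succ_apply' _ _ _
  set S := (sinkNodes C k).erase i with hS
  have hwnn : ∀ j, 0 ≤ w j := fun j => by
    by_cases hj : j ∈ S
    · exact (hwpos j hj).le
    · rw [hw0 j hj]
  set ε := η / (1 + η) with hε
  have hε0 : 0 < ε := by positivity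
  have hε1 : (1 - ε) * (1 + η) = 1 := by rw [hε]; field_simp; ring
  have hε2 : 0 < 1 - ε := by
    by_contra! h
    nlinarith
  have hcoord : ∀ j, Filter.Tendsto (fun t => X t j) Filter.atTop
      (𝓝 ((Pi.single i 1 : Fin n → ℝ) j)) := fun j => (tendsto_pi_nhds.1 hlim) j
  obtain ⟨T, hT⟩ : ∃ T, ∀ t ≥ T, 1 - ε < X t i := by
    have := hcoord i
    rw [Pi.single_eq_same] at this
    exact Filter.eventually_atTop.1 (this.eventually (lt_mem_nhds (by linarith)))
  have hstep : ∀ t ≥ T, ∑ j, X t j * w j ≤ ∑ j, X (t + 1) j * w j := by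
    intro t ht
    rw [hsucc, dfMap_sum_mul]
    have hy := stdSimplex_logistic_nonneg (hmem t)
    have hCw : ∀ l, 0 ≤ ∑ j, C l j * w j := fun l =>
      Finset.sum_nonneg fun j _ => mul_nonneg (hC.nonneg l j) (hwnn j)
    have ha : ∑ j, X t j * w j = ∑ l ∈ S, X t l * w l :=
      (Finset.sum_subset (Finset.subset_univ S) fun j _ hj => by rw [hw0 j hj, mul_zero]).symm
    have hXi := hT t ht
    have hins : X t i + ∑ l ∈ S, X t l ≤ 1 := by
      rw [Finset.add_sum_erase _ (X t) hi]
      exact sinkPower_le_one (hmem t) k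
    have hSnn : 0 ≤ ∑ l ∈ S, X t l := Finset.sum_nonneg fun l _ => (hmem t).1 l
    have hyi : (1 - ε) * ∑ l ∈ S, X t l ≤ X t i - X t i ^ 2 := by nlinarith
    have hyl : ∀ l ∈ S, (1 - ε) * X t l ≤ X t l - X t l ^ 2 := fun l hl => by
      have := stdSimplex_add_le_one (hmem t) (Finset.ne_of_mem_erase hl)
      nlinarith [(hmem t).1 l]
    have hb : (X t i - X t i ^ 2) * ∑ j, C i j * w j +
        ∑ l ∈ S, (X t l - X t l ^ 2) * ∑ j, C l j * w j ≤
        ∑ l, (X t l - X t l ^ 2) * ∑ j, C l j * w j := by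
      rw [Finset.add_sum_erase _ (fun l => (X t l - X t l ^ 2) * ∑ j, C l j * w j) hi]
      exact Finset.sum_le_sum_of_subset_of_nonneg (Finset.subset_univ _)
        fun l _ _ => mul_nonneg (hy l) (hCw l)
    have hc : ∑ l ∈ S, X t l * w l ≤ (X t i - X t i ^ 2) * ∑ j, C i j * w j +
        ∑ l ∈ S, (X t l - X t l ^ 2) * ∑ j, C l j * w j := by
      calc ∑ l ∈ S, X t l * w l
          ≤ ∑ l ∈ S, (1 - ε) * X t l * ∑ j, (C i j + C l j) * w j := by
            refine Finset.sum_le_sum fun l hl => ?_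
            have := mul_le_mul_of_nonneg_left (hw l hl) (mul_nonneg hε2.le ((hmem t).1 l))
            calc X t l * w l = (1 - ε) * X t l * ((1 + η) * w l) := by
                  linear_combination (-(X t l * w l)) * hε1
              _ ≤ _ := this
        _ = (1 - ε) * (∑ l ∈ S, X t l) * ∑ j, C i j * w j +
            ∑ l ∈ S, (1 - ε) * X t l * ∑ j, C l j * w j := by
            rw [Finset.mul_sum S, Finset.sum_mul S, ← Finset.sum_add_distrib]
            refine Finset.sum_congr rfl fun l _ => ?_
            rw [← mul_add, ← Finset.sum_add_distrib]
            simp only [add_mul]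
        _ ≤ _ := add_le_add (mul_le_mul_of_nonneg_right hyi (hCw i))
            (Finset.sum_le_sum fun l hl => mul_le_mul_of_nonneg_right (hyl l hl) (hCw l))
    have hd : 0 ≤ ∑ j, X t j ^ 2 * w j :=
      Finset.sum_nonneg fun j _ => mul_nonneg (sq_nonneg _) (hwnn j)
    linarith
  have hL0 : Filter.Tendsto (fun t => ∑ j, X t j * w j) Filter.atTop (𝓝 0) := by
    have h2 : Filter.Tendsto (fun t => ∑ j, X t j * w j) Filter.atTop
        (𝓝 (∑ j, (Pi.single i 1 : Fin n → ℝ) j * w j)) :=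
      tendsto_finsetSum _ fun j _ => (hcoord j).mul_const _
    rwa [Finset.sum_eq_zero] at h2
    intro j _
    by_cases hj : j = i
    · rw [hj, hw0 i (by simp [hS]), mul_zero]
    · rw [Pi.single_eq_of_ne hj, zero_mul]
  -- From `T` on the functional is nondecreasing with limit 0. But it becomes positive later, since
  -- `i` feeds another node of its sink.
  have hLle : ∀ t ≥ T, ∑ j, X t j * w j ≤ 0 := by
    intro t ht
    refine ge_of_tendsto hL0 (Filter.eventually_atTop.2 ⟨t, fun s hs => ?_⟩)
    induction s, hs using Nat.le_induction with
    | base => exact le_rfl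
    | succ s hts ih => exact ih.trans (hstep s (ht.trans hts))
  obtain ⟨j, hj, hji, hij⟩ := hC.exists_pos_sink hi
  obtain ⟨T', hT'⟩ := iterate_pos hC (hmem T) (iterate_ne_one hC hx h1 T)
    (Relation.ReflTransGen.single hij : Reaches C i j) (hε2.trans (hT T le_rfl))
  have hXj : 0 < X (T' + T) j := by
    have := hT' T' le_rfl
    rwa [← Function.iterate_add_apply] at this
  have hjS : j ∈ S := Finset.mem_erase.2 ⟨hji, hj⟩
  have : 0 < ∑ j, X (T' + T) j * w j :=
    Finset.sum_pos' (fun a _ => mul_nonneg ((hmem _).1 a) (hwnn a))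
      ⟨j, Finset.mem_univ j, mul_pos hXj (hwpos j hjS)⟩
  linarith [hLle (T' + T) (by omega)]

/-- Convergence when no two-node sink takes all the power. -/
lemma exists_tendsto_of_pair_lt_one (hC : IsRelativeInteraction C) {x : Fin n → ℝ}
    (hx : x ∈ stdSimplex ℝ (Fin n)) (h1 : ∀ i, x i ≠ 1) {ζ : Sink C → ℝ}
    (hζ : ∀ k, Filter.Tendsto (fun t : ℕ => sinkPower C ((dfMap C)^[t] x) k) Filter.atTop
        (𝓝 (ζ k)))
    (h2 : ∀ k, (sinkNodes C k).card = 2 → ζ k < 1) :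
    ∃ p, IsSplitEquilibrium C ζ p ∧
      Filter.Tendsto (fun t : ℕ => (dfMap C)^[t] x) Filter.atTop (𝓝 p) := by
  have hmem := iterate_mem_stdSimplex hC hx
  set X : ℕ → Fin n → ℝ := fun t => (dfMap C)^[t] x with hX
  have hsucc : ∀ t, X (t + 1) = dfMap C (X t) := fun t => Function.iterate_succ_apply' _ _ _
  have hpow : ∀ (φ : ℕ → ℕ) p, StrictMono φ → Filter.Tendsto (X ∘ φ) Filter.atTop (𝓝 p) →
      sinkPower C p = ζ := fun φ p hφ hp => funext fun k =>
    tendsto_nhds_unique (((continuous_sinkPower k).tendsto p).comp hp)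
      ((hζ k).comp hφ.tendsto_atTop)
  -- All possible subsequential limits; finiteness makes each of them isolated.
  set Q : Set (Fin n → ℝ) := Set.range (fun i : Fin n => (Pi.single i 1 : Fin n → ℝ)) ∪
    {p | IsSplitEquilibrium C ζ p} with hQ
  have hQfin : Q.Finite := (Set.finite_range _).union
    (Set.Subsingleton.finite fun p hp q hq => hp.unique hC h2 hq)
  have hsub : ∀ (φ : ℕ → ℕ) p, StrictMono φ → Filter.Tendsto (X ∘ φ) Filter.atTop (𝓝 p) →
      p ∈ Q := by
    intro φ p hφ hp
    obtain ⟨hpm, hpR, hpf⟩ := fixed_of_tendsto_subseq hC hx h1 hφ hp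
    by_cases hv : ∃ i, p i = 1
    · obtain ⟨i, hi⟩ := hv
      exact Or.inl ⟨i, (stdSimplex_eq_single hpm hi).symm⟩
    · push Not at hv
      refine Or.inr ?_
      have := (isSplitEquilibrium_of_fixed_of_ne_one hC hpm hpf hv).2
      rwa [hpow φ p hφ hp] at this
  obtain ⟨p, -, φ, hφ, hp⟩ := (isCompact_stdSimplex ℝ (Fin n)).tendsto_subseq hmem
  obtain ⟨hpm, hpR, hpf⟩ := fixed_of_tendsto_subseq hC hx h1 hφ hp
  have hlim : Filter.Tendsto X Filter.atTop (𝓝 p) := by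
    have hopen : (Q \ {p})ᶜ ∈ 𝓝 p :=
      (hQfin.subset Set.sdiff_subset).isClosed.isOpen_compl.mem_nhds (by simp)
    obtain ⟨R, hR, hball⟩ := Metric.nhds_basis_closedBall.mem_iff.1 hopen
    refine tendsto_of_isolated_subseq_limit continuous_dfMap hsucc hpf hφ hp hR ?_
    intro ψ q hψ hq hd
    by_contra hne
    exact hball (Metric.mem_closedBall.2 hd) ⟨hsub ψ q hψ hq, hne⟩
  refine ⟨p, ?_, hlim⟩
  rw [← hpow φ p hφ hp]
  refine isSplitEquilibrium_of_fixed hC hpm hpf hpR fun k i hi hi1 _ => ?_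
  by_contra hns
  rw [stdSimplex_eq_single hpm hi1] at hlim
  exact not_tendsto_single hC hx h1 hi hns hlim

/-- Exponential convergence when a two-node sink takes all the power. -/
lemma exists_tendsto_of_pair_eq_one (hC : IsRelativeInteraction C) {x : Fin n → ℝ}
    (hx : x ∈ stdSimplex ℝ (Fin n)) (h1 : ∀ i, x i ≠ 1) {ζ : Sink C → ℝ}
    (hζ : ∀ k, Filter.Tendsto (fun t : ℕ => sinkPower C ((dfMap C)^[t] x) k) Filter.atTop
        (𝓝 (ζ k)))
    (hζm : ∀ t k, ζ k - sinkPower C ((dfMap C)^[t] x) k ≤ reducibleMass C ((dfMap C)^[t] x))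
    {k : Sink C} (hk2 : (sinkNodes C k).card = 2) (hk1 : ζ k = 1) :
    ∃ p, IsSplitEquilibrium C ζ p ∧
      Filter.Tendsto (fun t : ℕ => (dfMap C)^[t] x) Filter.atTop (𝓝 p) ∧
      ∃ A : ℝ, ∃ r ∈ Set.Ioo (0 : ℝ) 1, ∀ t : ℕ, ‖(dfMap C)^[t] x - p‖ ≤ A * r ^ t := by
  obtain ⟨A, r, hA, hr0, hr1, hm⟩ := exists_reducibleMass_le hC hx h1
  have hmem := iterate_mem_stdSimplex hC hx
  have hmono := sinkPower_iterate_monotone hC hx k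
  set X : ℕ → Fin n → ℝ := fun t => (dfMap C)^[t] x with hX
  have hsucc : ∀ t, X (t + 1) = dfMap C (X t) := fun t => Function.iterate_succ_apply' _ _ _
  have hout : ∀ {z : Fin n → ℝ}, z ∈ stdSimplex ℝ (Fin n) →
      ∑ l ∈ (sinkNodes C k)ᶜ, z l = 1 - sinkPower C z k := fun {z} hz => by
    have := Finset.sum_add_sum_compl (sinkNodes C k) z
    rw [hz.2] at this
    unfold sinkPower
    linarith
  have houtle : ∀ {z : Fin n → ℝ}, z ∈ stdSimplex ℝ (Fin n) → ∀ l ∉ sinkNodes C k,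
      z l ≤ 1 - sinkPower C z k := fun {z} hz l hl => by
    rw [← hout hz]
    exact Finset.single_le_sum (f := z) (fun j _ => hz.1 j) (Finset.mem_compl.2 hl)
  have hin : ∀ {z : Fin n → ℝ}, z ∈ stdSimplex ℝ (Fin n) → ∀ i j, i ≠ j →
      sinkNodes C k = {i, j} → |dfMap C z i - z i| ≤ 2 * (1 - sinkPower C z k) := by
    intro z hz i j hij hk
    have hsp : sinkPower C z k = z i + z j := by rw [sinkPower, hk, Finset.sum_pair hij]
    have hE0 : 0 ≤ ∑ l ∈ (sinkNodes C k)ᶜ, C l i * (z l - z l ^ 2) :=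
      Finset.sum_nonneg fun l _ => mul_nonneg (hC.nonneg l i) (stdSimplex_logistic_nonneg hz l)
    have hE1 : ∑ l ∈ (sinkNodes C k)ᶜ, C l i * (z l - z l ^ 2) ≤ 1 - sinkPower C z k := by
      rw [← hout hz]
      refine Finset.sum_le_sum fun l _ => ?_
      have := mul_le_of_le_one_left (stdSimplex_logistic_nonneg hz l) (hC.le_one l i)
      nlinarith [sq_nonneg (z l)]
    -- The exchange inside the pair is proportional to the power outside the pair, and so is the
    -- bound on the inflow.
    have hF : dfMap C z i - z i = (z j - z i) * (1 - sinkPower C z k) +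
        ∑ l ∈ (sinkNodes C k)ᶜ, C l i * (z l - z l ^ 2) := by
      rw [dfMap_apply, ← Finset.sum_add_sum_compl (sinkNodes C k), hsp]
      rw [show ∑ l ∈ sinkNodes C k, C l i * (z l - z l ^ 2) = z j - z j ^ 2 by
        rw [hk, Finset.sum_pair hij, hC.2 i,
          card_eq_two_pair hC hij.symm (hk.trans (Finset.pair_comm i j))]
        ring]
      ring
    have h0 := hz.1 i
    have h0' := hz.1 j
    have h1' := sinkPower_le_one hz k
    rw [hF, abs_le]
    constructor <;> nlinarith [stdSimplex_le_one hz i, stdSimplex_le_one hz j]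
  have hstep : ∀ t, dist (X t) (X (t + 1)) ≤ 2 * A * r ^ t := by
    intro t
    have hD : 1 - sinkPower C (X t) k ≤ A * r ^ t := by
      rw [← hk1]; exact (hζm t k).trans (hm t)
    have hnn : 0 ≤ A * r ^ t := by positivity
    rw [dist_pi_le_iff (by positivity)]
    intro l
    rw [dist_comm, Real.dist_eq]
    by_cases hl : l ∈ sinkNodes C k
    · obtain ⟨a, b, hab, hk⟩ := Finset.card_eq_two.1 hk2
      rw [hsucc]
      have hl' := hl
      rw [hk] at hl'
      rcases Finset.mem_insert.1 hl' with h | h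
      · rw [h]; linarith [hin (hmem t) a b hab hk]
      · rw [Finset.mem_singleton.1 h]
        linarith [hin (hmem t) b a hab.symm (hk.trans (Finset.pair_comm a b))]
    · have h3 := houtle (hmem t) l hl
      have h4 := houtle (hmem (t + 1)) l hl
      have h5 : sinkPower C (X t) k ≤ sinkPower C (X (t + 1)) k := hmono (Nat.le_succ t)
      have h6 := (hmem t).1 l
      have h7 := (hmem (t + 1)).1 l
      change X t l ≤ 1 - sinkPower C (X t) k at h3
      change X (t + 1) l ≤ 1 - sinkPower C (X (t + 1)) k at h4
      change 0 ≤ X t l at h6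
      change 0 ≤ X (t + 1) l at h7
      rw [abs_le]
      constructor <;> linarith
  obtain ⟨p, hp⟩ := cauchySeq_tendsto_of_complete (cauchySeq_of_le_geometric r (2 * A) hr1 hstep)
  obtain ⟨hpm, hpR, hpf⟩ := fixed_of_tendsto_subseq hC hx h1 strictMono_id hp
  have hpow : sinkPower C p = ζ := funext fun k =>
    tendsto_nhds_unique (((continuous_sinkPower k).tendsto p).comp hp) (hζ k)
  refine ⟨p, ?_, hp, 2 * A / (1 - r), r, ⟨hr0, hr1⟩, fun t => ?_⟩
  · rw [← hpow]
    refine isSplitEquilibrium_of_fixed hC hpm hpf hpR fun l i hi hi1 hl => ?_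
    exfalso
    have hik : i ∈ sinkNodes C k := by
      by_contra hik
      rw [eq_zero_of_sinkPower_eq_one hpm (by rw [hpow, hk1]) hik] at hi1
      exact zero_ne_one hi1
    rw [sink_eq hi hik] at hl
    omega
  · have := dist_le_of_le_geometric_of_tendsto r (2 * A) hr1 hstep hp t
    rw [dist_eq_norm] at this
    calc ‖X t - p‖ ≤ 2 * A * r ^ t / (1 - r) := this
      _ = _ := by ring

end Limits

/-! ### Geometric decay from quadratic forms -/

section ExponentialDecay

lemma exists_geometric_bound_of_le {f : ℕ → ℝ} {T : ℕ} {A r : ℝ} (hr : 0 < r)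
    (h : ∀ t ≥ T, f t ≤ A * r ^ t) : ∃ B, ∀ t, f t ≤ B * r ^ t := by
  refine ⟨max A 0 + ∑ s ∈ Finset.range T, |f s| / r ^ s, fun t => ?_⟩
  have hnn : 0 ≤ ∑ s ∈ Finset.range T, |f s| / r ^ s :=
    Finset.sum_nonneg fun s _ => by positivity
  have hrt : 0 < r ^ t := by positivity
  rcases le_or_gt T t with ht | ht
  · exact (h t ht).trans (mul_le_mul_of_nonneg_right (by linarith [le_max_left A 0]) hrt.le)
  · have h1 := Finset.single_le_sum (f := fun s => |f s| / r ^ s)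
      (fun s _ => by positivity) (Finset.mem_range.2 ht)
    calc f t ≤ |f t| := le_abs_self _
      _ = |f t| / r ^ t * r ^ t := by field_simp
      _ ≤ _ := mul_le_mul_of_nonneg_right (by linarith [le_max_right A 0]) hrt.le

/-- A perturbed Lyapunov inequality forces geometric decay. -/
lemma exists_geometric_bound_of_lyapunov {W b : ℕ → ℝ} {κ M A r : ℝ} (hκ : 0 < κ) (hA : 0 ≤ A)
    (hr0 : 0 < r) (hr1 : r < 1) (hb : ∀ t, 0 ≤ b t) (hW : Filter.Tendsto W Filter.atTop (𝓝 0))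
    (hstep : ∀ t, W (t + 1) ≤ W t - κ * b t + A * r ^ t) (hM : ∀ t, W t ≤ M * b t) :
    ∃ B ρ : ℝ, 0 < ρ ∧ ρ < 1 ∧ ∀ t, b t ≤ B * ρ ^ t := by
  -- The second argument keeps `θ` at least 1/2, so the induction hypothesis may be multiplied by
  -- it.
  set M' := max M (2 * κ) with hM'
  have hM'0 : 0 < M' := lt_max_of_lt_right (by linarith)
  set θ := 1 - κ / M' with hθ
  have hκM : κ / M' ≤ 1 / 2 := by
    rw [div_le_iff₀ hM'0]; linarith [le_max_right M (2 * κ)]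
  have hκM0 : 0 < κ / M' := by positivity
  set ρ := (1 + max r θ) / 2 with hρ
  have hmax : max r θ < 1 := max_lt hr1 (by rw [hθ]; linarith)
  have hρr : r < ρ := by rw [hρ]; linarith [le_max_left r θ]
  have hρθ : θ < ρ := by rw [hρ]; linarith [le_max_right r θ]
  have hρ0 : 0 < ρ := hr0.trans hρr
  have hρ1 : ρ < 1 := by rw [hρ]; linarith
  have hpow : ∀ t, r ^ t ≤ ρ ^ t := fun t => pow_le_pow_left₀ hr0.le hρr.le t
  set B := max (W 0) (A / (ρ - θ)) with hB
  have hBA : A ≤ B * (ρ - θ) := by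
    rw [← div_le_iff₀ (by linarith)]; exact le_max_right _ _
  have hWle : ∀ t, W t ≤ B * ρ ^ t := by
    intro t
    induction t with
    | zero => rw [pow_zero, mul_one]; exact le_max_left _ _
    | succ t ih =>
      have h1 : W t ≤ M' * b t :=
        (hM t).trans (mul_le_mul_of_nonneg_right (le_max_left _ _) (hb t))
      have h2 : κ / M' * W t ≤ κ * b t := by
        calc κ / M' * W t ≤ κ / M' * (M' * b t) := mul_le_mul_of_nonneg_left h1 hκM0.le
          _ = κ * b t := by field_simp
      have h3 : θ * W t ≤ θ * (B * ρ ^ t) :=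
        mul_le_mul_of_nonneg_left ih (by rw [hθ]; linarith)
      have h4 : A * r ^ t ≤ B * (ρ - θ) * ρ ^ t :=
        mul_le_mul hBA (hpow t) (by positivity) (hA.trans hBA)
      have h5 : θ * W t = W t - κ / M' * W t := by rw [hθ]; ring
      calc W (t + 1) ≤ W t - κ * b t + A * r ^ t := hstep t
        _ ≤ θ * (B * ρ ^ t) + B * (ρ - θ) * ρ ^ t := by linarith
        _ = B * ρ ^ (t + 1) := by rw [pow_succ]; ring
  set K := A / (1 - r) with hK
  have hK0 : 0 ≤ K := div_nonneg hA (by linarith)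
  have hKr : K * (1 - r) = A := div_mul_cancel₀ _ (by linarith)
  -- `W` may be negative, but with the error tail added it decreases to 0 and so is nonnegative.
  -- This bounds `W` from below and turns its drop into a bound on `b`.
  have hanti : Antitone fun t => W t + K * r ^ t := antitone_nat_of_succ_le fun t => by
    have h1 := hstep t
    have h2 : K * r ^ t - K * r ^ (t + 1) = A * r ^ t := by
      rw [pow_succ]; linear_combination r ^ t * hKr
    have h3 := mul_nonneg hκ.le (hb t)
    linarith
  have hlim : Filter.Tendsto (fun t => W t + K * r ^ t) Filter.atTop (𝓝 0) := by
    simpa using hW.add ((tendsto_pow_atTop_nhds_zero_of_lt_one hr0.le hr1).const_mul K)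
  have hge : ∀ t, 0 ≤ W t + K * r ^ t := fun t => hanti.le_of_tendsto hlim t
  refine ⟨(B + K + A) / κ, ρ, hρ0, hρ1, fun t => ?_⟩
  have h1 := hstep t
  have h2 := hge (t + 1)
  have h3 : K * r ^ (t + 1) ≤ K * ρ ^ t :=
    mul_le_mul_of_nonneg_left ((pow_le_pow_of_le_one hr0.le hr1.le (Nat.le_succ t)).trans (hpow t))
      hK0
  have h4 := mul_le_mul_of_nonneg_left (hpow t) hA
  have h5 := hWle t
  rw [div_mul_eq_mul_div, le_div_iff₀ hκ]
  linarith

/-- Minimum over the compact unit sphere of `U`, extended by homogeneity. -/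
lemma exists_pos_mul_sq_le {E : Type*} [NormedAddCommGroup E] [NormedSpace ℝ E]
    [FiniteDimensional ℝ E] (U : Submodule ℝ E) {G : E → ℝ} (hG : Continuous G)
    (hhom : ∀ (a : ℝ) v, G (a • v) = a ^ 2 * G v) (hpos : ∀ v ∈ U, v ≠ 0 → 0 < G v) :
    ∃ κ : ℝ, 0 < κ ∧ ∀ v ∈ U, κ * ‖v‖ ^ 2 ≤ G v := by
  have : ProperSpace E := FiniteDimensional.proper ℝ E
  have hK : IsCompact (Metric.sphere (0 : E) 1 ∩ U) :=
    (isCompact_sphere 0 1).inter_right U.closed_of_finiteDimensional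
  obtain ⟨κ, hκ, hle⟩ : ∃ κ : ℝ, 0 < κ ∧ ∀ v ∈ Metric.sphere (0 : E) 1 ∩ U, κ ≤ G v := by
    rcases (Metric.sphere (0 : E) 1 ∩ U).eq_empty_or_nonempty with he | hne
    · exact ⟨1, one_pos, by simp [he]⟩
    · obtain ⟨v, hv, hmin⟩ := hK.exists_isMinOn hne hG.continuousOn
      refine ⟨G v, hpos v hv.2 ?_, fun w hw => hmin hw⟩
      rintro rfl
      simpa using hv.1
  refine ⟨κ, hκ, fun v hv => ?_⟩
  by_cases h0 : v = 0
  · have := hhom 0 v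
    rw [h0] at this ⊢
    simp at this
    simp [this]
  · have hn : 0 < ‖v‖ := norm_pos_iff.2 h0
    have h1 := hle (‖v‖⁻¹ • v) ⟨by simp [norm_smul, hn.ne'], U.smul_mem _ hv⟩
    rw [hhom, inv_pow, inv_mul_eq_div, le_div_iff₀ (by positivity)] at h1
    exact h1

variable {n : ℕ}

/-- The diagonal bilinear form with coefficients `a`. -/
noncomputable def diagForm (a u v : Fin n → ℝ) : ℝ := ∑ i, a i * u i * v i

lemma diagForm_add (a u v : Fin n → ℝ) :
    diagForm a (u + v) (u + v) = diagForm a u u + 2 * diagForm a u v + diagForm a v v := by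
  simp only [diagForm, Finset.mul_sum, ← Finset.sum_add_distrib, Pi.add_apply]
  exact Finset.sum_congr rfl fun i _ => by ring

lemma abs_diagForm_le (a u v : Fin n → ℝ) :
    |diagForm a u v| ≤ (∑ i, |a i|) * (‖u‖ * ‖v‖) := by
  rw [Finset.sum_mul]
  refine (Finset.abs_sum_le_sum_abs _ _).trans (Finset.sum_le_sum fun i _ => ?_)
  rw [abs_mul, abs_mul, mul_assoc]
  have h1 := norm_le_pi_norm u i
  have h2 := norm_le_pi_norm v i
  rw [Real.norm_eq_abs] at h1 h2
  gcongr

/-- Exponential convergence to a fixed point from a quadratic form which decreases strictly along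
the linearization, up to exponentially small errors. -/
lemma exists_geometric_bound_of_linearization (J : (Fin n → ℝ) →ₗ[ℝ] (Fin n → ℝ))
    (U : Submodule ℝ (Fin n → ℝ)) (a : Fin n → ℝ)
    (hpos : ∀ v ∈ U, v ≠ 0 → diagForm a (J v) (J v) < diagForm a v v)
    {e s g : ℕ → Fin n → ℝ} {L A r : ℝ} (hL : 0 ≤ L) (hA : 0 ≤ A) (hr0 : 0 < r) (hr1 : r < 1)
    (he1 : ∀ t, ‖e t‖ ≤ 1) (he : Filter.Tendsto e Filter.atTop (𝓝 0))
    (hstep : ∀ t, e (t + 1) = J (e t) + g t) (hg : ∀ t, ‖g t‖ ≤ L * ‖e t‖ ^ 2)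
    (hU : ∀ t, e t - s t ∈ U) (hs : ∀ t, ‖s t‖ ≤ A * r ^ t) :
    ∃ B ρ : ℝ, 0 < ρ ∧ ρ < 1 ∧ ∀ t, ‖e t‖ ≤ B * ρ ^ t := by
  set q : (Fin n → ℝ) → ℝ := fun v => diagForm a v v with hq
  have hJc : Continuous J := J.continuous_of_finiteDimensional
  obtain ⟨κ, hκ, hκle⟩ := exists_pos_mul_sq_le U (G := fun v => q v - q (J v))
    (by
      have hqc : Continuous q := by simp only [hq, diagForm]; fun_prop
      exact hqc.sub (hqc.comp hJc))
    (fun b v => by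
      simp only [hq, diagForm, map_smul, Pi.smul_apply, smul_eq_mul, mul_sub, Finset.mul_sum]
      congr 1 <;> exact Finset.sum_congr rfl fun i _ => by ring)
    (fun v hv h0 => sub_pos.2 (hpos v hv h0))
  set Λ := ∑ i, |a i| with hΛ
  have hΛ0 : 0 ≤ Λ := Finset.sum_nonneg fun i _ => abs_nonneg _
  obtain ⟨K, hK0, hK⟩ : ∃ K : ℝ, 0 ≤ K ∧ ∀ v, ‖J v‖ ≤ K * ‖v‖ :=
    ⟨‖J.toContinuousLinearMap‖, norm_nonneg _, fun v => J.toContinuousLinearMap.le_opNorm v⟩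
  have hqdiff : ∀ u v, |q (u + v) - q u| ≤ Λ * (2 * ‖u‖ + ‖v‖) * ‖v‖ := by
    intro u v
    have h1 := abs_diagForm_le a u v
    have h2 := abs_diagForm_le a v v
    have h3 : q (u + v) - q u = 2 * diagForm a u v + diagForm a v v := by
      simp only [hq, diagForm_add]; ring
    rw [h3]
    calc |2 * diagForm a u v + diagForm a v v| ≤ 2 * |diagForm a u v| + |diagForm a v v| := by
          refine (abs_add_le _ _).trans_eq ?_
          rw [abs_mul, abs_two]
      _ ≤ 2 * (Λ * (‖u‖ * ‖v‖)) + Λ * (‖v‖ * ‖v‖) := by linarith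
      _ = _ := by ring
  have hrt1 : ∀ t, r ^ t ≤ 1 := fun t => pow_le_one₀ hr0.le hr1.le
  have hsA : ∀ t, ‖s t‖ ≤ A := fun t =>
    (hs t).trans (mul_le_of_le_one_right hA (hrt1 t))
  set M₁ := Λ * (2 * K * (1 + A) + K * A) * K + Λ * (2 * (1 + A) + A) + κ * (2 + A) with hM₁
  have hM₁0 : 0 ≤ M₁ := by positivity
  -- Strict decrease is available only on `U`, so it is applied to `e - s`; moving back to `e` costs
  -- a multiple of `‖s‖`, because all vectors are bounded.
  have hlin : ∀ t, q (J (e t)) ≤ q (e t) - κ * ‖e t‖ ^ 2 + M₁ * ‖s t‖ := by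
    intro t
    set p := e t - s t with hp
    have hes : e t = p + s t := by rw [hp, sub_add_cancel]
    have hpn : ‖p‖ ≤ 1 + A := (norm_sub_le _ _).trans (add_le_add (he1 t) (hsA t))
    have h1 : κ * ‖p‖ ^ 2 ≤ q p - q (J p) := hκle p (hU t)
    have h2 := (abs_le.1 (hqdiff (J p) (J (s t)))).2
    have h3 := (abs_le.1 (hqdiff p (s t))).1
    rw [← map_add, ← hes] at h2
    rw [← hes] at h3
    have h4 : Λ * (2 * ‖J p‖ + ‖J (s t)‖) * ‖J (s t)‖ ≤
        Λ * (2 * K * (1 + A) + K * A) * K * ‖s t‖ := by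
      have h5 : ‖J p‖ ≤ K * (1 + A) := (hK p).trans (mul_le_mul_of_nonneg_left hpn hK0)
      have h6 : ‖J (s t)‖ ≤ K * A := (hK _).trans (mul_le_mul_of_nonneg_left (hsA t) hK0)
      have h7 := hK (s t)
      calc Λ * (2 * ‖J p‖ + ‖J (s t)‖) * ‖J (s t)‖
          ≤ Λ * (2 * (K * (1 + A)) + K * A) * (K * ‖s t‖) := by gcongr
        _ = _ := by ring
    have h5 : Λ * (2 * ‖p‖ + ‖s t‖) * ‖s t‖ ≤ Λ * (2 * (1 + A) + A) * ‖s t‖ := by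
      have := hsA t
      gcongr
    have h6 : ‖e t‖ ^ 2 ≤ ‖p‖ ^ 2 + (2 + A) * ‖s t‖ := by
      have h7 : ‖e t‖ - ‖s t‖ ≤ ‖p‖ := by rw [hp]; exact norm_sub_norm_le _ _
      have h8 := norm_nonneg (s t)
      have h9 := norm_nonneg p
      rcases le_total 0 (‖e t‖ - ‖s t‖) with h | h
      · have := pow_le_pow_left₀ h h7 2
        nlinarith [he1 t, mul_nonneg hA h8]
      · nlinarith [he1 t, norm_nonneg (e t), mul_nonneg hA h8, sq_nonneg ‖p‖]
    have h7 := mul_le_mul_of_nonneg_left h6 hκ.le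
    rw [hM₁]
    nlinarith
  set M₂ := Λ * (2 * K + L) * L with hM₂
  have hM₂0 : 0 ≤ M₂ := by positivity
  have hnonlin : ∀ t, q (e (t + 1)) ≤ q (J (e t)) + M₂ * ‖e t‖ * ‖e t‖ ^ 2 := by
    intro t
    have h1 := (abs_le.1 (hqdiff (J (e t)) (g t))).2
    rw [← hstep] at h1
    have h2 : ‖g t‖ ≤ L * ‖e t‖ := (hg t).trans <| by
      have := mul_le_of_le_one_left (norm_nonneg (e t)) (he1 t)
      exact mul_le_mul_of_nonneg_left (by rw [sq]; exact this) hL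
    have h3 : Λ * (2 * ‖J (e t)‖ + ‖g t‖) * ‖g t‖ ≤
        Λ * (2 * (K * ‖e t‖) + L * ‖e t‖) * (L * ‖e t‖ ^ 2) := by
      have := hK (e t)
      have := hg t
      gcongr
    calc q (e (t + 1)) ≤ q (J (e t)) + Λ * (2 * (K * ‖e t‖) + L * ‖e t‖) * (L * ‖e t‖ ^ 2) := by
          linarith
      _ = _ := by rw [hM₂]; ring
  have hnorm : Filter.Tendsto (fun t => ‖e t‖) Filter.atTop (𝓝 0) := by
    simpa using he.norm
  -- From here on the cubic remainder consumes at most half of the quadratic gain.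
  obtain ⟨T, hT⟩ : ∃ T, ∀ t ≥ T, M₂ * ‖e t‖ < κ / 2 := by
    have h1 : Filter.Tendsto (fun t => M₂ * ‖e t‖) Filter.atTop (𝓝 0) := by
      simpa using hnorm.const_mul M₂
    exact Filter.eventually_atTop.1 (h1.eventually (gt_mem_nhds (by linarith)))
  have hq0 : Filter.Tendsto (fun t => q (e t)) Filter.atTop (𝓝 0) := by
    have hqc : Continuous q := by simp only [hq, diagForm]; fun_prop
    have h1 := (hqc.tendsto 0).comp he
    rwa [show q 0 = 0 by simp [hq, diagForm]] at h1
  obtain ⟨B, ρ, hρ0, hρ1, hB⟩ := exists_geometric_bound_of_lyapunov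
    (W := fun t => q (e (T + t))) (b := fun t => ‖e (T + t)‖ ^ 2) (κ := κ / 2) (M := Λ)
    (A := M₁ * A) (by linarith) (mul_nonneg hM₁0 hA) hr0 hr1 (fun t => sq_nonneg _)
    (hq0.comp (Filter.tendsto_atTop_mono (fun t => Nat.le_add_left t T) Filter.tendsto_id))
    (fun t => by
      have h1 := hlin (T + t)
      have h2 := hnonlin (T + t)
      have h3 := mul_le_mul_of_nonneg_right (hT (T + t) (by omega)).le (sq_nonneg ‖e (T + t)‖)
      have h4 : M₁ * ‖s (T + t)‖ ≤ M₁ * A * r ^ t := by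
        calc M₁ * ‖s (T + t)‖ ≤ M₁ * (A * r ^ (T + t)) := mul_le_mul_of_nonneg_left (hs _) hM₁0
          _ ≤ M₁ * (A * r ^ t) := by
            have := pow_le_pow_of_le_one hr0.le hr1.le (Nat.le_add_left t T)
            gcongr
          _ = _ := by ring
      rw [← add_assoc]
      linarith)
    (fun t => by
      have := (abs_le.1 (abs_diagForm_le a (e (T + t)) (e (T + t)))).2
      rw [sq]; exact this)
  have hB0 : 0 ≤ B := by
    have := (sq_nonneg ‖e (T + 0)‖).trans (hB 0)
    simpa using this
  have hsq1 : Real.sqrt ρ < 1 := by rw [Real.sqrt_lt' one_pos]; linarith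
  have hsq0 : 0 < Real.sqrt ρ := Real.sqrt_pos.2 hρ0
  have hev : ∀ t ≥ T, ‖e t‖ ≤ Real.sqrt B / Real.sqrt ρ ^ T * Real.sqrt ρ ^ t := by
    intro t ht
    obtain ⟨u, rfl⟩ := Nat.exists_eq_add_of_le ht
    have h1 : ‖e (T + u)‖ ≤ Real.sqrt B * Real.sqrt ρ ^ u := by
      refine abs_le_of_sq_le_sq' ?_ (by positivity) |>.2
      rw [mul_pow, Real.sq_sqrt hB0, ← pow_mul, mul_comm u 2, pow_mul, Real.sq_sqrt hρ0.le]
      exact hB u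
    refine h1.trans_eq ?_
    rw [pow_add]; field_simp
  obtain ⟨B', hB'⟩ := exists_geometric_bound_of_le hsq0 hev
  exact ⟨B', _, hsq0, hsq1, hB'⟩

end ExponentialDecay

/-! ### Infinitesimal uniqueness for the logistic system -/

section Nondegenerate

/-- Nondegeneracy of the logistic system: infinitesimally proportional variations of zero sum
vanish. -/
lemma eq_zero_of_logistic_variation {ι : Type*} [DecidableEq ι] {T : Finset ι} {x v : ι → ℝ}
    {μ : ℝ} (hx : ∀ i ∈ T, 0 < x i) (hle : ∑ i ∈ T, x i ≤ 1)
    (h2 : ∀ i ∈ T, ∀ j ∈ T, i ≠ j → x i + x j < 1)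
    (hv : ∀ i ∈ T, (1 - 2 * x i) * v i = μ * (x i - x i ^ 2)) (hsum : ∑ i ∈ T, v i = 0) :
    ∀ i ∈ T, v i = 0 := by
  have hx1 : ∀ i ∈ T, x i ≤ 1 := fun i hi =>
    (Finset.single_le_sum (f := x) (fun j hj => (hx j hj).le) hi).trans hle
  by_cases hsmall : ∀ i ∈ T, x i < 1 / 2
  · have hf : ∀ i ∈ T, v i = μ * ((x i - x i ^ 2) / (1 - 2 * x i)) := fun i hi => by
      have h0 : (1 - 2 * x i) ≠ 0 := by have := hsmall i hi; intro h; linarith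
      rw [← mul_div_assoc, ← hv i hi, mul_div_cancel_left₀ _ h0]
    rcases T.eq_empty_or_nonempty with he | hne
    · simp [he]
    have hpos : 0 < ∑ i ∈ T, (x i - x i ^ 2) / (1 - 2 * x i) :=
      Finset.sum_pos (fun i hi => by
        have h3 := hsmall i hi
        have h4 := hx i hi
        exact div_pos (by nlinarith) (by linarith)) hne
    rw [Finset.sum_congr rfl hf, ← Finset.mul_sum] at hsum
    rcases mul_eq_zero.1 hsum with h | h
    · intro i hi
      rw [hf i hi, h, zero_mul]
    · exact absurd h hpos.ne'
  push Not at hsmall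
  obtain ⟨i, hi, hbig⟩ := hsmall
  have hothers : ∀ j ∈ T.erase i, x j < 1 - x i := fun j hj => by
    have := h2 i hi j (Finset.mem_of_mem_erase hj) (Finset.ne_of_mem_erase hj).symm
    linarith
  have hsv := Finset.add_sum_erase T v hi
  have hsx := Finset.add_sum_erase T x hi
  have hfin : (∀ j ∈ T.erase i, v j = 0) → ∀ j ∈ T, v j = 0 := by
    intro h j hj
    by_cases hji : j = i
    · rw [Finset.sum_eq_zero h] at hsv
      rw [hji]; linarith
    · exact h j (Finset.mem_erase.2 ⟨hji, hj⟩)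
  have hμ : μ = 0 → ∀ j ∈ T, v j = 0 := by
    intro h0
    refine hfin fun j hj => ?_
    have h3 := hv j (Finset.mem_of_mem_erase hj)
    rw [h0, zero_mul] at h3
    rcases mul_eq_zero.1 h3 with h | h
    · linarith [hothers j hj]
    · exact h
  rcases (T.erase i).eq_empty_or_nonempty with he | hne
  · exact hfin (by simp [he])
  have hxi1 : x i < 1 := by
    obtain ⟨j, hj⟩ := hne
    linarith [hothers j hj, hx j (Finset.mem_of_mem_erase hj)]
  have hyi : 0 < x i - x i ^ 2 := by nlinarith
  rcases hbig.eq_or_lt with hhalf | hhalf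
  · refine hμ ?_
    have h3 := hv i hi
    rw [← hhalf] at h3
    norm_num at h3
    exact h3
  refine hμ ?_
  have hd : 0 < 2 * x i - 1 := by linarith
  set P := x i / (2 * x i - 1) with hP
  have hPd : P * (2 * x i - 1) = x i := div_mul_cancel₀ _ hd.ne'
  have hP0 : 0 < P := by positivity
  have hvi : v i = -(μ * ((1 - x i) * P)) := by
    have h3 := hv i hi
    have h4 : (2 * x i - 1) * v i = (2 * x i - 1) * -(μ * ((1 - x i) * P)) := by
      linear_combination -h3 + μ * (1 - x i) * hPd
    exact mul_left_cancel₀ hd.ne' h4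
  have hvj : ∀ j ∈ T.erase i, v j = μ * ((x j - x j ^ 2) / (1 - 2 * x j)) := fun j hj => by
    have h0 : (1 - 2 * x j) ≠ 0 := by have := hothers j hj; intro h; linarith
    rw [← mul_div_assoc, ← hv j (Finset.mem_of_mem_erase hj), mul_div_cancel_left₀ _ h0]
  -- The function $(1-t)/(1-2t)$ increases on $[0,1/2)$ and equals `P` at `t = 1 - x i`, which
  -- exceeds every other entry. So the other variations cannot balance `v i` unless `μ = 0`.
  have hlt : ∑ j ∈ T.erase i, (x j - x j ^ 2) / (1 - 2 * x j) < (1 - x i) * P := by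
    calc ∑ j ∈ T.erase i, (x j - x j ^ 2) / (1 - 2 * x j) < ∑ j ∈ T.erase i, x j * P := by
          refine Finset.sum_lt_sum_of_nonempty hne fun j hj => ?_
          have h3 := hothers j hj
          have h4 := hx j (Finset.mem_of_mem_erase hj)
          rw [div_lt_iff₀ (by linarith), hP, mul_div_assoc', div_mul_eq_mul_div, lt_div_iff₀ hd]
          nlinarith [mul_pos h4 (sub_pos.2 h3)]
      _ = (∑ j ∈ T.erase i, x j) * P := by rw [Finset.sum_mul]
      _ ≤ (1 - x i) * P := mul_le_mul_of_nonneg_right (by linarith) hP0.le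
  rw [Finset.sum_congr rfl hvj, ← Finset.mul_sum, hvi, hsum] at hsv
  have h5 : μ * (∑ j ∈ T.erase i, (x j - x j ^ 2) / (1 - 2 * x j) - (1 - x i) * P) = 0 := by
    linear_combination hsv
  rcases mul_eq_zero.1 h5 with h | h
  · exact h
  · linarith

end Nondegenerate

/-! ### The derivative at an equilibrium and the exponential rate -/

section Linearization

variable {n : ℕ} {C : Matrix (Fin n) (Fin n) ℝ}

/-- The derivative of the DeGroot-Friedkin map at `x`. -/
noncomputable def dfDeriv (C : Matrix (Fin n) (Fin n) ℝ) (x : Fin n → ℝ) :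
    (Fin n → ℝ) →ₗ[ℝ] (Fin n → ℝ) where
  toFun v j := ∑ i, C i j * ((1 - 2 * x i) * v i) + 2 * x j * v j
  map_add' u v := by
    ext j
    simp only [Pi.add_apply, mul_add, Finset.sum_add_distrib]
    ring
  map_smul' b v := by
    ext j
    simp only [Pi.smul_apply, smul_eq_mul, RingHom.id_apply, mul_add, Finset.mul_sum]
    congr 1
    · exact Finset.sum_congr rfl fun i _ => by ring
    · ring

lemma dfDeriv_apply (x v : Fin n → ℝ) (j : Fin n) :
    dfDeriv C x v j = ∑ i, C i j * ((1 - 2 * x i) * v i) + 2 * x j * v j := rfl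

/-- The map is quadratic, so its second-order expansion is exact. -/
lemma dfMap_sub (x z : Fin n → ℝ) :
    dfMap C z - dfMap C x = dfDeriv C x (z - x) +
      fun j => (z j - x j) ^ 2 - ∑ i, C i j * (z i - x i) ^ 2 := by
  ext j
  simp only [Pi.sub_apply, Pi.add_apply, dfMap_apply, dfDeriv_apply]
  have : ∑ i, C i j * (z i - z i ^ 2) = ∑ i, C i j * (x i - x i ^ 2) +
      ∑ i, C i j * ((1 - 2 * x i) * (z i - x i)) - ∑ i, C i j * (z i - x i) ^ 2 := by
    rw [← Finset.sum_add_distrib, ← Finset.sum_sub_distrib]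
    exact Finset.sum_congr rfl fun i _ => by ring
  rw [this]; ring

lemma norm_dfMap_remainder_le (hC : IsRelativeInteraction C) (v : Fin n → ℝ) :
    ‖fun j => v j ^ 2 - ∑ i, C i j * v i ^ 2‖ ≤ ((n : ℝ) + 1) * ‖v‖ ^ 2 := by
  rw [pi_norm_le_iff_of_nonneg (by positivity)]
  intro j
  have hsq : ∀ i, v i ^ 2 ≤ ‖v‖ ^ 2 := fun i => by
    have := norm_le_pi_norm v i
    rw [Real.norm_eq_abs] at this
    rw [← sq_abs]
    exact pow_le_pow_left₀ (abs_nonneg _) this 2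
  have h1 : 0 ≤ ∑ i, C i j * v i ^ 2 :=
    Finset.sum_nonneg fun i _ => mul_nonneg (hC.nonneg i j) (sq_nonneg _)
  have h2 : ∑ i, C i j * v i ^ 2 ≤ n * ‖v‖ ^ 2 := by
    calc ∑ i, C i j * v i ^ 2 ≤ ∑ _i : Fin n, ‖v‖ ^ 2 :=
          Finset.sum_le_sum fun i _ =>
            (mul_le_of_le_one_left (sq_nonneg _) (hC.le_one i j)).trans (hsq i)
      _ = _ := by simp
  have h3 := hsq j
  have h4 := sq_nonneg (v j)
  have h5 : 0 ≤ (n : ℝ) * ‖v‖ ^ 2 := by positivity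
  rw [Real.norm_eq_abs, abs_le]
  constructor <;> nlinarith

/-- Variations supported on the support of `x` which preserve all sink powers. -/
def splitVariations (C : Matrix (Fin n) (Fin n) ℝ) (x : Fin n → ℝ) :
    Submodule ℝ (Fin n → ℝ) where
  carrier := {v | (∀ i, x i = 0 → v i = 0) ∧ ∀ k, sinkPower C v k = 0}
  add_mem' {u v} hu hv := ⟨fun i hi => by simp [hu.1 i hi, hv.1 i hi], fun k => by
    have h1 := hu.2 k
    have h2 := hv.2 k
    simp only [sinkPower, Pi.add_apply, Finset.sum_add_distrib] at h1 h2 ⊢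
    rw [h1, h2, add_zero]⟩
  zero_mem' := ⟨fun _ _ => rfl, fun k => by simp [sinkPower]⟩
  smul_mem' b v hv := ⟨fun i hi => by simp [hv.1 i hi], fun k => by
    have h1 := hv.2 k
    simp only [sinkPower, Pi.smul_apply, smul_eq_mul, ← Finset.mul_sum] at h1 ⊢
    rw [h1, mul_zero]⟩

/-- The form is the Hessian of the Lyapunov function. With $b=(1-2x)v$ and $d=C^\top b-b$, the
derivative sends $v$ to $v+d$, and the contraction by $C^\top$ yields a loss of at least $\sum
2x_id_i^2/c_i$. Without loss, $b$ is stationary, hence a multiple of $x-x^2$ on each sink with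
power, and `eq_zero_of_logistic_variation` gives $v=0$. -/
lemma diagForm_dfDeriv_lt (hC : IsRelativeInteraction C) {c : Fin n → ℝ} (hc0 : ∀ i, 0 ≤ c i)
    (hcp : ∀ i, 0 < c i ↔ ¬ IsReducibleNode C i) (hc : c ᵥ* C = c) {x : Fin n → ℝ}
    (hx : x ∈ stdSimplex ℝ (Fin n)) (hfix : dfMap C x = x)
    (hR : ∀ i, IsReducibleNode C i → x i = 0)
    (hsupp : ∀ k : Sink C, ∀ i ∈ sinkNodes C k, ∀ j ∈ sinkNodes C k, 0 < x i → 0 < x j)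
    (hpair : ∀ k : Sink C, ∀ i ∈ sinkNodes C k, ∀ j ∈ sinkNodes C k, i ≠ j → x i + x j < 1)
    {v : Fin n → ℝ} (hv : v ∈ splitVariations C x) (hv0 : v ≠ 0) :
    diagForm (fun i => (1 - 2 * x i) / c i) (dfDeriv C x v) (dfDeriv C x v) <
      diagForm (fun i => (1 - 2 * x i) / c i) v v := by
  obtain ⟨hvs, hvk⟩ := hv
  set b : Fin n → ℝ := fun i => (1 - 2 * x i) * v i with hb
  set d : Fin n → ℝ := fun i => ∑ j, C j i * b j - b i with hd
  have hcx : ∀ i, c i = 0 → x i = 0 := fun i hi => hR i <| by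
    by_contra h
    exact ((hcp i).2 h).ne' hi
  have hJ : ∀ i, dfDeriv C x v i = v i + d i := fun i => by
    simp only [dfDeriv_apply, hd, hb]; ring
  have hcs := sum_sq_vecMul_div_le hC hc0 hc (v := b) fun i hi => by
    simp [hb, hvs i (hcx i hi)]
  have hid : diagForm (fun i => (1 - 2 * x i) / c i) (dfDeriv C x v) (dfDeriv C x v) -
      diagForm (fun i => (1 - 2 * x i) / c i) v v + ∑ i, 2 * x i * d i ^ 2 / c i =
      ∑ i, (∑ j, C j i * b j) ^ 2 / c i - ∑ i, b i ^ 2 / c i := by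
    simp only [diagForm, hJ]
    rw [← Finset.sum_sub_distrib, ← Finset.sum_sub_distrib, ← Finset.sum_add_distrib]
    refine Finset.sum_congr rfl fun i _ => ?_
    have h1 : ∑ j, C j i * b j = b i + d i := by simp only [hd]; ring
    rw [h1]
    by_cases hi : c i = 0
    · simp [hi]
    · simp only [hb]
      field_simp
      ring
  have hterm : ∀ i ∈ Finset.univ, 0 ≤ 2 * x i * d i ^ 2 / c i := fun i _ => by
    have := hx.1 i
    have := hc0 i
    positivity
  have hDnn := Finset.sum_nonneg hterm
  refine lt_of_le_of_ne (by linarith) fun heq => hv0 ?_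
  have hD0 : ∑ i, 2 * x i * d i ^ 2 / c i = 0 := le_antisymm (by linarith) hDnn
  have hd0 : ∀ i, 0 < x i → d i = 0 := by
    intro i hi
    have h1 := (Finset.sum_eq_zero_iff_of_nonneg hterm).1 hD0 i (Finset.mem_univ i)
    rcases div_eq_zero_iff.1 h1 with h2 | h2
    · rcases mul_eq_zero.1 h2 with h3 | h3
      · linarith
      · exact pow_eq_zero_iff two_ne_zero |>.1 h3
    · exact absurd (hcx i h2) hi.ne'
  have hb0 : ∀ i, x i = 0 → b i = 0 := fun i hi => by simp [hb, hvs i hi]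
  have hbst : b ᵥ* C = b := by
    rw [vecMul_eq_iff]
    intro j
    have h1 : ∑ i, b i * C i j = b j + d j := by
      simp only [hd, mul_comm (b _) (C _ j)]; ring
    rw [h1]
    rcases (hx.1 j).eq_or_lt with hj | hj
    · rw [← h1, hb0 j hj.symm]
      refine Finset.sum_eq_zero fun i _ => ?_
      rcases (hx.1 i).eq_or_lt with hi | hi
      · rw [hb0 i hi.symm, zero_mul]
      · have hir : ¬ IsReducibleNode C i := fun h => hi.ne' (hR i h)
        obtain ⟨k, hk⟩ := not_isReducibleNode.1 hir
        rw [hC.sink_out hk fun hjk => (hsupp k i hk j hjk hi).ne hj, mul_zero]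
    · rw [hd0 j hj, add_zero]
  ext i
  rcases (hx.1 i).eq_or_lt with hi | hi
  · exact hvs i hi.symm
  have hir : ¬ IsReducibleNode C i := fun h => hi.ne' (hR i h)
  obtain ⟨k, hik⟩ := not_isReducibleNode.1 hir
  obtain ⟨ck, hck, -⟩ := existsUnique_isSinkCentrality hC k
  obtain ⟨l, hl⟩ := hck.exists_eq_mul_of_stationary hC hbst fun a ha => hb0 a (hR a ha)
  obtain ⟨α, hα⟩ := hck.exists_eq_mul_of_stationary hC (dfMap_eq_self_iff.1 hfix)
    fun a ha => by rw [hR a ha]; ring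
  have hxk : ∀ j ∈ sinkNodes C k, 0 < x j := fun j hj => hsupp k i hik j hj hi
  have hα0 : α ≠ 0 := by
    rintro rfl
    obtain ⟨j, hj, hji, -⟩ := hC.exists_pos_sink hik
    have h1 := hpair k i hik j hj hji.symm
    have h2 := hxk j hj
    have h3 := hα i hik
    nlinarith
  refine eq_zero_of_logistic_variation (T := sinkNodes C k) (x := x) (μ := l / α) hxk
    (sinkPower_le_one hx k) (hpair k) (fun j hj => ?_) (hvk k) i hik
  rw [hα j hj]
  have h1 : (1 - 2 * x j) * v j = l * ck j := hl j hj
  rw [h1]; field_simp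

/-- Exponential convergence to a split equilibrium without full stars, when no two-node sink has
all the power. -/
lemma exists_geometric_bound (hC : IsRelativeInteraction C) {x₀ : Fin n → ℝ}
    (hx₀ : x₀ ∈ stdSimplex ℝ (Fin n)) (h1 : ∀ i, x₀ i ≠ 1) {ζ : Sink C → ℝ}
    (hζ : ∀ t k, sinkPower C ((dfMap C)^[t] x₀) k ≤ ζ k ∧
        ζ k - sinkPower C ((dfMap C)^[t] x₀) k ≤ reducibleMass C ((dfMap C)^[t] x₀))
    (h2 : ∀ k, (sinkNodes C k).card = 2 → ζ k < 1) (hns : ∀ k, ¬ IsFullStar C ζ k)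
    {x : Fin n → ℝ} (hx : IsSplitEquilibrium C ζ x)
    (hlim : Filter.Tendsto (fun t : ℕ => (dfMap C)^[t] x₀) Filter.atTop (𝓝 x)) :
    ∃ A : ℝ, ∃ r ∈ Set.Ioo (0 : ℝ) 1, ∀ t : ℕ, ‖(dfMap C)^[t] x₀ - x‖ ≤ A * r ^ t := by
  obtain ⟨c, hc0, hcp, hc⟩ := exists_stationary_pos_iff hC
  obtain ⟨A, r, hA, hr0, hr1, hm⟩ := exists_reducibleMass_le hC hx₀ h1
  have hmem := iterate_mem_stdSimplex hC hx₀
  set X : ℕ → Fin n → ℝ := fun t => (dfMap C)^[t] x₀ with hX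
  have hsucc : ∀ t, X (t + 1) = dfMap C (X t) := fun t => Function.iterate_succ_apply' _ _ _
  -- Excluding full stars leaves each sink either without power or positive at every node.
  have hcases : ∀ k : Sink C, (∀ i ∈ sinkNodes C k, x i = 0) ∨
      (ζ k ≠ 0 ∧ ∀ i ∈ sinkNodes C k, 0 < x i) := by
    intro k
    have hζ0 : 0 ≤ ζ k := hx.power k ▸ sinkPower_nonneg hx.mem_simplex.1 k
    rcases hζ0.eq_or_lt with h0 | h0
    · left
      intro i hi
      exact eq_zero_of_sinkPower_eq_zero hx.mem_simplex.1 ((hx.power k).trans h0.symm) hi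
    · refine Or.inr ⟨h0.ne', fun i hi => ?_⟩
      rcases (hC.two_le_card k).eq_or_lt with hk | hk
      · rw [hx.pair k hk.symm (h2 k hk.symm) i hi]; linarith
      · exact hx.pos k hk h0 (hns k) i hi
  have hsupp : ∀ k : Sink C, ∀ i ∈ sinkNodes C k, ∀ j ∈ sinkNodes C k, 0 < x i → 0 < x j := by
    intro k i hi j hj hxi
    rcases hcases k with h | h
    · exact absurd (h i hi) hxi.ne'
    · exact h.2 j hj
  have hpair : ∀ k : Sink C, ∀ i ∈ sinkNodes C k, ∀ j ∈ sinkNodes C k, i ≠ j →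
      x i + x j < 1 := by
    intro k i hi j hj hij
    rcases hcases k with h | h
    · rw [h i hi, h j hj]; norm_num
    · rcases (hC.two_le_card k).eq_or_lt with hk | hk
      · rw [hx.pair k hk.symm (h2 k hk.symm) i hi, hx.pair k hk.symm (h2 k hk.symm) j hj]
        linarith [h2 k hk.symm]
      · exact add_lt_one_of_pos hx.mem_simplex hk h.2 hij
  choose ck hck using fun k => (existsUnique_isSinkCentrality hC k).exists
  have hckk : ∀ k l i, i ∈ sinkNodes C k → l ≠ k → ck l i = 0 := fun k l i hi hl =>
    (hck l).eq_zero fun h => hl (sink_eq h hi)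
  classical
  -- The part of the error outside `splitVariations`: entries where the limit vanishes, and the
  -- deficit of each sink spread along its centrality. It is bounded by the reducible mass.
  set s : ℕ → Fin n → ℝ := fun t i =>
    if x i = 0 then X t i else ∑ k, (sinkPower C (X t) k - ζ k) * ck k i with hs
  have hσ : ∀ t k i, i ∈ sinkNodes C k →
      ∑ l, (sinkPower C (X t) l - ζ l) * ck l i = (sinkPower C (X t) k - ζ k) * ck k i :=
    fun t k i hi => Finset.sum_eq_single k
      (fun l _ hl => by rw [hckk k l i hi hl, mul_zero]) (by simp)
  have hsn : ∀ t, ‖s t‖ ≤ A * r ^ t := by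
    intro t
    refine le_trans ?_ (hm t)
    have hm0 : 0 ≤ reducibleMass C (X t) := reducibleMass_nonneg (hmem t).1
    refine (pi_norm_le_iff_of_nonneg hm0).2 fun i => ?_
    rw [Real.norm_eq_abs]
    by_cases hxi : x i = 0
    · simp only [hs, if_pos hxi]
      rw [abs_of_nonneg ((hmem t).1 i)]
      by_cases hir : IsReducibleNode C i
      · exact le_reducibleMass (hmem t).1 hir
      · obtain ⟨k, hk⟩ := not_isReducibleNode.1 hir
        rcases hcases k with h | h
        · have h3 : ζ k = 0 := by rw [← hx.power k]; exact Finset.sum_eq_zero h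
          have h4 := le_sinkPower (hmem t).1 hk
          have h5 := (hζ t k).1
          exact (h4.trans (h5.trans_eq h3)).trans hm0
        · exact absurd hxi (h.2 i hk).ne'
    · simp only [hs, if_neg hxi]
      have hir : ¬ IsReducibleNode C i := fun h => hxi (hx.reducible i h)
      obtain ⟨k, hk⟩ := not_isReducibleNode.1 hir
      rw [hσ t k i hk, abs_mul, abs_of_nonneg ((hck k).1.1 i), abs_sub_comm,
        abs_of_nonneg (sub_nonneg.2 (hζ t k).1)]
      exact (mul_le_of_le_one_right (sub_nonneg.2 (hζ t k).1)
        (stdSimplex_le_one (hck k).1 i)).trans (hζ t k).2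
  have hU : ∀ t, (X t - x) - s t ∈ splitVariations C x := by
    intro t
    refine ⟨fun i hi => by simp [hs, hi], fun k => ?_⟩
    rcases hcases k with h | h
    · exact Finset.sum_eq_zero fun i hi => by simp [hs, h i hi]
    · have h3 : ∀ i ∈ sinkNodes C k, ((X t - x) - s t) i =
          X t i - x i - (sinkPower C (X t) k - ζ k) * ck k i := fun i hi => by
        simp only [Pi.sub_apply, hs, if_neg (h.2 i hi).ne', hσ t k i hi]
      rw [sinkPower, Finset.sum_congr rfl h3, Finset.sum_sub_distrib, Finset.sum_sub_distrib,
        ← Finset.mul_sum, (hck k).sum_sink, mul_one]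
      have h4 := hx.power k
      unfold sinkPower at h4 ⊢
      rw [h4]; ring
  obtain ⟨B, ρ, hρ0, hρ1, hB⟩ := exists_geometric_bound_of_linearization (dfDeriv C x)
    (splitVariations C x) (fun i => (1 - 2 * x i) / c i)
    (fun v hv hv0 => diagForm_dfDeriv_lt hC hc0 hcp hc hx.mem_simplex hx.fixed hx.reducible hsupp
      hpair hv hv0)
    (e := fun t => X t - x) (s := s)
    (g := fun t j => (X t j - x j) ^ 2 - ∑ i, C i j * (X t i - x i) ^ 2)
    (L := (n : ℝ) + 1) (A := A) (r := r) (by positivity) hA hr0 hr1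
    (fun t => by
      refine (pi_norm_le_iff_of_nonneg zero_le_one).2 fun i => ?_
      have h3 := (hmem t).1 i
      have h4 := stdSimplex_le_one (hmem t) i
      have h5 := hx.mem_simplex.1 i
      have h6 := stdSimplex_le_one hx.mem_simplex i
      change 0 ≤ X t i at h3
      change X t i ≤ 1 at h4
      rw [Real.norm_eq_abs, Pi.sub_apply, abs_le]
      constructor <;> linarith)
    (by simpa using hlim.sub_const x)
    (fun t => by
      rw [hsucc, ← dfMap_sub, hx.fixed])
    (fun t => norm_dfMap_remainder_le hC (X t - x))
    hU hsn
  exact ⟨B, ρ, ⟨hρ0, hρ1⟩, hB⟩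

end Linearization

/-! ### Existence of an equilibrium for every split -/

section Existence

variable {n : ℕ} {C : Matrix (Fin n) (Fin n) ℝ}

/-- Existence comes from the dynamics: the centralities mixed according to `ζ` carry no reducible
mass, so the sink powers stay equal to `ζ` and the limit of the orbit has this split. A two-node
sink with all the power is treated by an explicit point. -/
lemma exists_isSplitEquilibrium (hC : IsRelativeInteraction C) {ζ : Sink C → ℝ}
    (hζ : ζ ∈ stdSimplex ℝ (Sink C)) : ∃ x, IsSplitEquilibrium C ζ x := by
  by_cases hk : ∃ k, (sinkNodes C k).card = 2 ∧ ζ k = 1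
  · obtain ⟨k, hk2, hk1⟩ := hk
    obtain ⟨i, j, hij, hk⟩ := Finset.card_eq_two.1 hk2
    exact ⟨_, isSplitEquilibrium_pair hC hζ hk1 hij hk (α := 1 / 2) (by norm_num)⟩
  push Not at hk
  choose c hc using fun k => (existsUnique_isSinkCentrality hC k).exists
  set x : Fin n → ℝ := fun i => ∑ k, ζ k * c k i with hx
  have hxk : ∀ k, ∀ i ∈ sinkNodes C k, x i = ζ k * c k i := fun k i hi =>
    Finset.sum_eq_single k
      (fun l _ hl => by rw [(hc l).eq_zero fun h => hl (sink_eq h hi), mul_zero]) (by simp)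
  have hR : ∀ i, IsReducibleNode C i → x i = 0 := fun i hi =>
    Finset.sum_eq_zero fun k _ => by rw [(hc k).eq_zero (hi k), mul_zero]
  have hpow : ∀ k, sinkPower C x k = ζ k := fun k => by
    rw [sinkPower, Finset.sum_congr rfl (hxk k), ← Finset.mul_sum, (hc k).sum_sink, mul_one]
  have hmem : x ∈ stdSimplex ℝ (Fin n) := by
    refine ⟨fun i => Finset.sum_nonneg fun k _ => mul_nonneg (hζ.1 k) ((hc k).1.1 i), ?_⟩
    simp only [hx]
    rw [Finset.sum_comm]
    simp only [← Finset.mul_sum, (hc _).1.2, mul_one]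
    exact hζ.2
  have h1 : ∀ i, x i ≠ 1 := by
    intro i hi
    by_cases hr : IsReducibleNode C i
    · rw [hR i hr] at hi
      exact zero_ne_one hi
    · obtain ⟨k, hik⟩ := not_isReducibleNode.1 hr
      obtain ⟨j, hj, hji, -⟩ := hC.exists_pos_sink hik
      have h2 := stdSimplex_add_le_one (hc k).1 hji
      have h3 := (hc k).pos hj
      have h4 := (hc k).pos hik
      have h5 := stdSimplex_le_one hζ k
      rw [hxk k i hik] at hi
      nlinarith
  obtain ⟨p, hp, -⟩ := exists_tendsto_of_pair_lt_one hC hmem h1 (ζ := ζ)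
    (fun k => by
      simp only [iterate_sinkPower_eq hC hR, hpow]
      exact tendsto_const_nhds)
    (fun k hk2 => lt_of_le_of_ne (stdSimplex_le_one hζ k) (hk k hk2))
  exact ⟨p, hp⟩

lemma ne_one_of_not_mem_range {x : Fin n → ℝ} (hx : x ∈ stdSimplex ℝ (Fin n))
    (h : x ∉ Set.range (fun i : Fin n => (Pi.single i 1 : Fin n → ℝ))) (i : Fin n) : x i ≠ 1 :=
  fun hi => h ⟨i, (stdSimplex_eq_single hx hi).symm⟩

lemma dfMap_single (i : Fin n) :
    dfMap C (Pi.single i 1 : Fin n → ℝ) = Pi.single i 1 := by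
  ext j
  rw [dfMap_apply]
  by_cases hj : j = i
  · subst hj
    rw [Finset.sum_eq_zero]
    · simp
    · intro l _
      by_cases hl : l = j
      · simp [hl]
      · simp [hl]
  · rw [Finset.sum_eq_zero]
    · simp [hj]
    · intro l _
      by_cases hl : l = i
      · simp [hl]
      · simp [hl]

end Existence

/-! ### Assembly of the statement -/

theorem theorem4 {n : ℕ} (hn : 3 ≤ n) (C : Matrix (Fin n) (Fin n) ℝ)
    (hC : IsRelativeInteraction C) (hK : 2 ≤ Nat.card (Sink C)) :
    -- each sink has exactly one centrality vector
    (∀ k : Sink C, ∃! c : Fin n → ℝ, IsSinkCentrality C k c) ∧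
    -- (i) the equilibrium set
    {x : Fin n → ℝ | x ∈ stdSimplex ℝ (Fin n) ∧ dfMap C x = x} =
      Set.range (fun i : Fin n => (Pi.single i 1 : Fin n → ℝ)) ∪
        {x | ∃ ζ ∈ stdSimplex ℝ (Sink C), IsSplitEquilibrium C ζ x} ∧
    -- every split of the total power occurs
    (∀ ζ ∈ stdSimplex ℝ (Sink C), ∃ x, IsSplitEquilibrium C ζ x) ∧
    -- the equilibrium is determined by the split, unless a two-node sink has all the power
    (∀ ζ ∈ stdSimplex ℝ (Sink C), (∀ k, (sinkNodes C k).card = 2 → ζ k < 1) →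
      ∃! x, IsSplitEquilibrium C ζ x) ∧
    -- when a two-node sink has all the power, every division inside it is an equilibrium
    (∀ ζ ∈ stdSimplex ℝ (Sink C), ∀ k, ζ k = 1 → ∀ i j, i ≠ j → sinkNodes C k = {i, j} →
      ∀ α ∈ Set.Icc (0 : ℝ) 1,
        IsSplitEquilibrium C ζ (Pi.single i α + Pi.single j (1 - α))) ∧
    -- (ii) monotonicity of sink social power
    (∀ x₀ ∈ stdSimplex ℝ (Fin n), ∀ k : Sink C,
      (∀ t : ℕ, sinkPower C ((dfMap C)^[t] x₀) k ≤ sinkPower C ((dfMap C)^[t + 1] x₀) k) ∧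
      (sinkPower C x₀ k = 0 →
        (∀ i, IsReducibleNode C i → (∃ j ∈ sinkNodes C k, Reaches C i j) → x₀ i = 0) →
        (∀ t : ℕ, sinkPower C ((dfMap C)^[t] x₀) k = 0) ∧
        ∀ xlim : Fin n → ℝ,
          Filter.Tendsto (fun t : ℕ => (dfMap C)^[t] x₀) Filter.atTop (𝓝 xlim) →
          sinkPower C xlim k = 0)) ∧
    -- (iii) convergence of self-weights
    (∀ x₀ ∈ stdSimplex ℝ (Fin n),
      x₀ ∉ Set.range (fun i : Fin n => (Pi.single i 1 : Fin n → ℝ)) →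
      ∃ ζ ∈ stdSimplex ℝ (Sink C), ∃ x : Fin n → ℝ, IsSplitEquilibrium C ζ x ∧
        Filter.Tendsto (fun t : ℕ => (dfMap C)^[t] x₀) Filter.atTop (𝓝 x) ∧
        ((∀ k, ¬ IsFullStar C ζ k) →
          ∃ A : ℝ, ∃ r ∈ Set.Ioo (0 : ℝ) 1, ∀ t : ℕ,
            ‖(dfMap C)^[t] x₀ - x‖ ≤ A * r ^ t)) := by
  have hne := fun (x : Fin n → ℝ) (hx : x ∈ stdSimplex ℝ (Fin n)) =>
    ne_one_of_not_mem_range hx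
  refine ⟨existsUnique_isSinkCentrality hC, ?_, fun ζ hζ => exists_isSplitEquilibrium hC hζ,
    fun ζ hζ h2 => ?_, fun ζ hζ k hk1 i j hij hk α hα =>
      isSplitEquilibrium_pair hC hζ hk1 hij hk hα, fun x₀ hx₀ k => ⟨fun t => ?_, fun h0 hR => ?_⟩,
    fun x₀ hx₀ hv => ?_⟩
  · ext x
    constructor
    · rintro ⟨hx, hfix⟩
      by_cases hv : x ∈ Set.range (fun i : Fin n => (Pi.single i 1 : Fin n → ℝ))
      · exact Or.inl hv
      · exact Or.inr ⟨_, isSplitEquilibrium_of_fixed_of_ne_one hC hx hfix (hne x hx hv)⟩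
    · rintro (⟨i, rfl⟩ | ⟨ζ, -, hx⟩)
      · exact ⟨single_mem_stdSimplex ℝ i, dfMap_single i⟩
      · exact ⟨hx.mem_simplex, hx.fixed⟩
  · obtain ⟨x, hx⟩ := exists_isSplitEquilibrium hC hζ
    exact ⟨x, hx, fun y hy => hy.unique hC h2 hx⟩
  · exact sinkPower_iterate_monotone hC hx₀ k (Nat.le_succ t)
  · have hz : ∀ t : ℕ, sinkPower C ((dfMap C)^[t] x₀) k = 0 := fun t =>
      Finset.sum_eq_zero fun i hi => iterate_eq_zero_of_reaches hC
        (eq_zero_of_reaches_sink hx₀.1 h0 hR) t i ⟨i, hi, Relation.ReflTransGen.refl⟩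
    refine ⟨hz, fun xlim hlim => ?_⟩
    refine tendsto_nhds_unique (((continuous_sinkPower k).tendsto xlim).comp hlim) ?_
    exact tendsto_const_nhds.congr fun t => (hz t).symm
  · have h1 := hne x₀ hx₀ hv
    obtain ⟨ζ, hζ, hlim, hle⟩ := exists_tendsto_sinkPower hC hx₀ h1
    refine ⟨ζ, hζ, ?_⟩
    -- In the first case the limit is not isolated among equilibria, and the Cauchy argument gives
    -- convergence and rate together.
    by_cases hk : ∃ k, (sinkNodes C k).card = 2 ∧ ζ k = 1
    · obtain ⟨k, hk2, hk1⟩ := hk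
      obtain ⟨p, hp, hpl, hexp⟩ := exists_tendsto_of_pair_eq_one hC hx₀ h1 hlim
        (fun t k => (hle t k).2) hk2 hk1
      exact ⟨p, hp, hpl, fun _ => hexp⟩
    · push Not at hk
      have h2 : ∀ k, (sinkNodes C k).card = 2 → ζ k < 1 := fun k hk2 =>
        lt_of_le_of_ne (stdSimplex_le_one hζ k) (hk k hk2)
      obtain ⟨p, hp, hpl⟩ := exists_tendsto_of_pair_lt_one hC hx₀ h1 hlim h2
      exact ⟨p, hp, hpl, fun hns => exists_geometric_bound hC hx₀ h1 hle h2 hns hp hpl⟩
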